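/- For real parameters $\alpha,\beta$ let $\mathcal F_{\alpha\beta}$ be the equation $u_t+xu_y=|x-\alpha|^\beta u_{xx}$ for $u=u(t,x,y)$, considered at points where $|x-\alpha|^\beta\neq0$ (i.e. $x\ne\alpha$ if $\beta\neq0$, all points if $\beta=0$). Let $\mathcal F$ be the class of all $\mathcal F_{\alpha\beta}$ and $\mathcal F'$ its subclass of the equations $\mathcal F'_\beta:=\mathcal F_{0\beta}$. For a nonempty connected open set $\Omega\subset\mathbb R^3_{t,x,y}$, let $\mathfrak g_{\alpha\beta}=\mathfrak g_{\alpha\beta}(\Omega)$ be the maximal Lie invariance algebra of $\mathcal F_{\alpha\beta}$ over $\Omega$: the space of smooth vector fields $Q=\tau\partial_t+\xi^x\partial_x+\xi^y\partial_y+\eta\partial_u$ on $\Omega\times\mathbb R_u$ whose second prolongation annihilates $u_t+xu_y-|x-\alpha|^\beta u_{xx}$ on the solution manifold of $\mathcal F_{\alpha\beta}$ in the second-order jet space, over the points of $\Omega$ with $|x-\alpha|^\beta\ne0$. The kernel Lie invariance algebras are $\mathfrak g^\cap_{\mathcal F}:=\bigcap_{\alpha,\beta}\mathfrak g_{\alpha\beta}$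 and $\mathfrak g^\cap_{\mathcal F'}:=\bigcap_{\beta}\mathfrak g_{0\beta}$. Put $\mathcal P^t:=\partial_t$, $\mathcal P^y:=\partial_y$, $\mathcal I:=u\partial_u$, $\mathcal D^{\alpha\beta}:=(2-\beta)t\partial_t+(x-\alpha)\partial_x+\big((3-\beta)y-\alpha t\big)\partial_y$, $\mathcal Z(f):=f(t,x,y)\partial_u$. Say that $\Omega$ is regular for $\mathcal F_{\alpha\beta}$ if $|x-\alpha|^\beta\neq0$ on $\Omega$, and then let $$\mathfrak g^{\rm gen}_{\alpha\beta}:=\langle\mathcal P^t,\mathcal P^y,\mathcal I,\mathcal D^{\alpha\beta},\mathcal Z(f)\rangle,$$ where $f$ runs through the smooth solutions of $\mathcal F_{\alpha\beta}$ on $\Omega$. The equation $\mathcal F_{\alpha\beta}$ is a case of essential Lie symmetry extension if $\mathfrak g^{\rm gen}_{\alpha\beta}\subsetneq\mathfrak g_{\alpha\beta}$. Two equations of $\mathcal F$ are $\mathcal G^\sim_{\mathcal F}$-equivalent if a (local) point transformation of the variables $(t,x,y,u)$, i.e. a smooth diffeomorphism between nonempty open subsets of $\mathbb R^4$, maps one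 to the other. They are $G^\sim_{\mathcal F}$-equivalent if one is mapped to the other by an element of the (usual) equivalence group of $\mathcal F$, i.e. by a point transformation of $(t,x,y,u)$ together with an invertible smooth transformation $(\alpha,\beta)\mapsto(\tilde\alpha,\tilde\beta)$ of the parameters such that the former maps $\mathcal F_{\alpha\beta}$ to $\mathcal F_{\tilde\alpha\tilde\beta}$ for all $(\alpha,\beta)$. Then: 1. For every nonempty connected open $\Omega$, $\mathfrak g^\cap_{\mathcal F}=\mathfrak g^\cap_{\mathcal F'}=\langle\partial_t,\partial_y,u\partial_u,(tx-y)\partial_u,x\partial_u,\partial_u\rangle$. 2. For all $\alpha,\beta$ and every $\Omega$ regular for $\mathcal F_{\alpha\beta}$, $\mathfrak g^{\rm gen}_{\alpha\beta}\subseteq\mathfrak g_{\alpha\beta}$. 3. Every equation of $\mathcal F$ is $\mathcal G^\sim_{\mathcal F}$-equivalent to some $\mathcal F_{\tilde\alpha\tilde\beta}$ with $\tilde\beta\le 5/2$. 4. A complete list of $\mathcal G^\sim_{\mathcal F}$-inequivalent cases of essential Lie symmetry extension in $\mathcal F$ is $\mathcal F_{00}$, $\mathcal F_{02}$: these two equations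 are such cases (over every regular $\Omega$), they are not $\mathcal G^\sim_{\mathcal F}$-equivalent to each other, and every equation of $\mathcal F$ that is such a case (over some regular $\Omega$) is $\mathcal G^\sim_{\mathcal F}$-equivalent to one of them. Moreover, over every regular $\Omega$, $$\mathfrak g_{02}=\mathfrak g^{\rm gen}_{02}\dotplus\langle 2xy\partial_x+y^2\partial_y-xu\partial_u\rangle,$$ $$\mathfrak g_{00}=\mathfrak g^{\rm gen}_{00}\dotplus\langle\mathcal K_0,\mathcal P^3,\mathcal P^2,\mathcal P^1\rangle,$$ where $\mathcal K_0=t^2\partial_t+(tx+3y)\partial_x+3ty\partial_y-(x^2+2t)u\partial_u$, $\mathcal P^3=3t^2\partial_x+t^3\partial_y+3(y-tx)u\partial_u$, $\mathcal P^2=2t\partial_x+t^2\partial_y-xu\partial_u$, $\mathcal P^1=\partial_x+t\partial_y$. 5. In the same sense, a complete list of $G^\sim_{\mathcal F}$-inequivalent cases of essential Lie symmetry extension in $\mathcal F$ is $\mathcal F_{00}$, $\mathcal F_{02}$, $\mathcal F_{03}$, $\mathcal F_{05}$. -/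

import Mathlib

open Set Filter Topology
open scoped ContDiff

/-- The space of independent variables `(t, x, y)`. -/
abbrev Base := ℝ × ℝ × ℝ

/-- The space of independent and dependent variables `((t, x, y), u)`. -/
abbrev VarSpace := Base × ℝ

/-- The arbitrary elements `θ = (α, β)` of the class `𝓕`. -/
abbrev Param := ℝ × ℝ

/-- The partial derivative with respect to `t`. -/
noncomputable def pt (f : Base → ℝ) (p : Base) : ℝ := fderiv ℝ f p (1, 0, 0)

/-- The partial derivative with respect to `x`. -/
noncomputable def px (f : Base → ℝ) (p : Base) : ℝ := fderiv ℝ f p (0, 1, 0)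

/-- The partial derivative with respect to `y`. -/
noncomputable def py (f : Base → ℝ) (p : Base) : ℝ := fderiv ℝ f p (0, 0, 1)

/-- The diffusivity `|x - α| ^ β`. -/
noncomputable def diffusivity (θ : Param) (p : Base) : ℝ := |p.2.1 - θ.1| ^ θ.2

/-- Regular points of the equation: the diffusivity is nonzero there. As `0 ^ β = 0` for real
`β ≠ 0` and `0 ^ 0 = 1`, these are all points with `x ≠ α` if `β ≠ 0`, and all points if `β = 0`. -/
def Regular (θ : Param) (p : Base) : Prop := diffusivity θ p ≠ 0

/-- The equation `𝓕_{αβ} : u_t + x u_y = |x - α| ^ β u_xx`, as `eqResidual θ u = 0`.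
The equation `𝓕'_β : u_t + x u_y = |x| ^ β u_xx` is the one with `θ = (0, β)`. -/
noncomputable def eqResidual (θ : Param) (u : Base → ℝ) (p : Base) : ℝ :=
  pt u p + p.2.1 * py u p - diffusivity θ p * px (px u) p

/-! ### Lie symmetries

A vector field `τ ∂_t + ξˣ ∂_x + ξʸ ∂_y + η ∂_u` is a map `v : VarSpace → VarSpace` with value
`((τ, ξˣ, ξʸ), η)`. -/

/-- The characteristic `Q[u] = η - τ u_t - ξˣ u_x - ξʸ u_y`, evaluated on a function `u`. -/
noncomputable def characteristic (v : VarSpace → VarSpace) (u : Base → ℝ) (p : Base) : ℝ :=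
  (v (p, u p)).2 - fderiv ℝ u p (v (p, u p)).1

/-- `η^t = D_t Q[u] + τ u_tt + ξˣ u_tx + ξʸ u_ty`. -/
noncomputable def etaT (v : VarSpace → VarSpace) (u : Base → ℝ) (p : Base) : ℝ :=
  pt (characteristic v u) p + fderiv ℝ (pt u) p (v (p, u p)).1

/-- `η^y = D_y Q[u] + τ u_ty + ξˣ u_xy + ξʸ u_yy`. -/
noncomputable def etaY (v : VarSpace → VarSpace) (u : Base → ℝ) (p : Base) : ℝ :=
  py (characteristic v u) p + fderiv ℝ (py u) p (v (p, u p)).1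

/-- `η^xx = D_x² Q[u] + τ u_txx + ξˣ u_xxx + ξʸ u_xxy`. -/
noncomputable def etaXX (v : VarSpace → VarSpace) (u : Base → ℝ) (p : Base) : ℝ :=
  px (px (characteristic v u)) p + fderiv ℝ (px (px u)) p (v (p, u p)).1

/-- The second prolongation of `v` applied to `u_t + x u_y - |x - α| ^ β u_xx`, at the 2-jet of `u`
at the point `p`. -/
noncomputable def prolongedAction (θ : Param) (v : VarSpace → VarSpace) (u : Base → ℝ) (p : Base) : ℝ :=
  etaT v u p + p.2.1 * etaY v u p + (v (p, u p)).1.2.1 * py u p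
    - diffusivity θ p * etaXX v u p
    - (v (p, u p)).1.2.1 * px (diffusivity θ) p * px (px u) p

/-- The infinitesimal invariance criterion over the point `p`: the prolonged vector field annihilates
the equation at all 2-jets over `p` that satisfy it (every 2-jet is the jet of a smooth function). -/
def InvariantAt (θ : Param) (v : VarSpace → VarSpace) (p : Base) : Prop :=
  ∀ u : Base → ℝ, ContDiff ℝ ∞ u → eqResidual θ u p = 0 → prolongedAction θ v u p = 0

/-- The part of the space of all variables that lies over `Ω`. -/
def cylinder (Ω : TopologicalSpace.Opens Base) : Set VarSpace := {z | z.1 ∈ Ω}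

lemma contDiffAt_characteristic {Ω : TopologicalSpace.Opens Base} {v : VarSpace → VarSpace}
    (hv : ContDiffOn ℝ ∞ v (cylinder Ω)) {u : Base → ℝ} (hu : ContDiff ℝ ∞ u) {p : Base}
    (hp : p ∈ Ω) : ContDiffAt ℝ ∞ (characteristic v u) p := by
  have ho : IsOpen (cylinder Ω) := Ω.isOpen.preimage continuous_fst
  have h1 : ContDiffAt ℝ ∞ v (p, u p) := hv.contDiffAt (ho.mem_nhds hp)
  have h2 : ContDiffAt ℝ ∞ (fun q : Base => v (q, u q)) p :=
    ContDiffAt.comp p h1 (contDiffAt_id.prodMk hu.contDiffAt)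
  have h3 : ContDiffAt ℝ ∞ (fderiv ℝ u) p := (hu.fderiv_right le_rfl).contDiffAt
  exact h2.snd.sub (h3.clm_apply h2.fst)

lemma contDiffAt_fderiv_apply {f : Base → ℝ} {p : Base} (hf : ContDiffAt ℝ ∞ f p) (e : Base) :
    ContDiffAt ℝ ∞ (fun q => fderiv ℝ f q e) p :=
  (hf.fderiv_right le_rfl).clm_apply contDiffAt_const

lemma fderiv_lin {f g : Base → ℝ} {p : Base} (h1 : DifferentiableAt ℝ f p)
    (h2 : DifferentiableAt ℝ g p) (a b : ℝ) (e : Base) :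
    fderiv ℝ (fun q => a * f q + b * g q) p e = a * fderiv ℝ f p e + b * fderiv ℝ g p e := by
  rw [fderiv_fun_add (h1.const_mul a) (h2.const_mul b), fderiv_const_mul h1, fderiv_const_mul h2]
  simp

lemma px_px_lin {f g : Base → ℝ} {p : Base} (hf : ContDiffAt ℝ ∞ f p) (hg : ContDiffAt ℝ ∞ g p)
    (a b : ℝ) :
    px (px (fun q => a * f q + b * g q)) p = a * px (px f) p + b * px (px g) p := by
  have h : px (fun q => a * f q + b * g q) =ᶠ[𝓝 p] fun q => a * px f q + b * px g q := by
    have hf1 : ContDiffAt ℝ 1 f p := hf.of_le (by simp)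
    have hg1 : ContDiffAt ℝ 1 g p := hg.of_le (by simp)
    filter_upwards [hf1.eventually (by simp), hg1.eventually (by simp)] with q h1 h2
    exact fderiv_lin (h1.differentiableAt one_ne_zero) (h2.differentiableAt one_ne_zero) a b _
  unfold px at h ⊢
  rw [h.fderiv_eq]
  exact fderiv_lin ((contDiffAt_fderiv_apply hf _).differentiableAt (by simp))
    ((contDiffAt_fderiv_apply hg _).differentiableAt (by simp)) a b _

lemma prolongedAction_lin {Ω : TopologicalSpace.Opens Base} {v w : VarSpace → VarSpace}
    (hv : ContDiffOn ℝ ∞ v (cylinder Ω)) (hw : ContDiffOn ℝ ∞ w (cylinder Ω)) (a b : ℝ)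
    (θ : Param) {u : Base → ℝ} (hu : ContDiff ℝ ∞ u) {p : Base} (hp : p ∈ Ω) :
    prolongedAction θ (a • v + b • w) u p
      = a * prolongedAction θ v u p + b * prolongedAction θ w u p := by
  have hc : characteristic (a • v + b • w) u
      = fun q => a * characteristic v u q + b * characteristic w u q := by
    funext q
    simp only [characteristic, Pi.add_apply, Pi.smul_apply, Prod.snd_add, Prod.smul_snd,
      Prod.fst_add, Prod.smul_fst, map_add, map_smul, smul_eq_mul]
    ring
  have h1 := contDiffAt_characteristic hv hu hp
  have h2 := contDiffAt_characteristic hw hu hp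
  simp only [prolongedAction, etaT, etaY, etaXX, hc, px_px_lin h1 h2]
  unfold pt py
  have d1 := h1.differentiableAt (by simp)
  have d2 := h2.differentiableAt (by simp)
  rw [fderiv_lin d1 d2, fderiv_lin d1 d2]
  simp only [Pi.add_apply, Pi.smul_apply, Prod.snd_add, Prod.smul_snd,
      Prod.fst_add, Prod.smul_fst, map_add, map_smul, smul_eq_mul]
  ring

/-- The vector fields that are smooth on `Ω × ℝ` and satisfy the infinitesimal invariance criterion
over all regular points of the equation in `Ω` (with arbitrary values outside `Ω × ℝ`). -/
noncomputable def symmetryFields (θ : Param) (Ω : TopologicalSpace.Opens Base) :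
    Submodule ℝ (VarSpace → VarSpace) where
  carrier := {v | ContDiffOn ℝ ∞ v (cylinder Ω) ∧ ∀ p ∈ Ω, Regular θ p → InvariantAt θ v p}
  zero_mem' := by
    refine ⟨contDiffOn_const, fun p hp _ u hu _ => ?_⟩
    have h := prolongedAction_lin (Ω := Ω) (v := 0) (w := 0) contDiffOn_const contDiffOn_const
      0 0 θ hu hp
    simpa using h
  add_mem' := by
    rintro v w ⟨hv, hv'⟩ ⟨hw, hw'⟩
    refine ⟨hv.add hw, fun p hp hr u hu h0 => ?_⟩
    have h := prolongedAction_lin hv hw 1 1 θ hu hp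
    rw [hv' p hp hr u hu h0, hw' p hp hr u hu h0] at h
    simpa using h
  smul_mem' := by
    rintro c v ⟨hv, hv'⟩
    refine ⟨contDiffOn_const.smul hv, fun p hp hr u hu h0 => ?_⟩
    have h := prolongedAction_lin hv hv c 0 θ hu hp
    rw [hv' p hp hr u hu h0] at h
    simpa using h

/-- Restriction of vector fields to `Ω × ℝ`. -/
def restrictTo (Ω : TopologicalSpace.Opens Base) :
    (VarSpace → VarSpace) →ₗ[ℝ] (cylinder Ω → VarSpace) :=
  LinearMap.funLeft ℝ VarSpace (Subtype.val : cylinder Ω → VarSpace)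

/-- The maximal Lie invariance algebra of `𝓕_{αβ}` over `Ω`, consisting of vector fields on
`Ω × ℝ`. -/
noncomputable def maximalAlgebra (θ : Param) (Ω : TopologicalSpace.Opens Base) :
    Submodule ℝ (cylinder Ω → VarSpace) :=
  (symmetryFields θ Ω).map (restrictTo Ω)

/-- The span over `Ω` of a set of vector fields. -/
noncomputable def spanOver (Ω : TopologicalSpace.Opens Base) (S : Set (VarSpace → VarSpace)) :
    Submodule ℝ (cylinder Ω → VarSpace) :=
  (Submodule.span ℝ S).map (restrictTo Ω)

/-- The kernel Lie invariance algebra of the class `𝓕`. -/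
noncomputable def kernelAlgebraF (Ω : TopologicalSpace.Opens Base) :
    Submodule ℝ (cylinder Ω → VarSpace) :=
  ⨅ θ : Param, maximalAlgebra θ Ω

/-- The kernel Lie invariance algebra of the class `𝓕'`. -/
noncomputable def kernelAlgebraF' (Ω : TopologicalSpace.Opens Base) :
    Submodule ℝ (cylinder Ω → VarSpace) :=
  ⨅ β : ℝ, maximalAlgebra (0, β) Ω

/-! ### The vector fields -/

/-- `∂_t` -/
def fieldPt : VarSpace → VarSpace := fun _ => ((1, 0, 0), 0)

/-- `∂_y` -/
def fieldPy : VarSpace → VarSpace := fun _ => ((0, 0, 1), 0)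

/-- `u ∂_u` -/
def fieldI : VarSpace → VarSpace := fun ((_, _, _), u) => ((0, 0, 0), u)

/-- `(2 - β) t ∂_t + (x - α) ∂_x + ((3 - β) y - α t) ∂_y` -/
def fieldD (θ : Param) : VarSpace → VarSpace :=
  fun ((t, x, y), _) => (((2 - θ.2) * t, x - θ.1, (3 - θ.2) * y - θ.1 * t), 0)

/-- `f(t, x, y) ∂_u` -/
def fieldZ (f : Base → ℝ) : VarSpace → VarSpace := fun ((t, x, y), _) => ((0, 0, 0), f (t, x, y))

/-- `2 x y ∂_x + y² ∂_y - x u ∂_u` -/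
def fieldK2 : VarSpace → VarSpace :=
  fun ((_, x, y), u) => ((0, 2 * x * y, y ^ 2), -(x * u))

/-- `t² ∂_t + (t x + 3 y) ∂_x + 3 t y ∂_y - (x² + 2 t) u ∂_u` -/
def fieldK0 : VarSpace → VarSpace :=
  fun ((t, x, y), u) => ((t ^ 2, t * x + 3 * y, 3 * t * y), -((x ^ 2 + 2 * t) * u))

/-- `3 t² ∂_x + t³ ∂_y + 3 (y - t x) u ∂_u` -/
def fieldP3 : VarSpace → VarSpace :=
  fun ((t, x, y), u) => ((0, 3 * t ^ 2, t ^ 3), 3 * (y - t * x) * u)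

/-- `2 t ∂_x + t² ∂_y - x u ∂_u` -/
def fieldP2 : VarSpace → VarSpace :=
  fun ((t, x, _), u) => ((0, 2 * t, t ^ 2), -(x * u))

/-- `∂_x + t ∂_y` -/
def fieldP1 : VarSpace → VarSpace := fun ((t, _, _), _) => ((0, 1, t), 0)

/-- `f` is a smooth solution of `𝓕_{αβ}` on `Ω`. -/
def IsSolutionOn (θ : Param) (Ω : TopologicalSpace.Opens Base) (f : Base → ℝ) : Prop :=
  ContDiffOn ℝ ∞ f Ω ∧ ∀ p ∈ Ω, eqResidual θ f p = 0

/-- The algebra `⟨P^t, P^y, I, D^{αβ}, Z(f)⟩` over `Ω`, where `f` runs through the solutions of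
`𝓕_{αβ}` on `Ω`. -/
noncomputable def generalAlgebra (θ : Param) (Ω : TopologicalSpace.Opens Base) :
    Submodule ℝ (cylinder Ω → VarSpace) :=
  spanOver Ω ({fieldPt, fieldPy, fieldI, fieldD θ} ∪ {v | ∃ f, IsSolutionOn θ Ω f ∧ v = fieldZ f})

/-- Nonempty connected open sets of regular points of `𝓕_{αβ}`. -/
def IsRegularDomain (θ : Param) (Ω : TopologicalSpace.Opens Base) : Prop :=
  IsConnected (Ω : Set Base) ∧ ∀ p ∈ Ω, Regular θ p

/-- Over `Ω`, the equation `𝓕_{αβ}` is a case of essential Lie symmetry extension: its maximal Lie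
invariance algebra is strictly larger than the algebra common to all equations. -/
def HasExtension (θ : Param) (Ω : TopologicalSpace.Opens Base) : Prop :=
  generalAlgebra θ Ω < maximalAlgebra θ Ω

/-! ### Point equivalences -/

/-- (Local) point transformations in the space of `(t, x, y, u)`: diffeomorphisms between nonempty
open subsets. -/
def IsPointTransformation (Φ : OpenPartialHomeomorph VarSpace VarSpace) : Prop :=
  Φ.source.Nonempty ∧ ContDiffOn ℝ ∞ Φ Φ.source ∧ ContDiffOn ℝ ∞ Φ.symm Φ.target

/-- `Φ` maps the equation with parameters `θ` to the one with parameters `θ'`: whenever `Φ` maps the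
graph of `u` near `p` into the graph of `w`, the 2-jet of `u` at `p` satisfies the first equation if
and only if the 2-jet of `w` at the image point satisfies the second one. -/
def MapsEquation (Φ : OpenPartialHomeomorph VarSpace VarSpace) (θ θ' : Param) : Prop :=
  ∀ u w : Base → ℝ, ContDiff ℝ ∞ u → ContDiff ℝ ∞ w →
    ∀ p : Base, (p, u p) ∈ Φ.source → Regular θ p → Regular θ' (Φ (p, u p)).1 →
      (∀ᶠ q in 𝓝 p, w (Φ (q, u q)).1 = (Φ (q, u q)).2) →
      (eqResidual θ u p = 0 ↔ eqResidual θ' w (Φ (p, u p)).1 = 0)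

/-- Equivalence with respect to the equivalence groupoid of `𝓕`: there is an admissible
transformation between the two equations. -/
def GroupoidEquivalent (θ θ' : Param) : Prop :=
  ∃ Φ : OpenPartialHomeomorph VarSpace VarSpace, IsPointTransformation Φ ∧ MapsEquation Φ θ θ'

/-- Elements of the (usual) equivalence group of `𝓕`: a point transformation `Φ` of the variables
together with an invertible smooth transformation `Ψ` of the arbitrary elements such that `Φ` maps
every equation of the class, with parameters `θ`, to the equation with parameters `Ψ θ`. -/
def IsEquivalenceTransformation (Φ : OpenPartialHomeomorph VarSpace VarSpace) (Ψ : Param ≃ Param) :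
    Prop :=
  IsPointTransformation Φ ∧ ContDiff ℝ ∞ Ψ ∧ ContDiff ℝ ∞ Ψ.symm ∧ ∀ θ, MapsEquation Φ θ (Ψ θ)

/-- Equivalence with respect to the equivalence group of `𝓕`. -/
def GroupEquivalent (θ θ' : Param) : Prop :=
  ∃ (Φ : OpenPartialHomeomorph VarSpace VarSpace) (Ψ : Param ≃ Param),
    IsEquivalenceTransformation Φ Ψ ∧ Ψ θ = θ'

/-- `L` is a complete list of `R`-inequivalent cases of essential Lie symmetry extension. -/
def IsCompleteExtensionList (R : Param → Param → Prop) (L : Set Param) : Prop :=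
  (∀ θ ∈ L, ∀ Ω, IsRegularDomain θ Ω → HasExtension θ Ω) ∧
  (∀ θ Ω, IsRegularDomain θ Ω → HasExtension θ Ω → ∃ θ' ∈ L, R θ θ') ∧
  L.Pairwise fun θ θ' => ¬ R θ θ'

/-! Infinitesimal part. Splitting the invariance criterion with respect to the free jet coordinates
gives τ = τ(t,y), ξʸ = ζ(t,y), ξˣ = ζ_t + xζ_y − x(τ_t + xτ_y), with η affine in u (`Determining`).
The remaining equation for ξˣ, multiplied by x − α, involves the diffusivity A only through (x −
α)A' = βA, so it becomes a quadratic polynomial in x − α whose coefficients depend on (t,y) alone.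
Its three coefficients are the classifying equations (`symmetry_classifying`): (β − 5)τ_y = 0, a
relation between ζ_y and τ_t, and one that disappears for β = 0. A symmetry with τ = ζ = 0 is c·u∂_u
+ f∂_u with f a solution (`restrictTo_mem_general`), so an algebra is known once all pairs (τ, ζ)
are known. For β outside {0, 2, 3, 5} the classifying equations leave only translations and
`fieldD`. For β = 0 and β = 2 the conditions on η_u cut (τ, ζ) down to explicit polynomials. For β =
3 and β = 5 one explicit extra field is enough. The kernel is found from the two equations β = 0 and
β = 1 with α = 0.

Equivalences. Shifting x together with y ↦ y − at moves α to 0 for all equations at once. The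
inversion (t, x, y, u) ↦ (y − αt, 1/(x − α), t, u/(x − α)) sends (α, β) to (0, 5 − β); hence β ≤ 5/2
can be achieved, and 3 and 5 reduce to 2 and 0. Its centre depends on α, so it is only a groupoid
element.

Inequivalence. Let Φ = (T, X, Y, U) be an admissible transformation. Applying it to quadratic
polynomials whose 2-jets satisfy the equation (`jet_condition`) shows that T and Y depend on (t,y)
only (`projectable`), that X = (Y_t + xY_y)/(T_t + xT_y), and that the two diffusivities are related
by A'(T_t + xT_y) = A·X_x² (`coefficient_conditions`). The logarithmic x-derivative of the last
relation is again a quadratic polynomial identity in x − α (`admissible_conditions`). It excludes a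
map between β = 0 and β = 2. A transformation that changes β must have T_y ≠ 0, and then β = 1
forces T_t + αT_y = 0. A single Φ cannot satisfy this for two values of α, which separates all four
cases under the equivalence group. -/

/-! ### Directional derivatives -/

/-- The derivative of `f` in the direction `e`. -/
noncomputable def dd {E : Type*} [NormedAddCommGroup E] [NormedSpace ℝ E] (e : E) (f : E → ℝ)
    (z : E) : ℝ := fderiv ℝ f z e

section DirectionalDerivative

variable {E : Type*} [NormedAddCommGroup E] [NormedSpace ℝ E] {f g : E → ℝ} {z : E}

lemma dd_eq_fderiv (e : E) (f : E → ℝ) (z : E) : dd e f z = fderiv ℝ f z e := rfl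

lemma ContDiffAt.diffAt {F : Type*} [NormedAddCommGroup F] [NormedSpace ℝ F] {f : E → F}
    (hf : ContDiffAt ℝ ∞ f z) : DifferentiableAt ℝ f z :=
  hf.differentiableAt (by simp)

lemma ContDiffAt.two {F : Type*} [NormedAddCommGroup F] [NormedSpace ℝ F] {f : E → F}
    (hf : ContDiffAt ℝ ∞ f z) : ContDiffAt ℝ 2 f z :=
  hf.of_le (WithTop.coe_le_coe.mpr (OrderTop.le_top (2 : ℕ∞)))

lemma ContDiffAt.eventually_smooth {F : Type*} [NormedAddCommGroup F] [NormedSpace ℝ F] {f : E → F}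
    (hf : ContDiffAt ℝ 2 f z) : ∀ᶠ w in 𝓝 z, ContDiffAt ℝ 2 f w :=
  hf.eventually (by simp)

lemma ContDiffAt.dd (hf : ContDiffAt ℝ ∞ f z) (e : E) : ContDiffAt ℝ ∞ (dd e f) z :=
  (hf.fderiv_right le_rfl).clm_apply contDiffAt_const

lemma ContDiff.dd (hf : ContDiff ℝ ∞ f) (e : E) : ContDiff ℝ ∞ (dd e f) :=
  (hf.fderiv_right le_rfl).clm_apply contDiff_const

lemma dd_congr (h : f =ᶠ[𝓝 z] g) (e : E) : dd e f z = dd e g z := by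
  simp only [dd, h.fderiv_eq]

lemma dd_congr_eventually (h : f =ᶠ[𝓝 z] g) (e : E) : dd e f =ᶠ[𝓝 z] dd e g := by
  filter_upwards [h.eventuallyEq_nhds] with w hw using dd_congr hw e

lemma dd_add (hf : DifferentiableAt ℝ f z) (hg : DifferentiableAt ℝ g z) (e : E) :
    dd e (fun w => f w + g w) z = dd e f z + dd e g z := by
  simp [dd, fderiv_fun_add hf hg]

lemma dd_sub (hf : DifferentiableAt ℝ f z) (hg : DifferentiableAt ℝ g z) (e : E) :
    dd e (fun w => f w - g w) z = dd e f z - dd e g z := by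
  simp [dd, fderiv_fun_sub hf hg]

lemma dd_mul (hf : DifferentiableAt ℝ f z) (hg : DifferentiableAt ℝ g z) (e : E) :
    dd e (fun w => f w * g w) z = dd e f z * g z + f z * dd e g z := by
  simp [dd, fderiv_fun_mul hf hg]; ring

lemma dd_const_mul (hf : DifferentiableAt ℝ f z) (c : ℝ) (e : E) :
    dd e (fun w => c * f w) z = c * dd e f z := by
  simp [dd, fderiv_const_mul hf]

lemma dd_const (c : ℝ) (e : E) : dd e (fun _ => c) z = 0 := by simp [dd]

lemma dd_comm (hf : ContDiffAt ℝ 2 f z) (e e' : E) : dd e (dd e' f) z = dd e' (dd e f) z := by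
  have h := hf.isSymmSndFDerivAt (by simp)
  have hd : DifferentiableAt ℝ (fderiv ℝ f) z :=
    (hf.fderiv_right (m := 1) (by norm_num)).differentiableAt (by simp)
  have key : ∀ a b : E, dd a (dd b f) z = fderiv ℝ (fderiv ℝ f) z a b := by
    intro a b
    unfold dd
    rw [fderiv_clm_apply hd (differentiableAt_const b)]
    simp
  rw [key, key]
  exact h e e'

/-- The second derivative of a product in one direction. -/
lemma dd_dd_mul (hf : ContDiffAt ℝ ∞ f z) (hg : ContDiffAt ℝ ∞ g z) (e : E) :
    dd e (dd e (fun w => f w * g w)) z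
      = dd e (dd e f) z * g z + 2 * dd e f z * dd e g z + f z * dd e (dd e g) z := by
  have h : dd e (fun w => f w * g w) =ᶠ[𝓝 z] fun w => dd e f w * g w + f w * dd e g w := by
    filter_upwards [hf.two.eventually_smooth,
      hg.two.eventually_smooth] with w h1 h2
    exact dd_mul (h1.differentiableAt (by simp)) (h2.differentiableAt (by simp)) e
  rw [dd_congr h, dd_add ((hf.dd e).mul hg).diffAt (hf.mul (hg.dd e)).diffAt,
    dd_mul (hf.dd e).diffAt hg.diffAt, dd_mul hf.diffAt (hg.dd e).diffAt]
  ring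

lemma dd_dd_sub (hf : ContDiffAt ℝ ∞ f z) (hg : ContDiffAt ℝ ∞ g z) (e : E) :
    dd e (dd e (fun w => f w - g w)) z = dd e (dd e f) z - dd e (dd e g) z := by
  have h : dd e (fun w => f w - g w) =ᶠ[𝓝 z] fun w => dd e f w - dd e g w := by
    filter_upwards [hf.two.eventually_smooth,
      hg.two.eventually_smooth] with w h1 h2
    exact dd_sub (h1.differentiableAt (by simp)) (h2.differentiableAt (by simp)) e
  rw [dd_congr h, dd_sub (hf.dd e).diffAt (hg.dd e).diffAt]

end DirectionalDerivative

/-! ### The second prolongation in coordinates -/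

/-- The coordinate vector of `t` in the space of all variables. -/
def vt : VarSpace := ((1, 0, 0), 0)

/-- The coordinate vector of `x` in the space of all variables. -/
def vx : VarSpace := ((0, 1, 0), 0)

/-- The coordinate vector of `y` in the space of all variables. -/
def vy : VarSpace := ((0, 0, 1), 0)

/-- The coordinate vector of `u` in the space of all variables. -/
def vu : VarSpace := ((0, 0, 0), 1)

/-- The component `τ` of a vector field. -/
def tauC (v : VarSpace → VarSpace) (z : VarSpace) : ℝ := (v z).1.1

/-- The component `ξˣ` of a vector field. -/
def xiC (v : VarSpace → VarSpace) (z : VarSpace) : ℝ := (v z).1.2.1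

/-- The component `ξʸ` of a vector field. -/
def zetaC (v : VarSpace → VarSpace) (z : VarSpace) : ℝ := (v z).1.2.2

/-- The component `η` of a vector field. -/
def etaC (v : VarSpace → VarSpace) (z : VarSpace) : ℝ := (v z).2

section Components

variable {v : VarSpace → VarSpace} {z : VarSpace}

lemma ContDiffAt.tauC (h : ContDiffAt ℝ ∞ v z) : ContDiffAt ℝ ∞ (tauC v) z := h.fst.fst
lemma ContDiffAt.xiC (h : ContDiffAt ℝ ∞ v z) : ContDiffAt ℝ ∞ (xiC v) z := h.fst.snd.fst
lemma ContDiffAt.zetaC (h : ContDiffAt ℝ ∞ v z) : ContDiffAt ℝ ∞ (zetaC v) z := h.fst.snd.snd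
lemma ContDiffAt.etaC (h : ContDiffAt ℝ ∞ v z) : ContDiffAt ℝ ∞ (etaC v) z := h.snd

end Components

/-- A linear functional on the space of independent variables in coordinates. -/
lemma base_apply (L : Base →L[ℝ] ℝ) (a : Base) :
    L a = a.1 * L (1, 0, 0) + a.2.1 * L (0, 1, 0) + a.2.2 * L (0, 0, 1) := by
  have : a = a.1 • ((1, 0, 0) : Base) + a.2.1 • ((0, 1, 0) : Base) + a.2.2 • ((0, 0, 1) : Base) := by
    ext <;> simp
  conv_lhs => rw [this]
  simp only [map_add, map_smul, smul_eq_mul]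

section Total

variable {u : Base → ℝ} {F : VarSpace → ℝ} {p : Base}

lemma contDiffAt_comp_graph (hF : ContDiffAt ℝ ∞ F (p, u p)) (hu : ContDiff ℝ ∞ u) :
    ContDiffAt ℝ ∞ (fun q => F (q, u q)) p :=
  ContDiffAt.comp p hF (contDiffAt_id.prodMk hu.contDiffAt)

/-- This is the total derivative D_e = ∂_e + u_e ∂_u in fixed coordinates; all prolongation formulas
are reduced to it. -/
lemma dd_comp_graph (hF : DifferentiableAt ℝ F (p, u p)) (hu : DifferentiableAt ℝ u p) (e : Base) :
    dd e (fun q => F (q, u q)) p = dd (e, (0 : ℝ)) F (p, u p) + dd e u p * dd vu F (p, u p) := by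
  have h1 : HasFDerivAt (fun q : Base => (q, u q))
      ((ContinuousLinearMap.id ℝ Base).prod (fderiv ℝ u p)) p :=
    (hasFDerivAt_id p).prodMk hu.hasFDerivAt
  have h2 := HasFDerivAt.comp p hF.hasFDerivAt h1
  have h3 : ((e, fderiv ℝ u p e) : VarSpace) = (e, 0) + fderiv ℝ u p e • vu := by
    simp [vu]
  simp only [dd]
  rw [show (fun q => F (q, u q)) = F ∘ (fun q => (q, u q)) from rfl, h2.fderiv]
  simp only [ContinuousLinearMap.comp_apply, ContinuousLinearMap.prod_apply,
    ContinuousLinearMap.id_apply]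
  rw [h3, map_add, map_smul, smul_eq_mul]

lemma dd_dd_comp_graph (hF : ContDiffAt ℝ ∞ F (p, u p)) (hu : ContDiff ℝ ∞ u) (e : Base) :
    dd e (dd e (fun q => F (q, u q))) p
      = dd (e, (0 : ℝ)) (dd (e, (0 : ℝ)) F) (p, u p)
        + 2 * dd e u p * dd (e, (0 : ℝ)) (dd vu F) (p, u p)
        + dd e u p ^ 2 * dd vu (dd vu F) (p, u p) + dd e (dd e u) p * dd vu F (p, u p) := by
  have hF2 : ContDiffAt ℝ 2 F (p, u p) := hF.two
  have hcont : Tendsto (fun q : Base => (q, u q)) (𝓝 p) (𝓝 (p, u p)) :=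
    (continuous_id.prodMk hu.continuous).tendsto p
  have h : dd e (fun q => F (q, u q)) =ᶠ[𝓝 p]
      fun q => dd (e, (0 : ℝ)) F (q, u q) + dd e u q * dd vu F (q, u q) := by
    filter_upwards [hcont.eventually hF2.eventually_smooth] with q hq
    exact dd_comp_graph (hq.differentiableAt (by simp)) (hu.contDiffAt.diffAt) e
  have c1 := contDiffAt_comp_graph (hF.dd (e, (0 : ℝ))) hu
  have c2 := contDiffAt_comp_graph (hF.dd vu) hu
  rw [dd_congr h, dd_add c1.diffAt ((hu.dd e).contDiffAt.mul c2).diffAt,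
    dd_mul (hu.dd e).contDiffAt.diffAt c2.diffAt, dd_comp_graph (hF.dd _).diffAt hu.contDiffAt.diffAt,
    dd_comp_graph (hF.dd _).diffAt hu.contDiffAt.diffAt, dd_comm hF2 vu (e, (0 : ℝ))]
  ring

end Total

/-- The total derivative of `F` with respect to an independent variable with coordinate vector `e`,
if the derivative of `u` is `a`. -/
noncomputable def totalD (e : VarSpace) (F : VarSpace → ℝ) (z : VarSpace) (a : ℝ) : ℝ :=
  dd e F z + a * dd vu F z

/-- The second total derivative of `F` with respect to `x`, if `u_x = b` and `u_xx = c`. -/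
noncomputable def totalDxx (F : VarSpace → ℝ) (z : VarSpace) (b c : ℝ) : ℝ :=
  dd vx (dd vx F) z + 2 * b * dd vx (dd vu F) z + b ^ 2 * dd vu (dd vu F) z + c * dd vu F z

lemma characteristic_eq (v : VarSpace → VarSpace) (u : Base → ℝ) (q : Base) :
    characteristic v u q = etaC v (q, u q) - tauC v (q, u q) * pt u q - xiC v (q, u q) * px u q
      - zetaC v (q, u q) * py u q := by
  rw [characteristic, base_apply]
  simp only [etaC, tauC, xiC, zetaC, pt, px, py]
  ring

/-- The expression `Dη - u_t Dτ - u_x Dξˣ - u_y Dξʸ`, where `D` is the total derivative in the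
direction `e` and `a` is the derivative of `u` in this direction. -/
noncomputable def firstProl (v : VarSpace → VarSpace) (e z : VarSpace) (a ut ux uy : ℝ) : ℝ :=
  totalD e (etaC v) z a - ut * totalD e (tauC v) z a - ux * totalD e (xiC v) z a
    - uy * totalD e (zetaC v) z a

/-- The coefficient of the second prolongation that corresponds to `u_xx`. -/
noncomputable def secondProl (v : VarSpace → VarSpace) (z : VarSpace)
    (ut ux uy utx uxx uxy : ℝ) : ℝ :=
  totalDxx (etaC v) z ux uxx - ut * totalDxx (tauC v) z ux uxx - ux * totalDxx (xiC v) z ux uxx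
    - uy * totalDxx (zetaC v) z ux uxx - 2 * utx * totalD vx (tauC v) z ux
    - 2 * uxx * totalD vx (xiC v) z ux - 2 * uxy * totalD vx (zetaC v) z ux

section Prolongation

variable {v : VarSpace → VarSpace} {u : Base → ℝ} {p : Base}

/-- The second derivatives of u produced by differentiating the characteristic cancel against the
transport terms, which leaves the classical formula in first derivatives. -/
lemma dd_characteristic (hv : ContDiffAt ℝ ∞ v (p, u p)) (hu : ContDiff ℝ ∞ u) (e : Base) :
    dd e (characteristic v u) p
      + (tauC v (p, u p) * dd e (pt u) p + xiC v (p, u p) * dd e (px u) p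
        + zetaC v (p, u p) * dd e (py u) p)
      = firstProl v (e, 0) (p, u p) (dd e u p) (pt u p) (px u p) (py u p) := by
  have c1 := contDiffAt_comp_graph hv.etaC hu
  have c2 := contDiffAt_comp_graph hv.tauC hu
  have c3 := contDiffAt_comp_graph hv.xiC hu
  have c4 := contDiffAt_comp_graph hv.zetaC hu
  have ut : ContDiffAt ℝ ∞ (pt u) p := (hu.dd _).contDiffAt
  have ux : ContDiffAt ℝ ∞ (px u) p := (hu.dd _).contDiffAt
  have uy : ContDiffAt ℝ ∞ (py u) p := (hu.dd _).contDiffAt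
  have hu' := (hu.contDiffAt (x := p)).diffAt
  rw [show characteristic v u = _ from funext (characteristic_eq v u),
    dd_sub ((c1.sub (c2.mul ut)).sub (c3.mul ux)).diffAt (c4.mul uy).diffAt,
    dd_sub (c1.sub (c2.mul ut)).diffAt (c3.mul ux).diffAt, dd_sub c1.diffAt (c2.mul ut).diffAt,
    dd_mul c2.diffAt ut.diffAt, dd_mul c3.diffAt ux.diffAt, dd_mul c4.diffAt uy.diffAt,
    dd_comp_graph hv.etaC.diffAt hu', dd_comp_graph hv.tauC.diffAt hu',
    dd_comp_graph hv.xiC.diffAt hu', dd_comp_graph hv.zetaC.diffAt hu']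
  simp only [firstProl, totalD]
  ring

lemma dd_function_comm (hu : ContDiff ℝ ∞ u) (e e' : Base) : dd e (dd e' u) = dd e' (dd e u) := by
  funext q
  exact dd_comm hu.contDiffAt.two e e'

lemma dd_field (w : Base → ℝ) (z : VarSpace) :
    fderiv ℝ w p (v z).1 = tauC v z * pt w p + xiC v z * px w p + zetaC v z * py w p := by
  rw [base_apply]; rfl

lemma etaT_eq (hv : ContDiffAt ℝ ∞ v (p, u p)) (hu : ContDiff ℝ ∞ u) :
    etaT v u p = firstProl v vt (p, u p) (pt u p) (pt u p) (px u p) (py u p) := by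
  have h := dd_characteristic hv hu (1, 0, 0)
  have e1 : px (pt u) p = dd (1, 0, 0) (px u) p := congrFun (dd_function_comm hu _ _) p
  have e2 : py (pt u) p = dd (1, 0, 0) (py u) p := congrFun (dd_function_comm hu _ _) p
  rw [etaT, dd_field, e1, e2]
  exact h

lemma etaY_eq (hv : ContDiffAt ℝ ∞ v (p, u p)) (hu : ContDiff ℝ ∞ u) :
    etaY v u p = firstProl v vy (p, u p) (py u p) (pt u p) (px u p) (py u p) := by
  have h := dd_characteristic hv hu (0, 0, 1)
  have e1 : px (py u) p = dd (0, 0, 1) (px u) p := congrFun (dd_function_comm hu _ _) p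
  have e2 : pt (py u) p = dd (0, 0, 1) (pt u) p := congrFun (dd_function_comm hu _ _) p
  rw [etaY, dd_field, e1, e2]
  exact h

/-- After reordering mixed partials, the third derivatives of u cancel, so the coefficient is a
function of the 2-jet. -/
lemma etaXX_eq (hv : ContDiffAt ℝ ∞ v (p, u p)) (hu : ContDiff ℝ ∞ u) :
    etaXX v u p = secondProl v (p, u p) (pt u p) (px u p) (py u p) (px (pt u) p) (px (px u) p)
      (px (py u) p) := by
  have c1 := contDiffAt_comp_graph hv.etaC hu
  have c2 := contDiffAt_comp_graph hv.tauC hu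
  have c3 := contDiffAt_comp_graph hv.xiC hu
  have c4 := contDiffAt_comp_graph hv.zetaC hu
  have ut : ContDiffAt ℝ ∞ (pt u) p := (hu.dd _).contDiffAt
  have ux : ContDiffAt ℝ ∞ (px u) p := (hu.dd _).contDiffAt
  have uy : ContDiffAt ℝ ∞ (py u) p := (hu.dd _).contDiffAt
  have hu' := (hu.contDiffAt (x := p)).diffAt
  have e1 : pt (px (px u)) p = px (px (pt u)) p := by
    change dd (1, 0, 0) (dd (0, 1, 0) (px u)) p = dd (0, 1, 0) (dd (0, 1, 0) (pt u)) p
    rw [dd_function_comm (u := px u) (hu.dd _), show dd (1, 0, 0) (px u) = dd (0, 1, 0) (pt u) from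
      dd_function_comm hu _ _]
  have e2 : py (px (px u)) p = px (px (py u)) p := by
    change dd (0, 0, 1) (dd (0, 1, 0) (px u)) p = dd (0, 1, 0) (dd (0, 1, 0) (py u)) p
    rw [dd_function_comm (u := px u) (hu.dd _), show dd (0, 0, 1) (px u) = dd (0, 1, 0) (py u) from
      dd_function_comm hu _ _]
  rw [etaXX, dd_field, e1, e2]
  change dd (0, 1, 0) (dd (0, 1, 0) (characteristic v u)) p + _ = _
  rw [show characteristic v u = _ from funext (characteristic_eq v u),
    dd_dd_sub ((c1.sub (c2.mul ut)).sub (c3.mul ux)) (c4.mul uy),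
    dd_dd_sub (c1.sub (c2.mul ut)) (c3.mul ux), dd_dd_sub c1 (c2.mul ut),
    dd_dd_mul c2 ut, dd_dd_mul c3 ux, dd_dd_mul c4 uy,
    dd_dd_comp_graph hv.etaC hu, dd_dd_comp_graph hv.tauC hu,
    dd_dd_comp_graph hv.xiC hu, dd_dd_comp_graph hv.zetaC hu,
    dd_comp_graph hv.tauC.diffAt hu', dd_comp_graph hv.xiC.diffAt hu',
    dd_comp_graph hv.zetaC.diffAt hu']
  simp only [secondProl, totalD, totalDxx]
  change _ + (tauC v (p, u p) * dd (0, 1, 0) (dd (0, 1, 0) (pt u)) p +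
    xiC v (p, u p) * dd (0, 1, 0) (dd (0, 1, 0) (px u)) p +
    zetaC v (p, u p) * dd (0, 1, 0) (dd (0, 1, 0) (py u)) p) = _
  have a1 : dd (0, 1, 0) u p = px u p := rfl
  have a2 : dd (0, 1, 0) (dd (0, 1, 0) u) p = px (px u) p := rfl
  have a3 : dd (0, 1, 0) (pt u) p = px (pt u) p := rfl
  have a4 : dd (0, 1, 0) (px u) p = px (px u) p := rfl
  have a5 : dd (0, 1, 0) (py u) p = px (py u) p := rfl
  have a6 : (((0, 1, 0), 0) : VarSpace) = vx := rfl
  rw [a1, a2, a3, a4, a5, a6]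
  ring

end Prolongation

/-- The second prolongation of `v` applied to the equation, as a function on the jet space; here
`A` and `A'` are the diffusivity and its derivative. -/
noncomputable def jetAction (A A' : ℝ) (v : VarSpace → VarSpace) (z : VarSpace)
    (ut ux uy utx uxx uxy : ℝ) : ℝ :=
  firstProl v vt z ut ut ux uy + z.1.2.1 * firstProl v vy z uy ut ux uy + xiC v z * uy
    - A * secondProl v z ut ux uy utx uxx uxy - xiC v z * A' * uxx

lemma prolongedAction_eq (θ : Param) {v : VarSpace → VarSpace} {u : Base → ℝ} {p : Base}
    (hv : ContDiffAt ℝ ∞ v (p, u p)) (hu : ContDiff ℝ ∞ u) :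
    prolongedAction θ v u p = jetAction (diffusivity θ p) (px (diffusivity θ) p) v (p, u p)
      (pt u p) (px u p) (py u p) (px (pt u) p) (px (px u) p) (px (py u) p) := by
  rw [prolongedAction, etaT_eq hv hu, etaY_eq hv hu, etaXX_eq hv hu]
  rfl

/-! ### The determining equations -/

section OpenSet

variable {E : Type*} [NormedAddCommGroup E] [NormedSpace ℝ E] {O : Set E} {f g : E → ℝ}

lemma dd_eqOn (hO : IsOpen O) (h : ∀ z ∈ O, f z = g z) (e : E) : ∀ z ∈ O, dd e f z = dd e g z :=
  fun z hz => dd_congr (by filter_upwards [hO.mem_nhds hz] with w hw using h w hw) e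

lemma dd_zero_on (hO : IsOpen O) (h : ∀ z ∈ O, f z = 0) (e : E) : ∀ z ∈ O, dd e f z = 0 :=
  fun z hz => (dd_eqOn (g := fun _ => 0) hO h e z hz).trans (dd_const 0 e)

end OpenSet

/-- A polynomial with prescribed jet at `p`. -/
noncomputable def testFunction (p : Base) (u₀ a b c d e f : ℝ) (q : Base) : ℝ :=
  u₀ + a * (q.1 - p.1) + b * (q.2.1 - p.2.1) + c * (q.2.2 - p.2.2)
    + d * ((q.1 - p.1) * (q.2.1 - p.2.1)) + e * (q.2.1 - p.2.1) ^ 2 / 2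
    + f * ((q.2.1 - p.2.1) * (q.2.2 - p.2.2))

section TestFunction

variable (p : Base) (u₀ a b c d e f : ℝ)

lemma contDiff_testFunction : ContDiff ℝ ∞ (testFunction p u₀ a b c d e f) := by
  unfold testFunction; fun_prop

lemma testFunction_self : testFunction p u₀ a b c d e f p = u₀ := by simp [testFunction]

lemma fderiv_testFunction (q w : Base) : fderiv ℝ (testFunction p u₀ a b c d e f) q w
    = a * w.1 + b * w.2.1 + c * w.2.2 + d * (w.1 * (q.2.1 - p.2.1) + (q.1 - p.1) * w.2.1)
      + e * ((q.2.1 - p.2.1) * w.2.1)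
      + f * (w.2.1 * (q.2.2 - p.2.2) + (q.2.1 - p.2.1) * w.2.2) := by
  have h1 : HasFDerivAt (fun q : Base => q.1 - p.1) (ContinuousLinearMap.fst ℝ ℝ (ℝ × ℝ)) q :=
    hasFDerivAt_fst.sub_const _
  have h2 : HasFDerivAt (fun q : Base => q.2.1 - p.2.1)
      ((ContinuousLinearMap.fst ℝ ℝ ℝ).comp (ContinuousLinearMap.snd ℝ ℝ (ℝ × ℝ))) q :=
    (hasFDerivAt_fst.comp q hasFDerivAt_snd).sub_const _
  have h3 : HasFDerivAt (fun q : Base => q.2.2 - p.2.2)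
      ((ContinuousLinearMap.snd ℝ ℝ ℝ).comp (ContinuousLinearMap.snd ℝ ℝ (ℝ × ℝ))) q :=
    (hasFDerivAt_snd.comp q hasFDerivAt_snd).sub_const _
  have h : HasFDerivAt (testFunction p u₀ a b c d e f) _ q :=
    ((((((h1.const_mul a).const_add u₀).add (h2.const_mul b)).add (h3.const_mul c)).add
      ((h1.mul h2).const_mul d)).add (((h2.mul h2).const_mul (e / 2)))).add
      ((h2.mul h3).const_mul f) |>.congr_of_eventuallyEq
      (Eventually.of_forall fun q => by simp [testFunction]; try ring)
  rw [h.fderiv]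
  simp
  ring

lemma pt_testFunction :
    pt (testFunction p u₀ a b c d e f) = testFunction p a 0 d 0 0 0 0 := by
  funext q; rw [pt, fderiv_testFunction]; simp [testFunction]

lemma px_testFunction :
    px (testFunction p u₀ a b c d e f) = testFunction p b d e f 0 0 0 := by
  funext q; rw [px, fderiv_testFunction]; simp [testFunction]

lemma py_testFunction :
    py (testFunction p u₀ a b c d e f) = testFunction p c 0 f 0 0 0 0 := by
  funext q; rw [py, fderiv_testFunction]; simp [testFunction]

end TestFunction

/-- The derivatives u_tt, u_ty and u_yy do not enter the prolonged action, so `testFunction`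
realizes every jet that matters, and functions can be traded for independent real coordinates. -/
lemma invariantAt_iff (θ : Param) {v : VarSpace → VarSpace} {p : Base}
    (hv : ∀ u₀ : ℝ, ContDiffAt ℝ ∞ v (p, u₀)) :
    InvariantAt θ v p ↔ ∀ u₀ ut ux uy utx uxx uxy : ℝ,
      ut + p.2.1 * uy = diffusivity θ p * uxx →
      jetAction (diffusivity θ p) (px (diffusivity θ) p) v (p, u₀) ut ux uy utx uxx uxy = 0 := by
  constructor
  · intro h u₀ a b c d e f hyp
    have hu := contDiff_testFunction p u₀ a b c d e f
    have h1 := h (testFunction p u₀ a b c d e f) hu (by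
      simp only [eqResidual, pt_testFunction, px_testFunction, py_testFunction, testFunction_self]
      linarith)
    rw [prolongedAction_eq θ (hv _) hu] at h1
    simpa only [pt_testFunction, px_testFunction, py_testFunction, testFunction_self] using h1
  · intro h u hu h0
    rw [prolongedAction_eq θ (hv _) hu]
    apply h
    unfold eqResidual at h0
    linarith

/-- The determining equations for Lie symmetries of `𝓕_{αβ}` at the point `z`. -/
structure Determining (θ : Param) (v : VarSpace → VarSpace) (z : VarSpace) : Prop where
  tau_x : dd vx (tauC v) z = 0
  tau_u : dd vu (tauC v) z = 0
  zeta_x : dd vx (zetaC v) z = 0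
  zeta_u : dd vu (zetaC v) z = 0
  xi_u : dd vu (xiC v) z = 0
  xi_eq : xiC v z = dd vt (zetaC v) z + z.1.2.1 * dd vy (zetaC v) z
    - z.1.2.1 * (dd vt (tauC v) z + z.1.2.1 * dd vy (tauC v) z)
  xi_x : diffusivity θ z.1 * (2 * dd vx (xiC v) z - dd vt (tauC v) z - z.1.2.1 * dd vy (tauC v) z)
    = xiC v z * px (diffusivity θ) z.1
  eta_uu : dd vu (dd vu (etaC v)) z = 0
  eta_xu : dd vt (xiC v) z + z.1.2.1 * dd vy (xiC v) z
    = diffusivity θ z.1 * (dd vx (dd vx (xiC v)) z - 2 * dd vx (dd vu (etaC v)) z)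
  eta_eq : dd vt (etaC v) z + z.1.2.1 * dd vy (etaC v) z
    = diffusivity θ z.1 * dd vx (dd vx (etaC v)) z

lemma isOpen_cylinder (Ω : TopologicalSpace.Opens Base) : IsOpen (cylinder Ω) :=
  Ω.isOpen.preimage continuous_fst

lemma contDiffAt_of_mem_cylinder {F : Type*} [NormedAddCommGroup F] [NormedSpace ℝ F]
    {Ω : TopologicalSpace.Opens Base} {v : VarSpace → F}
    (hv : ContDiffOn ℝ ∞ v (cylinder Ω)) {z : VarSpace} (hz : z ∈ cylinder Ω) :
    ContDiffAt ℝ ∞ v z :=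
  hv.contDiffAt ((isOpen_cylinder Ω).mem_nhds hz)

/-- The action is polynomial in the jet coordinates once u_t is eliminated, so every coefficient
must vanish; coefficients are read off as finite differences at small integer values. -/
lemma determining_of_invariant {θ : Param} {v : VarSpace → VarSpace}
    {Ω : TopologicalSpace.Opens Base} (hr : ∀ p ∈ Ω, Regular θ p)
    (hv : ContDiffOn ℝ ∞ v (cylinder Ω)) (hi : ∀ p ∈ Ω, InvariantAt θ v p) :
    ∀ z ∈ cylinder Ω, Determining θ v z := by
  have hO := isOpen_cylinder Ω
  have hs : ∀ z ∈ cylinder Ω, ContDiffAt ℝ ∞ v z := fun z hz => contDiffAt_of_mem_cylinder hv hz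
  have hA : ∀ z ∈ cylinder Ω, diffusivity θ z.1 ≠ 0 := fun z hz => hr _ hz
  have key : ∀ z ∈ cylinder Ω, ∀ ut ux uy utx uxx uxy : ℝ,
      ut + z.1.2.1 * uy = diffusivity θ z.1 * uxx →
      jetAction (diffusivity θ z.1) (px (diffusivity θ) z.1) v z ut ux uy utx uxx uxy = 0 := by
    intro z hz
    exact (invariantAt_iff θ fun u₀ => hs (z.1, u₀) hz).1 (hi z.1 hz) z.2
  have hτ : ∀ z ∈ cylinder Ω, ∀ b, totalD vx (tauC v) z b = 0 := by
    intro z hz b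
    -- The coordinate u_tx is unconstrained by the equation and occurs only with the coefficient
    -- 2A·D_xτ.
    have h1 := key z hz 0 b 0 0 0 0 (by ring)
    have h2 := key z hz 0 b 0 1 0 0 (by ring)
    have : diffusivity θ z.1 * totalD vx (tauC v) z b = 0 := by
      simp only [jetAction, secondProl] at h1 h2
      linear_combination (h2 - h1) / 2
    exact (mul_eq_zero.1 this).resolve_left (hA z hz)
  have hζ : ∀ z ∈ cylinder Ω, ∀ b, totalD vx (zetaC v) z b = 0 := by
    intro z hz b
    have h1 := key z hz 0 b 0 0 0 0 (by ring)
    have h2 := key z hz 0 b 0 0 0 1 (by ring)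
    have : diffusivity θ z.1 * totalD vx (zetaC v) z b = 0 := by
      simp only [jetAction, secondProl] at h1 h2
      linear_combination (h2 - h1) / 2
    exact (mul_eq_zero.1 this).resolve_left (hA z hz)
  have τx : ∀ z ∈ cylinder Ω, dd vx (tauC v) z = 0 := fun z hz => by
    simpa [totalD] using hτ z hz 0
  have τu : ∀ z ∈ cylinder Ω, dd vu (tauC v) z = 0 := fun z hz => by
    simpa [totalD, τx z hz] using hτ z hz 1
  have ζx : ∀ z ∈ cylinder Ω, dd vx (zetaC v) z = 0 := fun z hz => by
    simpa [totalD] using hζ z hz 0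
  have ζu : ∀ z ∈ cylinder Ω, dd vu (zetaC v) z = 0 := fun z hz => by
    simpa [totalD, ζx z hz] using hζ z hz 1
  have ξu : ∀ z ∈ cylinder Ω, dd vu (xiC v) z = 0 := by
    intro z hz
    have red := fun b e : ℝ => key z hz (diffusivity θ z.1 * e) b 0 0 e 0 (by ring)
    simp only [jetAction, firstProl, secondProl, totalD, totalDxx, τx z hz, τu z hz, ζx z hz,
      ζu z hz, dd_zero_on hO τx vx z hz, dd_zero_on hO τu vx z hz, dd_zero_on hO τu vu z hz] at red
    -- The mixed difference isolates the coefficient of u_x u_xx, which is 2A·ξ_u: three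
    -- contributions from the second prolongation minus one from u_t = A u_xx.
    have : diffusivity θ z.1 * dd vu (xiC v) z = 0 := by
      linear_combination (red 1 1 - red 1 0 - red 0 1 + red 0 0) / 2
    exact (mul_eq_zero.1 this).resolve_left (hA z hz)
  intro z hz
  -- What remains is quadratic in u_x and linear in u_y and u_xx, without cross terms.
  have red : ∀ b c e : ℝ, jetAction (diffusivity θ z.1) (px (diffusivity θ) z.1) v z
      (diffusivity θ z.1 * e - z.1.2.1 * c) b c 0 e 0 = 0 := fun b c e =>
    key z hz _ b c 0 e 0 (by ring)
  simp only [jetAction, firstProl, secondProl, totalD, totalDxx, τx z hz, τu z hz, ζx z hz,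
    ζu z hz, ξu z hz, dd_zero_on hO τx vx z hz, dd_zero_on hO τu vx z hz,
    dd_zero_on hO τu vu z hz, dd_zero_on hO ζx vx z hz, dd_zero_on hO ζu vx z hz,
    dd_zero_on hO ζu vu z hz, dd_zero_on hO ξu vx z hz, dd_zero_on hO ξu vu z hz] at red
  have hA0 := hA z hz
  refine ⟨τx z hz, τu z hz, ζx z hz, ζu z hz, ξu z hz, ?_, ?_, ?_, ?_, ?_⟩
  · linear_combination red 0 1 0 - red 0 0 0
  · linear_combination red 0 0 1 - red 0 0 0
  · apply (mul_eq_zero.1 _).resolve_left hA0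
    linear_combination -(red 1 0 0 + red (-1) 0 0 - 2 * red 0 0 0) / 2
  · linear_combination -(red 1 0 0 - red (-1) 0 0) / 2
  · linear_combination red 0 0 0

/-- Second derivatives of τ, ζ and ξˣ that would enter are x- or u-derivatives of equations valid on
the open cylinder, so they vanish. The rest is a combination of four determining equations with
coefficients u_y, u_xx, −u_x and 1. -/
lemma invariant_of_determining {θ : Param} {v : VarSpace → VarSpace}
    {Ω : TopologicalSpace.Opens Base}
    (hv : ContDiffOn ℝ ∞ v (cylinder Ω)) (h : ∀ z ∈ cylinder Ω, Determining θ v z) :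
    ∀ p ∈ Ω, InvariantAt θ v p := by
  have hO := isOpen_cylinder Ω
  intro p hp
  refine (invariantAt_iff θ fun u₀ => contDiffAt_of_mem_cylinder hv (z := (p, u₀)) hp).2 ?_
  intro u₀ ut ux uy utx uxx uxy hyp
  have hz : ((p, u₀) : VarSpace) ∈ cylinder Ω := hp
  have e1 := dd_zero_on hO (fun z hz => (h z hz).tau_x) vx _ hz
  have e2 := dd_zero_on hO (fun z hz => (h z hz).tau_u) vx _ hz
  have e3 := dd_zero_on hO (fun z hz => (h z hz).tau_u) vu _ hz
  have e4 := dd_zero_on hO (fun z hz => (h z hz).zeta_x) vx _ hz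
  have e5 := dd_zero_on hO (fun z hz => (h z hz).zeta_u) vx _ hz
  have e6 := dd_zero_on hO (fun z hz => (h z hz).zeta_u) vu _ hz
  have e7 := dd_zero_on hO (fun z hz => (h z hz).xi_u) vx _ hz
  have e8 := dd_zero_on hO (fun z hz => (h z hz).xi_u) vu _ hz
  obtain ⟨h1, h2, h3, h4, h5, h6, h7, h8, h9, h10⟩ := h _ hz
  obtain rfl : ut = diffusivity θ p * uxx - p.2.1 * uy := by linarith
  simp only [jetAction, firstProl, secondProl, totalD, totalDxx, h1, h2, h3, h4, h5, e1, e2, e3,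
    e4, e5, e6, e7, e8, h8] at h6 h7 h9 h10 ⊢
  linear_combination uy * h6 + uxx * h7 - ux * h9 + h10

lemma isOpen_setOf_regular (θ : Param) : IsOpen {p : Base | Regular θ p} := by
  by_cases hβ : θ.2 = 0
  · have : {p : Base | Regular θ p} = univ := by
      ext p; simp [Regular, diffusivity, hβ]
    rw [this]; exact isOpen_univ
  · have : {p : Base | Regular θ p} = {p : Base | p.2.1 ≠ θ.1} := by
      ext p
      simp [Regular, diffusivity, Real.rpow_eq_zero (abs_nonneg _) hβ, sub_eq_zero]
    rw [this]
    exact isOpen_ne_fun (by fun_prop) continuous_const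

lemma regular_of_ne {θ : Param} {p : Base} (h : p.2.1 ≠ θ.1) : Regular θ p :=
  (Real.rpow_pos_of_pos (abs_pos.2 (sub_ne_zero.2 h)) _).ne'

lemma ne_of_regular {θ : Param} {p : Base} (hβ : θ.2 ≠ 0) (h : Regular θ p) : p.2.1 ≠ θ.1 := by
  rintro h'
  exact h (by simp [diffusivity, h', Real.zero_rpow hβ])

/-- The regular points of `Ω`. -/
def regularPart (θ : Param) (Ω : TopologicalSpace.Opens Base) : TopologicalSpace.Opens Base :=
  Ω ⊓ ⟨{p | Regular θ p}, isOpen_setOf_regular θ⟩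

lemma mem_symmetryFields_iff {θ : Param} {Ω : TopologicalSpace.Opens Base}
    {v : VarSpace → VarSpace} : v ∈ symmetryFields θ Ω ↔ ContDiffOn ℝ ∞ v (cylinder Ω) ∧
      ∀ z ∈ cylinder Ω, Regular θ z.1 → Determining θ v z := by
  have hsub : cylinder (regularPart θ Ω) ⊆ cylinder Ω := fun z hz => hz.1
  constructor
  · rintro ⟨h1, h2⟩
    refine ⟨h1, fun z hz hr => ?_⟩
    exact determining_of_invariant (Ω := regularPart θ Ω) (fun p hp => hp.2) (h1.mono hsub)
      (fun p hp => h2 p hp.1 hp.2) z ⟨hz, hr⟩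
  · rintro ⟨h1, h2⟩
    refine ⟨h1, fun p hp hr => ?_⟩
    exact invariant_of_determining (Ω := regularPart θ Ω) (h1.mono hsub)
      (fun z hz => h2 z hz.1 hz.2) p ⟨hp, hr⟩

lemma hasDerivAt_abs_rpow_div (β : ℝ) {s : ℝ} (hs : s ≠ 0) :
    HasDerivAt (fun r => |r| ^ β) (β * |s| ^ β / s) s := by
  have h := (hasDerivAt_abs hs).rpow_const (p := β) (Or.inl (abs_ne_zero.2 hs))
  refine h.congr_deriv ?_
  rw [Real.rpow_sub_one (abs_ne_zero.2 hs)]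
  rcases lt_or_gt_of_ne hs with h | h
  · rw [abs_of_neg h, sign_neg h]; simp; field_simp
  · rw [abs_of_pos h, sign_pos h]; simp; field_simp

/-- This Euler relation is the only information about the derivative of the diffusivity that the
classifying equations use; it also covers x = α when β = 0. -/
lemma px_diffusivity (θ : Param) {p : Base} (hr : Regular θ p) :
    (p.2.1 - θ.1) * px (diffusivity θ) p = θ.2 * diffusivity θ p := by
  by_cases hβ : θ.2 = 0
  · have : diffusivity θ = fun _ => 1 := by funext q; simp [diffusivity, hβ]
    simp [px, this, hβ]
  · have hne := sub_ne_zero.2 (ne_of_regular hβ hr)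
    have h0 : HasFDerivAt (fun q : Base => q.2.1 - θ.1)
        ((ContinuousLinearMap.fst ℝ ℝ ℝ).comp (ContinuousLinearMap.snd ℝ ℝ (ℝ × ℝ))) p :=
      (hasFDerivAt_fst.comp p hasFDerivAt_snd).sub_const _
    have h := (hasDerivAt_abs_rpow_div θ.2 hne).comp_hasFDerivAt p h0
    have h' : HasFDerivAt (diffusivity θ) _ p := h
    rw [px, h'.fderiv]
    simp [diffusivity]
    field_simp

/-! ### Some Lie symmetries -/

lemma dd_pow {E : Type*} [NormedAddCommGroup E] [NormedSpace ℝ E] {f : E → ℝ} {z : E}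
    (hf : DifferentiableAt ℝ f z) (n : ℕ) (e : E) :
    dd e (fun w => f w ^ n) z = n * f z ^ (n - 1) * dd e f z := by
  simp [dd, fderiv_fun_pow n hf]

lemma dd_neg {E : Type*} [NormedAddCommGroup E] [NormedSpace ℝ E] {f : E → ℝ} {z : E} (e : E) :
    dd e (fun w => -f w) z = -dd e f z := by
  simp [dd]

lemma dd_coord_t (e z : VarSpace) : dd e (fun w => w.1.1) z = e.1.1 := by
  have : HasFDerivAt (fun w : VarSpace => w.1.1)
      ((ContinuousLinearMap.fst ℝ ℝ (ℝ × ℝ)).comp (ContinuousLinearMap.fst ℝ Base ℝ)) z :=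
    hasFDerivAt_fst.comp z hasFDerivAt_fst
  simp [dd, this.fderiv]

lemma dd_coord_x (e z : VarSpace) : dd e (fun w => w.1.2.1) z = e.1.2.1 := by
  have : HasFDerivAt (fun w : VarSpace => w.1.2.1) ((ContinuousLinearMap.fst ℝ ℝ ℝ).comp
      ((ContinuousLinearMap.snd ℝ ℝ (ℝ × ℝ)).comp (ContinuousLinearMap.fst ℝ Base ℝ))) z :=
    hasFDerivAt_fst.comp z (hasFDerivAt_snd.comp z hasFDerivAt_fst)
  simp [dd, this.fderiv]

lemma dd_coord_y (e z : VarSpace) : dd e (fun w => w.1.2.2) z = e.1.2.2 := by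
  have : HasFDerivAt (fun w : VarSpace => w.1.2.2) ((ContinuousLinearMap.snd ℝ ℝ ℝ).comp
      ((ContinuousLinearMap.snd ℝ ℝ (ℝ × ℝ)).comp (ContinuousLinearMap.fst ℝ Base ℝ))) z :=
    hasFDerivAt_snd.comp z (hasFDerivAt_snd.comp z hasFDerivAt_fst)
  simp [dd, this.fderiv]

lemma dd_coord_u (e z : VarSpace) : dd e (fun w => w.2) z = e.2 := by
  simp [dd, fderiv_snd]

lemma dd_comp_fst {f : Base → ℝ} {z : VarSpace} (hf : DifferentiableAt ℝ f z.1) (e : VarSpace) :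
    dd e (fun w => f w.1) z = dd e.1 f z.1 := by
  have h : HasFDerivAt (fun w : VarSpace => f w.1) _ z := hf.hasFDerivAt.comp z hasFDerivAt_fst
  simp [dd, h.fderiv]

section Fields

attribute [local simp] dd_add dd_sub dd_mul dd_pow dd_neg dd_const dd_coord_t dd_coord_x dd_coord_y
  dd_coord_u vt vx vy vu

lemma px_diffusivity_of_eq_zero {θ : Param} (h : θ.2 = 0) (p : Base) : px (diffusivity θ) p = 0 := by
  have : diffusivity θ = fun _ => 1 := by funext q; simp [diffusivity, h]
  simp [px, this]

lemma px_diffusivity_of_ne {θ : Param} {p : Base} (h : p.2.1 ≠ θ.1) :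
    px (diffusivity θ) p = θ.2 * diffusivity θ p / (p.2.1 - θ.1) := by
  rw [eq_div_iff (sub_ne_zero.2 h), mul_comm]
  exact px_diffusivity θ (regular_of_ne h)

lemma fieldPt_mem (θ : Param) (Ω : TopologicalSpace.Opens Base) :
    fieldPt ∈ symmetryFields θ Ω := by
  refine mem_symmetryFields_iff.2 ⟨contDiffOn_const, fun z _ _ => ?_⟩
  have h1 : tauC fieldPt = fun _ => 1 := rfl
  have h2 : xiC fieldPt = fun _ => 0 := rfl
  have h3 : zetaC fieldPt = fun _ => 0 := rfl
  have h4 : etaC fieldPt = fun _ => 0 := rfl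
  have h5 : ∀ e : VarSpace, dd e (fun _ : VarSpace => (0 : ℝ)) = fun _ => 0 := fun e =>
    funext fun z => dd_const 0 e
  constructor <;> simp [h1, h2, h3, h4, h5]

lemma fieldPy_mem (θ : Param) (Ω : TopologicalSpace.Opens Base) :
    fieldPy ∈ symmetryFields θ Ω := by
  refine mem_symmetryFields_iff.2 ⟨contDiffOn_const, fun z _ _ => ?_⟩
  have h1 : tauC fieldPy = fun _ => 0 := rfl
  have h2 : xiC fieldPy = fun _ => 0 := rfl
  have h3 : zetaC fieldPy = fun _ => 1 := rfl
  have h4 : etaC fieldPy = fun _ => 0 := rfl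
  have h5 : ∀ e : VarSpace, dd e (fun _ : VarSpace => (0 : ℝ)) = fun _ => 0 := fun e =>
    funext fun z => dd_const 0 e
  constructor <;> simp [h1, h2, h3, h4, h5]

lemma fieldI_mem (θ : Param) (Ω : TopologicalSpace.Opens Base) :
    fieldI ∈ symmetryFields θ Ω := by
  have hs : ContDiff ℝ ∞ fieldI := by unfold fieldI; fun_prop
  refine mem_symmetryFields_iff.2 ⟨hs.contDiffOn, fun z _ _ => ?_⟩
  have h1 : tauC fieldI = fun _ => 0 := rfl
  have h2 : xiC fieldI = fun _ => 0 := rfl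
  have h3 : zetaC fieldI = fun _ => 0 := rfl
  have h4 : ∀ e, dd e (etaC fieldI) = fun _ => e.2 := fun e => funext fun z => dd_coord_u e z
  have h5 : ∀ e : VarSpace, dd e (fun _ : VarSpace => (0 : ℝ)) = fun _ => 0 := fun e =>
    funext fun z => dd_const 0 e
  constructor <;> simp [h1, h2, h3, h4, h5]

lemma fieldD_mem (θ : Param) (Ω : TopologicalSpace.Opens Base) :
    fieldD θ ∈ symmetryFields θ Ω := by
  have hs : ContDiff ℝ ∞ (fieldD θ) := by unfold fieldD; fun_prop
  refine mem_symmetryFields_iff.2 ⟨hs.contDiffOn, fun z _ hr => ?_⟩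
  have h1 : tauC (fieldD θ) = fun z => (2 - θ.2) * z.1.1 := rfl
  have h2 : xiC (fieldD θ) = fun z => z.1.2.1 - θ.1 := rfl
  have h3 : zetaC (fieldD θ) = fun z => (3 - θ.2) * z.1.2.2 - θ.1 * z.1.1 := rfl
  have h4 : etaC (fieldD θ) = fun _ => 0 := rfl
  have h5 : ∀ e : VarSpace, dd e (fun _ : VarSpace => (0 : ℝ)) = fun _ => 0 := fun e =>
    funext fun z => dd_const 0 e
  have h6 : dd vx (xiC (fieldD θ)) = fun _ => 1 := by
    funext z; simp (disch := fun_prop) [h2]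
  have h7 := px_diffusivity θ hr
  constructor
  all_goals try rw [h6]
  all_goals simp (disch := fun_prop) [h1, h2, h3, h4, h5]
  all_goals linarith

lemma fieldZ_mem {θ : Param} {Ω : TopologicalSpace.Opens Base} {f : Base → ℝ}
    (hf : ContDiffOn ℝ ∞ f Ω) (h : ∀ p ∈ Ω, Regular θ p → eqResidual θ f p = 0) :
    fieldZ f ∈ symmetryFields θ Ω := by
  have hη : etaC (fieldZ f) = fun z => f z.1 := rfl
  have hs : ContDiffOn ℝ ∞ (fieldZ f) (cylinder Ω) :=
    contDiffOn_const.prodMk (hf.comp contDiffOn_fst fun z hz => hz)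
  have hf' : ∀ p ∈ Ω, ContDiffAt ℝ ∞ f p := fun p hp => hf.contDiffAt (Ω.isOpen.mem_nhds hp)
  refine mem_symmetryFields_iff.2 ⟨hs, fun z hz hr => ?_⟩
  have hO := isOpen_cylinder Ω
  have h1 : tauC (fieldZ f) = fun _ => 0 := rfl
  have h2 : xiC (fieldZ f) = fun _ => 0 := rfl
  have h3 : zetaC (fieldZ f) = fun _ => 0 := rfl
  have h5 : ∀ e : VarSpace, dd e (fun _ : VarSpace => (0 : ℝ)) = fun _ => 0 := fun e =>
    funext fun z => dd_const 0 e
  have h4 : ∀ e, ∀ z ∈ cylinder Ω, dd e (etaC (fieldZ f)) z = dd e.1 f z.1 := fun e z hz =>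
    dd_comp_fst (hf' _ hz).diffAt e
  have h6 : ∀ z ∈ cylinder Ω, dd vu (etaC (fieldZ f)) z = 0 := fun z hz => by
    rw [h4 vu z hz]; exact map_zero (fderiv ℝ f z.1)
  have h7 := dd_eqOn hO (h4 vx) vx z hz
  rw [dd_comp_fst ((hf' _ hz).dd _).diffAt] at h7
  constructor
  all_goals try rw [dd_zero_on hO h6 _ z hz]
  all_goals try simp [h1, h2, h3, h5]
  rw [h4 _ z hz, h4 _ z hz]
  have h8 := h z.1 hz hr
  unfold eqResidual at h8
  have h9 : dd ((0, 1, 0), 0) (dd ((0, 1, 0), 0) (etaC (fieldZ f))) z = px (px f) z.1 := h7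
  rw [h9]
  change pt f z.1 + _ * py f z.1 = _
  linarith

lemma fieldK0_mem (Ω : TopologicalSpace.Opens Base) : fieldK0 ∈ symmetryFields (0, 0) Ω := by
  have hs : ContDiff ℝ ∞ fieldK0 := by unfold fieldK0; fun_prop
  refine mem_symmetryFields_iff.2 ⟨hs.contDiffOn, fun z _ _ => ?_⟩
  have h1 : tauC fieldK0 = fun z => z.1.1 ^ 2 := rfl
  have h2 : xiC fieldK0 = fun z => z.1.1 * z.1.2.1 + 3 * z.1.2.2 := rfl
  have h3 : zetaC fieldK0 = fun z => 3 * z.1.1 * z.1.2.2 := rfl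
  have h4 : etaC fieldK0 = fun z => -((z.1.2.1 ^ 2 + 2 * z.1.1) * z.2) := rfl
  have h5 : dd vx (xiC fieldK0) = fun z => z.1.1 := by
    funext z; simp (disch := fun_prop) [h2]
  have h6 : dd vu (etaC fieldK0) = fun z => -(z.1.2.1 ^ 2 + 2 * z.1.1) := by
    funext z; simp (disch := fun_prop) [h4]
  have h7 : dd vx (etaC fieldK0) = fun z => -2 * z.1.2.1 * z.2 := by
    funext z; simp (disch := fun_prop) [h4]
  constructor
  all_goals
    try rw [h5]
    try rw [h6]
    try rw [h7]
    simp (disch := fun_prop) [h1, h2, h3, h4, px_diffusivity_of_eq_zero (θ := (0, 0)) rfl,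
      diffusivity]
  all_goals ring

lemma fieldP3_mem (Ω : TopologicalSpace.Opens Base) : fieldP3 ∈ symmetryFields (0, 0) Ω := by
  have hs : ContDiff ℝ ∞ fieldP3 := by unfold fieldP3; fun_prop
  refine mem_symmetryFields_iff.2 ⟨hs.contDiffOn, fun z _ _ => ?_⟩
  have h1 : tauC fieldP3 = fun z => 0 := rfl
  have h2 : xiC fieldP3 = fun z => 3 * z.1.1 ^ 2 := rfl
  have h3 : zetaC fieldP3 = fun z => z.1.1 ^ 3 := rfl
  have h4 : etaC fieldP3 = fun z => 3 * (z.1.2.2 - z.1.1 * z.1.2.1) * z.2 := rfl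
  have h5 : dd vx (xiC fieldP3) = fun z => 0 := by
    funext z; simp (disch := fun_prop) [h2]
  have h6 : dd vu (etaC fieldP3) = fun z => 3 * (z.1.2.2 - z.1.1 * z.1.2.1) := by
    funext z; simp (disch := fun_prop) [h4]
  have h7 : dd vx (etaC fieldP3) = fun z => -3 * z.1.1 * z.2 := by
    funext z; simp (disch := fun_prop) [h4]
  constructor
  all_goals
    try rw [h5]
    try rw [h6]
    try rw [h7]
    simp (disch := fun_prop) [h1, h2, h3, h4, px_diffusivity_of_eq_zero (θ := (0, 0)) rfl,
      diffusivity]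
  all_goals ring

lemma fieldP2_mem (Ω : TopologicalSpace.Opens Base) : fieldP2 ∈ symmetryFields (0, 0) Ω := by
  have hs : ContDiff ℝ ∞ fieldP2 := by unfold fieldP2; fun_prop
  refine mem_symmetryFields_iff.2 ⟨hs.contDiffOn, fun z _ _ => ?_⟩
  have h1 : tauC fieldP2 = fun z => 0 := rfl
  have h2 : xiC fieldP2 = fun z => 2 * z.1.1 := rfl
  have h3 : zetaC fieldP2 = fun z => z.1.1 ^ 2 := rfl
  have h4 : etaC fieldP2 = fun z => -(z.1.2.1 * z.2) := rfl
  have h5 : dd vx (xiC fieldP2) = fun z => 0 := by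
    funext z; simp (disch := fun_prop) [h2]
  have h6 : dd vu (etaC fieldP2) = fun z => -z.1.2.1 := by
    funext z; simp (disch := fun_prop) [h4]
  have h7 : dd vx (etaC fieldP2) = fun z => -z.2 := by
    funext z; simp (disch := fun_prop) [h4]
  constructor
  all_goals
    try rw [h5]
    try rw [h6]
    try rw [h7]
    simp (disch := fun_prop) [h1, h2, h3, h4, px_diffusivity_of_eq_zero (θ := (0, 0)) rfl,
      diffusivity]

lemma fieldP1_mem (Ω : TopologicalSpace.Opens Base) : fieldP1 ∈ symmetryFields (0, 0) Ω := by
  have hs : ContDiff ℝ ∞ fieldP1 := by unfold fieldP1; fun_prop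
  refine mem_symmetryFields_iff.2 ⟨hs.contDiffOn, fun z _ _ => ?_⟩
  have h1 : tauC fieldP1 = fun z => 0 := rfl
  have h2 : xiC fieldP1 = fun z => 1 := rfl
  have h3 : zetaC fieldP1 = fun z => z.1.1 := rfl
  have h4 : etaC fieldP1 = fun z => 0 := rfl
  have h5 : ∀ (c : ℝ) (e : VarSpace), dd e (fun _ : VarSpace => c) = fun _ => 0 := fun c e =>
    funext fun z => dd_const c e
  constructor
  all_goals simp (disch := fun_prop) [h1, h2, h3, h4, h5,
    px_diffusivity_of_eq_zero (θ := (0, 0)) rfl]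

lemma fieldK2_mem (Ω : TopologicalSpace.Opens Base) : fieldK2 ∈ symmetryFields (0, 2) Ω := by
  have hs : ContDiff ℝ ∞ fieldK2 := by unfold fieldK2; fun_prop
  refine mem_symmetryFields_iff.2 ⟨hs.contDiffOn, fun z _ hr => ?_⟩
  have hx : z.1.2.1 ≠ 0 := ne_of_regular (θ := (0, 2)) two_ne_zero hr
  have h0 := px_diffusivity_of_ne (θ := (0, 2)) hx
  have h1 : tauC fieldK2 = fun z => 0 := rfl
  have h2 : xiC fieldK2 = fun z => 2 * z.1.2.1 * z.1.2.2 := rfl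
  have h3 : zetaC fieldK2 = fun z => z.1.2.2 ^ 2 := rfl
  have h4 : etaC fieldK2 = fun z => -(z.1.2.1 * z.2) := rfl
  have h5 : dd vx (xiC fieldK2) = fun z => 2 * z.1.2.2 := by
    funext z; simp (disch := fun_prop) [h2]
  have h6 : dd vu (etaC fieldK2) = fun z => -z.1.2.1 := by
    funext z; simp (disch := fun_prop) [h4]
  have h7 : dd vx (etaC fieldK2) = fun z => -z.2 := by
    funext z; simp (disch := fun_prop) [h4]
  constructor
  all_goals
    try rw [h5]
    try rw [h6]
    try rw [h7]
    simp (disch := fun_prop) [h0, h1, h2, h3, h4, diffusivity]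
  all_goals field_simp

/-- A Lie symmetry of `u_t + x u_y = |x| ^ 3 u_xx`. -/
noncomputable def fieldK3 : VarSpace → VarSpace :=
  fun z => ((z.1.1 ^ 2, -(2 * z.1.1 * z.1.2.1), 0), -((|z.1.2.1|⁻¹ + 2 * z.1.1) * z.2))

/-- A Lie symmetry of `u_t + x u_y = |x| ^ 5 u_xx`. -/
def fieldK5 : VarSpace → VarSpace :=
  fun z => ((z.1.2.2, -z.1.2.1 ^ 2, 0), -(z.1.2.1 * z.2))

/-- The field is the pull-back of `fieldP1` under the inversion (t, x, y, u) ↦ (y, 1/x, t, u/x);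
here the criterion is checked directly, on both sides of x = 0. -/
lemma fieldK5_mem (Ω : TopologicalSpace.Opens Base) : fieldK5 ∈ symmetryFields (0, 5) Ω := by
  have hs : ContDiff ℝ ∞ fieldK5 := by unfold fieldK5; fun_prop
  refine mem_symmetryFields_iff.2 ⟨hs.contDiffOn, fun z _ hr => ?_⟩
  have hx : z.1.2.1 ≠ 0 := ne_of_regular (θ := (0, 5)) (by norm_num) hr
  have h0 := px_diffusivity_of_ne (θ := (0, 5)) hx
  have h1 : tauC fieldK5 = fun z => z.1.2.2 := rfl
  have h2 : xiC fieldK5 = fun z => -z.1.2.1 ^ 2 := rfl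
  have h3 : zetaC fieldK5 = fun z => 0 := rfl
  have h4 : etaC fieldK5 = fun z => -(z.1.2.1 * z.2) := rfl
  have h5 : dd vx (xiC fieldK5) = fun z => -2 * z.1.2.1 := by
    funext z; simp (disch := fun_prop) [h2]
  have h6 : dd vu (etaC fieldK5) = fun z => -z.1.2.1 := by
    funext z; simp (disch := fun_prop) [h4]
  have h7 : dd vx (etaC fieldK5) = fun z => -z.2 := by
    funext z; simp (disch := fun_prop) [h4]
  constructor
  all_goals
    try rw [h5]
    try rw [h6]
    try rw [h7]
    simp (disch := fun_prop) [h0, h1, h2, h3, h4]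
  all_goals field_simp
  all_goals ring

lemma hasDerivAt_inv_abs {s : ℝ} (hs : s ≠ 0) : HasDerivAt (fun r : ℝ => |r|⁻¹) (-|s|⁻¹ / s) s := by
  have h := (hasDerivAt_abs hs).inv (abs_ne_zero.2 hs)
  refine h.congr_deriv ?_
  rcases lt_or_gt_of_ne hs with h | h
  · rw [abs_of_neg h, sign_neg h]; simp; field_simp
  · rw [abs_of_pos h, sign_pos h]; simp; field_simp

/-- For x > 0 the field is the pull-back of `fieldK2` under the inversion. The absolute value makes
it invariant under (x, y) ↦ (−x, −y), a symmetry of the equation, which covers x < 0. Regularity of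
Ω is needed because the field is singular at x = 0. -/
lemma fieldK3_mem {Ω : TopologicalSpace.Opens Base} (hΩ : ∀ p ∈ Ω, Regular (0, 3) p) :
    fieldK3 ∈ symmetryFields (0, 3) Ω := by
  have hO := isOpen_cylinder Ω
  have hx : ∀ z ∈ cylinder Ω, z.1.2.1 ≠ 0 := fun z hz =>
    ne_of_regular (θ := (0, 3)) (by norm_num) (hΩ _ hz)
  have hg : ∀ z ∈ cylinder Ω, ContDiffAt ℝ ∞ (fun w : VarSpace => |w.1.2.1|⁻¹) z := fun z hz =>
    ((contDiffAt_abs (hx z hz)).comp z (f := fun w : VarSpace => w.1.2.1) (by fun_prop)).inv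
      (abs_ne_zero.2 (hx z hz))
  have hs : ContDiffOn ℝ ∞ fieldK3 (cylinder Ω) := by
    intro z hz
    have := hg z hz
    unfold fieldK3
    exact ContDiffAt.contDiffWithinAt (by fun_prop)
  refine mem_symmetryFields_iff.2 ⟨hs, fun z hz _ => ?_⟩
  have h0 := px_diffusivity_of_ne (θ := (0, 3)) (hx z hz)
  have h1 : tauC fieldK3 = fun z => z.1.1 ^ 2 := rfl
  have h2 : xiC fieldK3 = fun z => -(2 * z.1.1 * z.1.2.1) := rfl
  have h3 : zetaC fieldK3 = fun z => 0 := rfl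
  have h4 : etaC fieldK3 = fun z => -((|z.1.2.1|⁻¹ + 2 * z.1.1) * z.2) := rfl
  have dg : ∀ e, ∀ z ∈ cylinder Ω,
      dd e (fun w : VarSpace => |w.1.2.1|⁻¹) z = -|z.1.2.1|⁻¹ / z.1.2.1 * e.1.2.1 := by
    intro e z hz
    have h : HasFDerivAt (fun w : VarSpace => w.1.2.1) ((ContinuousLinearMap.fst ℝ ℝ ℝ).comp
        ((ContinuousLinearMap.snd ℝ ℝ (ℝ × ℝ)).comp (ContinuousLinearMap.fst ℝ Base ℝ))) z :=
      hasFDerivAt_fst.comp z (hasFDerivAt_snd.comp z hasFDerivAt_fst)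
    have h' := (hasDerivAt_inv_abs (hx z hz)).comp_hasFDerivAt z h
    have h'' : HasFDerivAt (fun w : VarSpace => |w.1.2.1|⁻¹) _ z := h'
    simp [dd, h''.fderiv]
  have dη : ∀ e, ∀ z ∈ cylinder Ω, dd e (etaC fieldK3) z
      = -((-|z.1.2.1|⁻¹ / z.1.2.1 * e.1.2.1 + 2 * e.1.1) * z.2
        + (|z.1.2.1|⁻¹ + 2 * z.1.1) * e.2) := by
    intro e z hz
    have d1 := (hg z hz).diffAt
    have d2 : DifferentiableAt ℝ (fun w : VarSpace => |w.1.2.1|⁻¹ + 2 * w.1.1) z := by fun_prop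
    rw [h4, dd_neg, dd_mul d2 (by fun_prop), dd_add d1 (by fun_prop), dg e z hz]
    simp (disch := fun_prop)
  have h5 : dd vx (xiC fieldK3) = fun z => -(2 * z.1.1) := by
    funext z; simp (disch := fun_prop) [h2]
  have h6 : ∀ z ∈ cylinder Ω, dd vu (etaC fieldK3) z = -(|z.1.2.1|⁻¹ + 2 * z.1.1) := by
    intro z hz; rw [dη vu z hz]; simp
  have h7 : ∀ z ∈ cylinder Ω, dd vx (etaC fieldK3) z = |z.1.2.1|⁻¹ * z.1.2.1⁻¹ * z.2 := by
    intro z hz; rw [dη vx z hz]; simp; ring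
  have h8 : ∀ e, dd e (dd vu (etaC fieldK3)) z
      = |z.1.2.1|⁻¹ / z.1.2.1 * e.1.2.1 - 2 * e.1.1 := by
    intro e
    have d1 := (hg z hz).diffAt
    rw [dd_eqOn hO h6 e z hz, dd_neg, dd_add d1 (by fun_prop), dg e z hz]
    simp (disch := fun_prop); ring
  have hx0 := hx z hz
  have h9 : dd vx (dd vx (etaC fieldK3)) z = -2 * |z.1.2.1|⁻¹ / z.1.2.1 ^ 2 * z.2 := by
    have d1 := (hg z hz).diffAt
    have h : HasFDerivAt (fun w : VarSpace => w.1.2.1) ((ContinuousLinearMap.fst ℝ ℝ ℝ).comp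
        ((ContinuousLinearMap.snd ℝ ℝ (ℝ × ℝ)).comp (ContinuousLinearMap.fst ℝ Base ℝ))) z :=
      hasFDerivAt_fst.comp z (hasFDerivAt_snd.comp z hasFDerivAt_fst)
    have hc := (hasDerivAt_inv hx0).comp_hasFDerivAt z h
    have hi : HasFDerivAt (fun w : VarSpace => w.1.2.1⁻¹) _ z := hc
    have hi' : dd vx (fun w : VarSpace => w.1.2.1⁻¹) z = -(z.1.2.1 ^ 2)⁻¹ := by
      simp [dd, hi.fderiv]
    have d2 : DifferentiableAt ℝ (fun w : VarSpace => |w.1.2.1|⁻¹ * w.1.2.1⁻¹) z :=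
      d1.mul hi.differentiableAt
    rw [dd_eqOn hO h7 vx z hz, dd_mul d2 (by fun_prop),
      dd_mul d1 hi.differentiableAt, dg vx z hz, hi']
    simp
    field_simp
    norm_num
  have hA : diffusivity (0, 3) z.1 = |z.1.2.1| ^ 3 := by simp [diffusivity]
  constructor
  all_goals
    try rw [h5]
    try rw [h8]
    try rw [h9]
  case eta_xu =>
    simp (disch := fun_prop) [hA, h2]
    field_simp
    rw [sq_abs]
  case eta_eq =>
    rw [dη vt z hz, dη vy z hz, hA]
    simp
    field_simp
    rw [sq_abs]
  all_goals simp (disch := fun_prop) [h0, h1, h2, h3]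
  all_goals field_simp
  all_goals ring

end Fields

/-! ### Functions of `t` and `y` -/

section Smooth

variable {E : Type*} [NormedAddCommGroup E] [NormedSpace ℝ E] {O : Set E} {f : E → ℝ}

lemma ContDiffOn.dd (hf : ContDiffOn ℝ ∞ f O) (hO : IsOpen O) (e : E) :
    ContDiffOn ℝ ∞ (dd e f) O := fun _ hz =>
  ((hf.contDiffAt (hO.mem_nhds hz)).dd e).contDiffWithinAt

lemma dd_comm_on (hf : ContDiffOn ℝ ∞ f O) (hO : IsOpen O) (e e' : E) :
    ∀ z ∈ O, dd e (dd e' f) z = dd e' (dd e f) z := fun _ hz =>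
  dd_comm (hf.contDiffAt (hO.mem_nhds hz)).two e e'

end Smooth

/-- Smooth functions on `O` that locally depend only on `t` and `y`. -/
structure TY (O : Set VarSpace) (f : VarSpace → ℝ) : Prop where
  smooth : ContDiffOn ℝ ∞ f O
  dx : ∀ z ∈ O, dd vx f z = 0
  du : ∀ z ∈ O, dd vu f z = 0

section TYLemmas

variable {O : Set VarSpace} {f g c₀ c₁ c₂ : VarSpace → ℝ}

lemma TY.diff (hf : TY O f) (hO : IsOpen O) {z : VarSpace} (hz : z ∈ O) :
    DifferentiableAt ℝ f z := (hf.smooth.contDiffAt (hO.mem_nhds hz)).diffAt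

lemma TY.dd (hf : TY O f) (hO : IsOpen O) (e : VarSpace) : TY O (dd e f) where
  smooth := hf.smooth.dd hO e
  dx z hz := by rw [dd_comm_on hf.smooth hO _ _ z hz]; exact dd_zero_on hO hf.dx e z hz
  du z hz := by rw [dd_comm_on hf.smooth hO _ _ z hz]; exact dd_zero_on hO hf.du e z hz

lemma TY.add (hf : TY O f) (hg : TY O g) (hO : IsOpen O) : TY O (fun z => f z + g z) where
  smooth := hf.smooth.add hg.smooth
  dx z hz := by rw [dd_add (hf.diff hO hz) (hg.diff hO hz), hf.dx z hz, hg.dx z hz, add_zero]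
  du z hz := by rw [dd_add (hf.diff hO hz) (hg.diff hO hz), hf.du z hz, hg.du z hz, add_zero]

lemma TY.const_mul (hf : TY O f) (hO : IsOpen O) (c : ℝ) : TY O (fun z => c * f z) where
  smooth := contDiffOn_const.mul hf.smooth
  dx z hz := by rw [dd_const_mul (hf.diff hO hz), hf.dx z hz, mul_zero]
  du z hz := by rw [dd_const_mul (hf.diff hO hz), hf.du z hz, mul_zero]

lemma TY.const (c : ℝ) : TY O (fun _ => c) where
  smooth := contDiffOn_const
  dx _ _ := dd_const c _
  du _ _ := dd_const c _

lemma dd_polynomial {z : VarSpace} (h₀ : DifferentiableAt ℝ c₀ z) (h₁ : DifferentiableAt ℝ c₁ z)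
    (h₂ : DifferentiableAt ℝ c₂ z) (α : ℝ) (e : VarSpace) :
    dd e (fun w => c₀ w + c₁ w * (w.1.2.1 - α) + c₂ w * (w.1.2.1 - α) ^ 2) z
      = dd e c₀ z + dd e c₁ z * (z.1.2.1 - α) + dd e c₂ z * (z.1.2.1 - α) ^ 2
        + e.1.2.1 * (c₁ z + 2 * c₂ z * (z.1.2.1 - α)) := by
  have h : DifferentiableAt ℝ (fun w : VarSpace => w.1.2.1 - α) z := by fun_prop
  have h' : DifferentiableAt ℝ (fun w : VarSpace => (w.1.2.1 - α) ^ 2) z := by fun_prop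
  have h'' : DifferentiableAt ℝ (fun w : VarSpace => w.1.2.1) z := by fun_prop
  rw [dd_add (h₀.fun_add (h₁.fun_mul h)) (h₂.fun_mul h'), dd_add h₀ (h₁.fun_mul h), dd_mul h₁ h, dd_mul h₂ h',
    dd_pow h, dd_sub h'' (differentiableAt_const α), dd_coord_x, dd_const]
  push_cast
  ring

/-- Differentiating twice in x isolates the coefficients from the top down. This is pointwise and
local, so the x-sections of O may have any shape. -/
lemma polynomial_eq_zero (hO : IsOpen O) (h₀ : TY O c₀) (h₁ : TY O c₁) (h₂ : TY O c₂) (α : ℝ)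
    (h : ∀ z ∈ O, c₀ z + c₁ z * (z.1.2.1 - α) + c₂ z * (z.1.2.1 - α) ^ 2 = 0) :
    (∀ z ∈ O, c₀ z = 0) ∧ (∀ z ∈ O, c₁ z = 0) ∧ ∀ z ∈ O, c₂ z = 0 := by
  have k1 : ∀ z ∈ O, c₁ z + (fun z => 2 * c₂ z) z * (z.1.2.1 - α)
      + (fun _ => 0) z * (z.1.2.1 - α) ^ 2 = 0 := by
    intro z hz
    have := dd_zero_on hO h vx z hz
    rw [dd_polynomial (h₀.diff hO hz) (h₁.diff hO hz) (h₂.diff hO hz), h₀.dx z hz, h₁.dx z hz,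
      h₂.dx z hz] at this
    simp only [vx] at this ⊢
    linarith
  have k2 : ∀ z ∈ O, c₂ z = 0 := by
    intro z hz
    have := dd_zero_on hO k1 vx z hz
    have h₂' := h₂.const_mul hO 2
    rw [dd_polynomial (h₁.diff hO hz) (h₂'.diff hO hz) (differentiableAt_const _), h₁.dx z hz,
      h₂'.dx z hz, dd_const] at this
    simp only [vx] at this
    linarith
  have k1' : ∀ z ∈ O, c₁ z = 0 := fun z hz => by
    have := k1 z hz
    simp only [k2 z hz] at this
    linarith
  refine ⟨fun z hz => ?_, k1', k2⟩
  have := h z hz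
  rw [k1' z hz, k2 z hz] at this
  linarith

lemma var_apply (L : VarSpace →L[ℝ] ℝ) (a : VarSpace) :
    L a = a.1.1 * L vt + a.1.2.1 * L vx + a.1.2.2 * L vy + a.2 * L vu := by
  have : a = a.1.1 • vt + a.1.2.1 • vx + a.1.2.2 • vy + a.2 • vu := by
    ext <;> simp [vt, vx, vy, vu]
  conv_lhs => rw [this]
  simp only [map_add, map_smul, smul_eq_mul]

/-- All integrations below go through this; connectedness makes the integration constants global. -/
lemma eq_add_const (hO : IsOpen O) (hc : IsPreconnected O) (hf : ContDiffOn ℝ ∞ f O)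
    (hg : ContDiffOn ℝ ∞ g O) (ht : ∀ z ∈ O, dd vt f z = dd vt g z)
    (hx : ∀ z ∈ O, dd vx f z = dd vx g z) (hy : ∀ z ∈ O, dd vy f z = dd vy g z)
    (hu : ∀ z ∈ O, dd vu f z = dd vu g z) : ∃ c : ℝ, ∀ z ∈ O, f z = g z + c := by
  have df := fun z hz => (hf.contDiffAt (hO.mem_nhds (x := z) hz)).diffAt
  have dg := fun z hz => (hg.contDiffAt (hO.mem_nhds (x := z) hz)).diffAt
  obtain ⟨c, hc⟩ := hO.exists_is_const_of_fderiv_eq_zero (𝕜 := ℝ) hc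
    (f := fun z => f z - g z) (fun z hz => ((df z hz).sub (dg z hz)).differentiableWithinAt) (by
      intro z hz
      refine ContinuousLinearMap.ext fun a => ?_
      rw [fderiv_fun_sub (df z hz) (dg z hz), var_apply]
      simp only [sub_apply, ← dd_eq_fderiv, ht z hz, hx z hz, hy z hz, hu z hz]
      simp)
  exact ⟨c, fun z hz => by linarith [hc z hz]⟩

lemma TY.eq_add_const (hf : TY O f) (hg : TY O g) (hO : IsOpen O) (hc : IsPreconnected O)
    (ht : ∀ z ∈ O, _root_.dd vt f z = _root_.dd vt g z)
    (hy : ∀ z ∈ O, _root_.dd vy f z = _root_.dd vy g z) : ∃ c : ℝ, ∀ z ∈ O, f z = g z + c :=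
  _root_.eq_add_const hO hc hf.smooth hg.smooth ht
    (fun z hz => by rw [hf.dx z hz, hg.dx z hz]) hy (fun z hz => by rw [hf.du z hz, hg.du z hz])

lemma TY.exists_const (hf : TY O f) (hO : IsOpen O) (hc : IsPreconnected O)
    (ht : ∀ z ∈ O, _root_.dd vt f z = 0) (hy : ∀ z ∈ O, _root_.dd vy f z = 0) :
    ∃ c : ℝ, ∀ z ∈ O, f z = c := by
  obtain ⟨c, h⟩ := hf.eq_add_const (TY.const 0) hO hc
    (fun z hz => by rw [ht z hz, dd_const]) (fun z hz => by rw [hy z hz, dd_const])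
  exact ⟨c, fun z hz => by rw [h z hz, zero_add]⟩

end TYLemmas

/-! ### Consequences of the determining equations -/

lemma isPreconnected_cylinder {Ω : TopologicalSpace.Opens Base}
    (hΩ : IsConnected (Ω : Set Base)) : IsPreconnected (cylinder Ω) := by
  have : cylinder Ω = (Ω : Set Base) ×ˢ univ := by ext z; simp [cylinder]
  rw [this]
  exact hΩ.isPreconnected.prod isPreconnected_univ

lemma differentiableAt_diffusivity {θ : Param} {p : Base} (hr : Regular θ p) :
    DifferentiableAt ℝ (diffusivity θ) p := by
  by_cases hβ : θ.2 = 0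
  · have : diffusivity θ = fun _ => 1 := by funext q; simp [diffusivity, hβ]
    rw [this]; exact differentiableAt_const _
  · have hne := sub_ne_zero.2 (ne_of_regular hβ hr)
    exact (hasDerivAt_abs_rpow_div θ.2 hne).differentiableAt.comp p
      (f := fun q : Base => q.2.1 - θ.1) (by fun_prop)

section Symmetry

variable {θ : Param} {Ω : TopologicalSpace.Opens Base} {v w : VarSpace → VarSpace}

lemma symmetry_smooth (hv : v ∈ symmetryFields θ Ω) :
    ContDiffOn ℝ ∞ (tauC v) (cylinder Ω) ∧ ContDiffOn ℝ ∞ (xiC v) (cylinder Ω) ∧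
      ContDiffOn ℝ ∞ (zetaC v) (cylinder Ω) ∧ ContDiffOn ℝ ∞ (etaC v) (cylinder Ω) :=
  ⟨hv.1.fst.fst, hv.1.fst.snd.fst, hv.1.fst.snd.snd, hv.1.snd⟩

lemma symmetry_determining (hΩ : ∀ p ∈ Ω, Regular θ p) (hv : v ∈ symmetryFields θ Ω) :
    ∀ z ∈ cylinder Ω, Determining θ v z := fun z hz =>
  (mem_symmetryFields_iff.1 hv).2 z hz (hΩ _ hz)

lemma symmetry_tau (hΩ : ∀ p ∈ Ω, Regular θ p) (hv : v ∈ symmetryFields θ Ω) :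
    TY (cylinder Ω) (tauC v) :=
  ⟨(symmetry_smooth hv).1, fun z hz => (symmetry_determining hΩ hv z hz).tau_x,
    fun z hz => (symmetry_determining hΩ hv z hz).tau_u⟩

lemma symmetry_zeta (hΩ : ∀ p ∈ Ω, Regular θ p) (hv : v ∈ symmetryFields θ Ω) :
    TY (cylinder Ω) (zetaC v) :=
  ⟨(symmetry_smooth hv).2.2.1, fun z hz => (symmetry_determining hΩ hv z hz).zeta_x,
    fun z hz => (symmetry_determining hΩ hv z hz).zeta_u⟩

/-- The derivative with respect to `u` of the `u`-component of a Lie symmetry field is a solution. -/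
lemma symmetry_eta_u (hΩ : ∀ p ∈ Ω, Regular θ p) (hv : v ∈ symmetryFields θ Ω) :
    ∀ z ∈ cylinder Ω, dd vt (dd vu (etaC v)) z + z.1.2.1 * dd vy (dd vu (etaC v)) z
      = diffusivity θ z.1 * dd vx (dd vx (dd vu (etaC v))) z := by
  have hO := isOpen_cylinder Ω
  have hη := (symmetry_smooth hv).2.2.2
  intro z hz
  have hd : ∀ {f : VarSpace → ℝ}, ContDiffOn ℝ ∞ f (cylinder Ω) → DifferentiableAt ℝ f z :=
    fun hf => (hf.contDiffAt (hO.mem_nhds hz)).diffAt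
  have h := dd_eqOn hO (fun z hz => (symmetry_determining hΩ hv z hz).eta_eq) vu z hz
  have hx : DifferentiableAt ℝ (fun w : VarSpace => w.1.2.1) z := by fun_prop
  have hA : DifferentiableAt ℝ (fun w : VarSpace => diffusivity θ w.1) z :=
    (differentiableAt_diffusivity (hΩ _ hz)).comp z differentiableAt_fst
  have hA' : dd vu (fun w : VarSpace => diffusivity θ w.1) z = 0 := by
    rw [dd_comp_fst (differentiableAt_diffusivity (hΩ _ hz))]
    exact map_zero (fderiv ℝ (diffusivity θ) z.1)
  have hx' : vu.1.2.1 = 0 := rfl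
  have e : dd vu (dd vx (dd vx (etaC v))) z = dd vx (dd vx (dd vu (etaC v))) z := by
    rw [dd_comm_on (hη.dd hO vx) hO vu vx z hz]
    exact dd_eqOn hO (dd_comm_on hη hO vu vx) vx z hz
  rw [dd_add (hd (hη.dd hO vt)) (hx.fun_mul (hd (hη.dd hO vy))), dd_mul hx (hd (hη.dd hO vy)),
    dd_mul hA (hd ((hη.dd hO vx).dd hO vx)), dd_coord_x, hA', hx', e, dd_comm_on hη hO vu vt z hz,
    dd_comm_on hη hO vu vy z hz] at h
  linarith

/-- The component `ξˣ` is quadratic in `x`, and the classifying equations hold. -/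
lemma symmetry_classifying (hΩ : ∀ p ∈ Ω, Regular θ p) (hv : v ∈ symmetryFields θ Ω) :
    ∀ z ∈ cylinder Ω, (θ.2 - 5) * dd vy (tauC v) z = 0 ∧
      (2 - θ.2) * (dd vy (zetaC v) z - θ.1 * dd vy (tauC v) z)
        = (3 - θ.2) * (dd vt (tauC v) z + θ.1 * dd vy (tauC v) z) ∧
      θ.2 * (dd vt (zetaC v) z + θ.1 * dd vy (zetaC v) z
        - θ.1 * (dd vt (tauC v) z + θ.1 * dd vy (tauC v) z)) = 0 := by
  have hO := isOpen_cylinder Ω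
  have hτ := symmetry_tau hΩ hv
  have hζ := symmetry_zeta hΩ hv
  have hdet := symmetry_determining hΩ hv
  obtain ⟨α, β⟩ := θ
  set τt := dd vt (tauC v)
  set τy := dd vy (tauC v)
  set ζt := dd vt (zetaC v)
  set ζy := dd vy (zetaC v)
  have Tτt : TY _ τt := hτ.dd hO vt
  have Tτy : TY _ τy := hτ.dd hO vy
  have Tζt : TY _ ζt := hζ.dd hO vt
  have Tζy : TY _ ζy := hζ.dd hO vy
  -- T0, T1 and T2 belong to the Taylor coefficients of ξˣ at x = α.
  have T0 : TY (cylinder Ω) fun z => (ζt z + α * ζy z) + (-α) * (τt z + α * τy z) :=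
    (Tζt.add (Tζy.const_mul hO _) hO).add ((Tτt.add (Tτy.const_mul hO _) hO).const_mul hO _) hO
  have T1 : TY (cylinder Ω) fun z => ζy z + ((-1) * τt z + (-2 * α) * τy z) :=
    Tζy.add ((Tτt.const_mul hO _).add (Tτy.const_mul hO _) hO) hO
  have T2 : TY (cylinder Ω) fun z => (-1) * τy z := Tτy.const_mul hO _
  have hξ : ∀ z ∈ cylinder Ω, xiC v z = ((ζt z + α * ζy z) + (-α) * (τt z + α * τy z))
      + (ζy z + ((-1) * τt z + (-2 * α) * τy z)) * (z.1.2.1 - α)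
      + ((-1) * τy z) * (z.1.2.1 - α) ^ 2 := by
    intro z hz
    rw [(hdet z hz).xi_eq]
    ring
  have hξx : ∀ z ∈ cylinder Ω, dd vx (xiC v) z
      = (ζy z + ((-1) * τt z + (-2 * α) * τy z)) + 2 * ((-1) * τy z) * (z.1.2.1 - α) := by
    intro z hz
    rw [dd_eqOn hO hξ vx z hz, dd_polynomial (T0.diff hO hz) (T1.diff hO hz) (T2.diff hO hz),
      T0.dx z hz, T1.dx z hz, T2.dx z hz]
    simp only [vx]
    ring
  -- These belong to the coefficients, in powers of s = x − α, of (2ξ_x − τ_t − xτ_y)s − βξ.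
  have S0 := T0.const_mul hO (-β)
  have S1 : TY (cylinder Ω) fun z => (2 - β) * (ζy z + ((-1) * τt z + (-2 * α) * τy z))
      + ((-1) * τt z + (-α) * τy z) :=
    (T1.const_mul hO (2 - β)).add ((Tτt.const_mul hO _).add (Tτy.const_mul hO _) hO) hO
  have S2 : TY (cylinder Ω) fun z => (β - 5) * τy z := Tτy.const_mul hO _
  obtain ⟨k0, k1, k2⟩ := polynomial_eq_zero hO S0 S1 S2 α (by
    intro z hz
    have h1 := (hdet z hz).xi_x
    have h2 := px_diffusivity _ (hΩ _ hz)
    have hA : diffusivity (α, β) z.1 ≠ 0 := hΩ _ hz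
    -- Multiplication by x − α turns A' into βA, so the nonzero diffusivity factors out.
    have h3 : diffusivity (α, β) z.1 * ((2 * dd vx (xiC v) z - τt z - z.1.2.1 * τy z)
        * (z.1.2.1 - α) - xiC v z * β) = 0 := by
      linear_combination (z.1.2.1 - α) * h1 + xiC v z * h2
    have h4 := (mul_eq_zero.1 h3).resolve_left hA
    rw [hξx z hz, hξ z hz] at h4
    linear_combination h4)
  intro z hz
  have := k0 z hz
  have := k1 z hz
  refine ⟨k2 z hz, ?_, ?_⟩ <;> simp only <;> linarith

end Symmetry

/-! ### The maximal Lie invariance algebras -/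

section Algebras

variable {θ : Param} {Ω : TopologicalSpace.Opens Base} {v w : VarSpace → VarSpace}
  {S : Set (VarSpace → VarSpace)}

lemma restrictTo_congr (h : ∀ z ∈ cylinder Ω, v z = w z) : restrictTo Ω v = restrictTo Ω w := by
  funext z
  exact h z.1 z.2

lemma restrictTo_mem_spanOver (h : v ∈ S) : restrictTo Ω v ∈ spanOver Ω S :=
  Submodule.mem_map_of_mem (Submodule.subset_span h)

lemma spanOver_le_iff {P : Submodule ℝ (cylinder Ω → VarSpace)} :
    spanOver Ω S ≤ P ↔ ∀ v ∈ S, restrictTo Ω v ∈ P := by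
  rw [spanOver, Submodule.map_span, Submodule.span_le]
  exact ⟨fun h v hv => h ⟨v, hv, rfl⟩, by rintro h _ ⟨v, hv, rfl⟩; exact h v hv⟩

lemma field_ext {a b : VarSpace → VarSpace} {z : VarSpace} (h1 : tauC a z = tauC b z)
    (h2 : xiC a z = xiC b z) (h3 : zetaC a z = zetaC b z) (h4 : etaC a z = etaC b z) :
    a z = b z := by
  simp only [tauC, xiC, zetaC, etaC] at *
  exact Prod.ext (Prod.ext h1 (Prod.ext h2 h3)) h4

lemma symmetry_xi_eq_zero (hΩ : ∀ p ∈ Ω, Regular θ p) (hv : v ∈ symmetryFields θ Ω)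
    (h1 : ∀ z ∈ cylinder Ω, tauC v z = 0) (h3 : ∀ z ∈ cylinder Ω, zetaC v z = 0) :
    ∀ z ∈ cylinder Ω, xiC v z = 0 := by
  have hO := isOpen_cylinder Ω
  intro z hz
  rw [(symmetry_determining hΩ hv z hz).xi_eq, dd_zero_on hO h3 _ z hz, dd_zero_on hO h3 _ z hz,
    dd_zero_on hO h1 _ z hz, dd_zero_on hO h1 _ z hz]
  ring

/-- A function that does not depend on `u`, in terms of its restriction to `u = 0`. -/
lemma eq_at_zero_of_dd_u {f : VarSpace → ℝ} (hf : ContDiffOn ℝ ∞ f (cylinder Ω))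
    (h : ∀ z ∈ cylinder Ω, dd vu f z = 0) {p : Base} (hp : p ∈ Ω) (u : ℝ) :
    f (p, u) = f (p, 0) := by
  have hd : ∀ s : ℝ, HasDerivAt (fun s => f (p, s)) (dd vu f (p, s)) s := by
    intro s
    have h1 : HasFDerivAt f _ (p, s) :=
      (contDiffAt_of_mem_cylinder hf (z := (p, s)) hp).diffAt.hasFDerivAt
    have h2 : HasDerivAt (fun s : ℝ => ((p, s) : VarSpace)) ((0, 1) : VarSpace) s :=
      (hasDerivAt_const s p).prodMk (hasDerivAt_id s)
    exact h1.comp_hasDerivAt s h2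
  exact is_const_of_deriv_eq_zero (fun s => (hd s).differentiableAt)
    (fun s => by rw [(hd s).deriv]; exact h _ hp) u 0

lemma dd_slice {f : VarSpace → ℝ} {p : Base} (hf : DifferentiableAt ℝ f (p, 0)) (e : Base) :
    dd e (fun q => f (q, 0)) p = dd (e, (0 : ℝ)) f (p, 0) := by
  rw [dd_comp_graph (u := fun _ => 0) hf (differentiableAt_const _), dd_const]
  ring

/-- The restriction to `u = 0` of a solution of the last determining equation is a solution. -/
lemma eqResidual_slice {f : VarSpace → ℝ} {p : Base} (hf : ContDiffAt ℝ ∞ f (p, 0))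
    (h : dd vt f (p, 0) + p.2.1 * dd vy f (p, 0) = diffusivity θ p * dd vx (dd vx f) (p, 0)) :
    eqResidual θ (fun q => f (q, 0)) p = 0 := by
  have h2 : px (px fun q => f (q, 0)) p = dd vx (dd vx f) (p, 0) := by
    change dd _ (dd _ _) p = _
    rw [dd_dd_comp_graph (u := fun _ => 0) hf contDiff_const, dd_const,
      show dd ((0, 1, 0) : Base) (fun _ : Base => (0 : ℝ)) = fun _ => 0 from
        funext fun _ => dd_const _ _, dd_const]
    simp only [vx]
    ring
  have h3 : pt (fun q => f (q, 0)) p = dd vt f (p, 0) := dd_slice hf.diffAt _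
  have h4 : py (fun q => f (q, 0)) p = dd vy f (p, 0) := dd_slice hf.diffAt _
  rw [eqResidual, h2, h3, h4, h, sub_self]

/-- With ξˣ = 0, the equation for η_xu gives (η_u)_x = 0. Then η_u is a solution independent of x
and u, so (η_u)_t + x(η_u)_y = 0 splits into two vanishing derivatives. -/
lemma exists_eta_u_eq (hΩ : IsRegularDomain θ Ω) (hv : v ∈ symmetryFields θ Ω)
    (h1 : ∀ z ∈ cylinder Ω, tauC v z = 0) (h3 : ∀ z ∈ cylinder Ω, zetaC v z = 0) :
    ∃ c : ℝ, ∀ z ∈ cylinder Ω, dd vu (etaC v) z = c := by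
  have hO := isOpen_cylinder Ω
  have hη := (symmetry_smooth hv).2.2.2
  have hdet := symmetry_determining hΩ.2 hv
  have h2 := symmetry_xi_eq_zero hΩ.2 hv h1 h3
  have hχ : TY (cylinder Ω) (dd vu (etaC v)) := by
    refine ⟨hη.dd hO vu, fun z hz => ?_, fun z hz => (hdet z hz).eta_uu⟩
    have h := (hdet z hz).eta_xu
    rw [dd_zero_on hO h2 _ z hz, dd_zero_on hO h2 _ z hz,
      dd_zero_on hO (dd_zero_on hO h2 _) _ z hz] at h
    have h' : diffusivity θ z.1 * dd vx (dd vu (etaC v)) z = 0 := by linarith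
    exact (mul_eq_zero.1 h').resolve_left (hΩ.2 _ hz)
  obtain ⟨k0, k1, -⟩ := polynomial_eq_zero hO (hχ.dd hO vt) (hχ.dd hO vy) (TY.const 0) 0 (by
    intro z hz
    have h := symmetry_eta_u hΩ.2 hv z hz
    rw [dd_zero_on hO hχ.dx _ z hz] at h
    linear_combination h)
  exact hχ.exists_const hO (isPreconnected_cylinder hΩ.1) k0 k1

/-- Constancy of η_u makes η = cu + f. The fibres of the cylinder are full lines in u, so f can be
read off at u = 0, where the last determining equation says that it is a solution. -/
lemma restrictTo_mem_general (hΩ : IsRegularDomain θ Ω) (hv : v ∈ symmetryFields θ Ω)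
    (h1 : ∀ z ∈ cylinder Ω, tauC v z = 0) (h3 : ∀ z ∈ cylinder Ω, zetaC v z = 0) :
    restrictTo Ω v ∈ generalAlgebra θ Ω := by
  have hη := (symmetry_smooth hv).2.2.2
  have hdet := symmetry_determining hΩ.2 hv
  have h2 := symmetry_xi_eq_zero hΩ.2 hv h1 h3
  obtain ⟨c, hc⟩ := exists_eta_u_eq hΩ hv h1 h3
  have hη' : ∀ p ∈ Ω, ∀ u : ℝ, etaC v (p, u) = c * u + etaC v (p, 0) := by
    intro p hp u
    have := eq_at_zero_of_dd_u (Ω := Ω) (f := fun z => etaC v z - c * z.2)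
      (hη.sub (by fun_prop)) (by
        intro z hz
        rw [dd_sub (contDiffAt_of_mem_cylinder hη hz).diffAt (by fun_prop),
          dd_const_mul (by fun_prop), dd_coord_u, hc z hz]
        simp [vu]) hp u
    simp only at this
    linarith
  have hsol : IsSolutionOn θ Ω fun q => etaC v (q, 0) := by
    refine ⟨hη.comp (by fun_prop) fun q hq => hq, fun p hp => ?_⟩
    exact eqResidual_slice (contDiffAt_of_mem_cylinder hη (z := (p, 0)) hp)
      (hdet (p, 0) hp).eta_eq
  have e : restrictTo Ω v = restrictTo Ω (c • fieldI + fieldZ fun q => etaC v (q, 0)) := by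
    refine restrictTo_congr fun z hz => field_ext ?_ ?_ ?_ ?_
    · rw [h1 z hz]; simp [tauC, fieldI, fieldZ]
    · rw [h2 z hz]; simp [xiC, fieldI, fieldZ]
    · rw [h3 z hz]; simp [zetaC, fieldI, fieldZ]
    · rw [show z = (z.1, z.2) from rfl, hη' z.1 hz z.2]; simp [etaC, fieldI, fieldZ]
  rw [e, map_add, map_smul]
  exact add_mem (Submodule.smul_mem _ _ (restrictTo_mem_spanOver (by simp)))
    (restrictTo_mem_spanOver (Or.inr ⟨_, hsol, rfl⟩))

/-- Two Lie symmetry fields with the same components `τ` and `ξʸ` are equal modulo the general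
algebra. -/
lemma restrictTo_mem_of_eq (hΩ : IsRegularDomain θ Ω) (hv : v ∈ symmetryFields θ Ω)
    (hw : w ∈ symmetryFields θ Ω) {P : Submodule ℝ (cylinder Ω → VarSpace)}
    (hP : generalAlgebra θ Ω ≤ P) (hwP : restrictTo Ω w ∈ P)
    (h1 : ∀ z ∈ cylinder Ω, tauC v z = tauC w z) (h3 : ∀ z ∈ cylinder Ω, zetaC v z = zetaC w z) :
    restrictTo Ω v ∈ P := by
  have h : restrictTo Ω (v - w) ∈ generalAlgebra θ Ω :=
    restrictTo_mem_general hΩ (sub_mem hv hw)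
      (fun z hz => by have := h1 z hz; simp only [tauC, Pi.sub_apply, Prod.fst_sub] at *; linarith)
      (fun z hz => by
        have := h3 z hz; simp only [zetaC, Pi.sub_apply, Prod.fst_sub, Prod.snd_sub] at *; linarith)
  rw [map_sub] at h
  simpa using add_mem (hP h) hwP

lemma generalAlgebra_le (θ : Param) (Ω : TopologicalSpace.Opens Base) :
    generalAlgebra θ Ω ≤ maximalAlgebra θ Ω := by
  refine spanOver_le_iff.2 ?_
  rintro v (h | ⟨f, hf, rfl⟩)
  · simp only [mem_insert_iff, mem_singleton_iff] at h
    rcases h with rfl | rfl | rfl | rfl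
    exacts [⟨_, fieldPt_mem θ Ω, rfl⟩, ⟨_, fieldPy_mem θ Ω, rfl⟩, ⟨_, fieldI_mem θ Ω, rfl⟩,
      ⟨_, fieldD_mem θ Ω, rfl⟩]
  · exact ⟨_, fieldZ_mem hf.1 fun p hp _ => hf.2 p hp, rfl⟩

/-- There is no essential Lie symmetry extension unless `β ∈ {0, 2, 3, 5}`. -/
lemma maximalAlgebra_le_general (hΩ : IsRegularDomain θ Ω) (h0 : θ.2 ≠ 0) (h2 : θ.2 ≠ 2)
    (h3 : θ.2 ≠ 3) (h5 : θ.2 ≠ 5) : maximalAlgebra θ Ω ≤ generalAlgebra θ Ω := by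
  rintro _ ⟨v, hv, rfl⟩
  have hO := isOpen_cylinder Ω
  have hc := isPreconnected_cylinder hΩ.1
  have hτ := symmetry_tau hΩ.2 hv
  have hζ := symmetry_zeta hΩ.2 hv
  have hcl := symmetry_classifying hΩ.2 hv
  have τy : ∀ z ∈ cylinder Ω, dd vy (tauC v) z = 0 := fun z hz =>
    (mul_eq_zero.1 (hcl z hz).1).resolve_left (sub_ne_zero.2 h5)
  have e1 : ∀ z ∈ cylinder Ω, (2 - θ.2) * dd vy (zetaC v) z = (3 - θ.2) * dd vt (tauC v) z := by
    intro z hz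
    have := (hcl z hz).2.1
    rw [τy z hz] at this
    linarith
  have e0 : ∀ z ∈ cylinder Ω, dd vt (zetaC v) z = θ.1 * dd vt (tauC v) z
      - θ.1 * dd vy (zetaC v) z := by
    intro z hz
    have := (mul_eq_zero.1 (hcl z hz).2.2).resolve_left h0
    rw [τy z hz] at this
    linarith
  have dτ := hτ.dd hO vt
  have dζ := hζ.dd hO vy
  -- Cross-differentiating the three first-order relations shows that τ_t and ζ_y are constant; β ≠
  -- 2 and β ≠ 3 are used to cancel their coefficients.
  have τty : ∀ z ∈ cylinder Ω, dd vy (dd vt (tauC v)) z = 0 := fun z hz => by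
    rw [dd_comm_on hτ.smooth hO _ _ z hz, dd_zero_on hO τy _ z hz]
  have e1' : ∀ e : VarSpace, ∀ z ∈ cylinder Ω, (2 - θ.2) * dd e (dd vy (zetaC v)) z
      = (3 - θ.2) * dd e (dd vt (tauC v)) z := by
    intro e z hz
    have := dd_eqOn hO e1 e z hz
    rwa [dd_const_mul (dζ.diff hO hz), dd_const_mul (dτ.diff hO hz)] at this
  have ζyy : ∀ z ∈ cylinder Ω, dd vy (dd vy (zetaC v)) z = 0 := fun z hz => by
    have := e1' vy z hz
    rw [τty z hz, mul_zero] at this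
    exact (mul_eq_zero.1 this).resolve_left (sub_ne_zero.2 (Ne.symm h2))
  have ζty : ∀ z ∈ cylinder Ω, dd vt (dd vy (zetaC v)) z = 0 := fun z hz => by
    have := dd_eqOn hO e0 vy z hz
    rw [dd_sub ((dτ.const_mul hO _).diff hO hz) ((dζ.const_mul hO _).diff hO hz),
      dd_const_mul (dτ.diff hO hz), dd_const_mul (dζ.diff hO hz), τty z hz, ζyy z hz] at this
    rw [dd_comm_on hζ.smooth hO _ _ z hz, this]
    ring
  have τtt : ∀ z ∈ cylinder Ω, dd vt (dd vt (tauC v)) z = 0 := fun z hz => by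
    have := e1' vt z hz
    rw [ζty z hz, mul_zero] at this
    exact (mul_eq_zero.1 this.symm).resolve_left (sub_ne_zero.2 (Ne.symm h3))
  obtain ⟨c, hck⟩ := dτ.exists_const hO hc τtt τty
  -- The constant τ_t is written as that of k times `fieldD`, which will account for everything but
  -- translations.
  obtain ⟨k, rfl⟩ : ∃ k, c = (2 - θ.2) * k :=
    ⟨c / (2 - θ.2), by field_simp [sub_ne_zero.2 (Ne.symm h2)]⟩
  have ζy : ∀ z ∈ cylinder Ω, dd vy (zetaC v) z = (3 - θ.2) * k := fun z hz => by
    have := e1 z hz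
    rw [hck z hz] at this
    exact mul_left_cancel₀ (sub_ne_zero.2 (Ne.symm h2)) (by linarith)
  obtain ⟨a, ha⟩ := hτ.eq_add_const ((symmetry_tau hΩ.2 (fieldD_mem θ Ω)).const_mul hO k) hO hc
    (fun z hz => by
      rw [hck z hz, dd_const_mul ((symmetry_tau hΩ.2 (fieldD_mem θ Ω)).diff hO hz),
        show tauC (fieldD θ) = fun z => (2 - θ.2) * z.1.1 from rfl, dd_const_mul (by fun_prop),
        dd_coord_t]
      simp [vt]; ring)
    (fun z hz => by
      rw [τy z hz, dd_const_mul ((symmetry_tau hΩ.2 (fieldD_mem θ Ω)).diff hO hz),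
        show tauC (fieldD θ) = fun z => (2 - θ.2) * z.1.1 from rfl, dd_const_mul (by fun_prop),
        dd_coord_t]
      simp [vy])
  have dD : ∀ (e z : VarSpace), dd e (zetaC (fieldD θ)) z
      = (3 - θ.2) * e.1.2.2 - θ.1 * e.1.1 := by
    intro e z
    rw [show zetaC (fieldD θ) = fun z => (3 - θ.2) * z.1.2.2 - θ.1 * z.1.1 from rfl,
      dd_sub (by fun_prop) (by fun_prop), dd_const_mul (by fun_prop), dd_const_mul (by fun_prop),
      dd_coord_t, dd_coord_y]
  obtain ⟨b, hb⟩ := hζ.eq_add_const ((symmetry_zeta hΩ.2 (fieldD_mem θ Ω)).const_mul hO k) hO hc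
    (fun z hz => by
      rw [e0 z hz, ζy z hz, hck z hz,
        dd_const_mul ((symmetry_zeta hΩ.2 (fieldD_mem θ Ω)).diff hO hz), dD]
      simp [vt]; ring)
    (fun z hz => by
      rw [ζy z hz, dd_const_mul ((symmetry_zeta hΩ.2 (fieldD_mem θ Ω)).diff hO hz), dD]
      simp [vy]; ring)
  refine restrictTo_mem_of_eq (w := k • fieldD θ + (a • fieldPt + b • fieldPy)) hΩ hv ?_ le_rfl ?_
    (fun z hz => ?_) (fun z hz => ?_)
  · exact add_mem (Submodule.smul_mem _ _ (fieldD_mem θ Ω)) (add_mem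
      (Submodule.smul_mem _ _ (fieldPt_mem θ Ω)) (Submodule.smul_mem _ _ (fieldPy_mem θ Ω)))
  · simp only [map_add, map_smul]
    exact add_mem (Submodule.smul_mem _ _ (restrictTo_mem_spanOver (by simp))) (add_mem
      (Submodule.smul_mem _ _ (restrictTo_mem_spanOver (by simp)))
      (Submodule.smul_mem _ _ (restrictTo_mem_spanOver (by simp))))
  · rw [ha z hz]; simp [tauC, fieldPt, fieldPy]
  · rw [hb z hz]; simp [zetaC, fieldPt, fieldPy]

end Algebras

/-! ### Upper bounds for the maximal algebras with β = 2 and β = 0. -/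

section Extensions

variable {Ω : TopologicalSpace.Opens Base} {v : VarSpace → VarSpace}

attribute [local simp] dd_add dd_sub dd_mul dd_pow dd_neg dd_const dd_coord_t dd_coord_x dd_coord_y
  dd_coord_u vt vx vy vu

/-- The classifying equations only say that τ is constant and ζ = ζ(y). The bound ζ_yyy = 0 comes
from compatibility of the equations for χ = η_u; quadratic ζ are then realized by `fieldPy`,
`fieldD` and `fieldK2`. -/
lemma maximalAlgebra_two_le (hΩ : IsRegularDomain (0, 2) Ω) :
    maximalAlgebra (0, 2) Ω ≤ generalAlgebra (0, 2) Ω ⊔ spanOver Ω {fieldK2} := by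
  rintro _ ⟨v, hv, rfl⟩
  have hO := isOpen_cylinder Ω
  have hc := isPreconnected_cylinder hΩ.1
  have hτ := symmetry_tau hΩ.2 hv
  have hζ := symmetry_zeta hΩ.2 hv
  have hη := (symmetry_smooth hv).2.2.2
  have hcl := symmetry_classifying hΩ.2 hv
  have hdet := symmetry_determining hΩ.2 hv
  have hx0 : ∀ z ∈ cylinder Ω, z.1.2.1 ≠ 0 := fun z hz =>
    ne_of_regular (θ := (0, 2)) two_ne_zero (hΩ.2 _ hz)
  have τy : ∀ z ∈ cylinder Ω, dd vy (tauC v) z = 0 := fun z hz => by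
    have := (hcl z hz).1; simp only at this; linarith
  have τt : ∀ z ∈ cylinder Ω, dd vt (tauC v) z = 0 := fun z hz => by
    have := (hcl z hz).2.1; simp only at this; linarith
  have ζt : ∀ z ∈ cylinder Ω, dd vt (zetaC v) z = 0 := fun z hz => by
    have := (hcl z hz).2.2; simp only at this; linarith
  have dζ := hζ.dd hO vy
  have ddζ := dζ.dd hO vy
  have ζyt : ∀ z ∈ cylinder Ω, dd vt (dd vy (zetaC v)) z = 0 := fun z hz => by
    rw [dd_comm_on hζ.smooth hO _ _ z hz, dd_zero_on hO ζt _ z hz]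
  have ζyyt : ∀ z ∈ cylinder Ω, dd vt (dd vy (dd vy (zetaC v))) z = 0 := fun z hz => by
    rw [dd_comm_on dζ.smooth hO _ _ z hz, dd_zero_on hO ζyt _ z hz]
  have hξ : ∀ z ∈ cylinder Ω, xiC v z = z.1.2.1 * dd vy (zetaC v) z := fun z hz => by
    rw [(hdet z hz).xi_eq, τt z hz, τy z hz, ζt z hz]; ring
  have dξ : ∀ e : VarSpace, ∀ z ∈ cylinder Ω, dd e (xiC v) z
      = e.1.2.1 * dd vy (zetaC v) z + z.1.2.1 * dd e (dd vy (zetaC v)) z := fun e z hz => by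
    rw [dd_eqOn hO hξ e z hz, dd_mul (by fun_prop) (dζ.diff hO hz), dd_coord_x]
  have hξxx : ∀ z ∈ cylinder Ω, dd vx (dd vx (xiC v)) z = 0 := fun z hz => by
    have h : ∀ z ∈ cylinder Ω, dd vx (xiC v) z = dd vy (zetaC v) z := fun z hz => by
      rw [dξ vx z hz, dζ.dx z hz]; simp
    rw [dd_eqOn hO h vx z hz, dζ.dx z hz]
  have χx : ∀ z ∈ cylinder Ω, dd vx (dd vu (etaC v)) z
      = (-(1 / 2)) * dd vy (dd vy (zetaC v)) z := fun z hz => by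
    have h := (hdet z hz).eta_xu
    have hA : diffusivity (0, 2) z.1 = z.1.2.1 ^ 2 := by simp [diffusivity]
    rw [dξ vt z hz, dξ vy z hz, hξxx z hz, ζyt z hz, hA] at h
    simp only [vt, vy] at h ⊢
    have h' := pow_ne_zero 2 (hx0 z hz)
    apply mul_left_cancel₀ h'
    linear_combination (1 / 2) * h
  have χxe : ∀ e : VarSpace, ∀ z ∈ cylinder Ω, dd vx (dd e (dd vu (etaC v))) z
      = (-(1 / 2)) * dd e (dd vy (dd vy (zetaC v))) z := fun e z hz => by
    rw [dd_comm_on (hη.dd hO vu) hO _ _ z hz, dd_eqOn hO χx e z hz, dd_const_mul (ddζ.diff hO hz)]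
  have hsm : ∀ e : VarSpace, ∀ z ∈ cylinder Ω, DifferentiableAt ℝ (dd e (dd vu (etaC v))) z :=
    fun e z hz => (contDiffAt_of_mem_cylinder ((hη.dd hO vu).dd hO e) hz).diffAt
  have h1 : ∀ z ∈ cylinder Ω, dd vt (dd vu (etaC v)) z + z.1.2.1 * dd vy (dd vu (etaC v)) z
      = 0 := fun z hz => by
    rw [symmetry_eta_u hΩ.2 hv z hz, χxe vx z hz, ddζ.dx z hz]; ring
  have χy : ∀ z ∈ cylinder Ω, dd vy (dd vu (etaC v)) z
      = 1 / 2 * (z.1.2.1 * dd vy (dd vy (dd vy (zetaC v))) z) := fun z hz => by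
    have h := dd_zero_on hO h1 vx z hz
    have hx : DifferentiableAt ℝ (fun w : VarSpace => w.1.2.1) z := by fun_prop
    rw [dd_add (hsm vt z hz) (hx.fun_mul (hsm vy z hz)), dd_mul hx (hsm vy z hz), dd_coord_x,
      χxe vt z hz, χxe vy z hz, ζyyt z hz] at h
    simp only [vx] at h
    linarith
  -- The two expressions for χ_xy are ½ζ_yyy and −½ζ_yyy.
  have ζyyy : ∀ z ∈ cylinder Ω, dd vy (dd vy (dd vy (zetaC v))) z = 0 := fun z hz => by
    have T := ddζ.dd hO vy
    have h := χxe vy z hz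
    have hx : DifferentiableAt ℝ (fun w : VarSpace => w.1.2.1) z := by fun_prop
    rw [dd_eqOn hO χy vx z hz, dd_const_mul (hx.fun_mul (T.diff hO hz)), dd_mul hx (T.diff hO hz),
      dd_coord_x, T.dx z hz] at h
    simp only [vx] at h
    linarith
  obtain ⟨a, ha⟩ := hτ.exists_const hO hc τt τy
  obtain ⟨k, hk⟩ := ddζ.exists_const hO hc ζyyt ζyyy
  have T1 : TY (cylinder Ω) fun z => k * z.1.2.2 :=
    ⟨by fun_prop, fun z _ => by simp (disch := fun_prop), fun z _ => by simp (disch := fun_prop)⟩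
  obtain ⟨l, hl⟩ := dζ.eq_add_const T1 hO hc
    (fun z hz => by rw [ζyt z hz]; simp (disch := fun_prop))
    (fun z hz => by rw [hk z hz]; simp (disch := fun_prop))
  have T2 : TY (cylinder Ω) fun z => k / 2 * z.1.2.2 ^ 2 + l * z.1.2.2 :=
    ⟨by fun_prop, fun z _ => by simp (disch := fun_prop), fun z _ => by simp (disch := fun_prop)⟩
  obtain ⟨b, hb⟩ := hζ.eq_add_const T2 hO hc
    (fun z hz => by rw [ζt z hz]; simp (disch := fun_prop))
    (fun z hz => by rw [hl z hz]; simp (disch := fun_prop); ring)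
  refine restrictTo_mem_of_eq
    (w := (a • fieldPt + (b • fieldPy + l • fieldD (0, 2))) + (k / 2) • fieldK2) hΩ hv ?_
    le_sup_left ?_ (fun z hz => ?_) (fun z hz => ?_)
  · exact add_mem (add_mem (Submodule.smul_mem _ _ (fieldPt_mem _ Ω)) (add_mem
      (Submodule.smul_mem _ _ (fieldPy_mem _ Ω)) (Submodule.smul_mem _ _ (fieldD_mem _ Ω))))
      (Submodule.smul_mem _ _ (fieldK2_mem Ω))
  · rw [map_add]
    refine Submodule.add_mem_sup ?_ ?_
    · simp only [map_add, map_smul]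
      exact add_mem (Submodule.smul_mem _ _ (restrictTo_mem_spanOver (by simp))) (add_mem
        (Submodule.smul_mem _ _ (restrictTo_mem_spanOver (by simp)))
        (Submodule.smul_mem _ _ (restrictTo_mem_spanOver (by simp))))
    · rw [map_smul]
      exact Submodule.smul_mem _ _ (restrictTo_mem_spanOver (by simp))
  · rw [ha z hz]; simp [tauC, fieldPt, fieldPy, fieldD, fieldK2]
  · rw [hb z hz]; simp [zetaC, fieldPt, fieldPy, fieldD, fieldK2]; ring

/-- Here τ = τ(t) and ζ_y = (3/2)τ_t. Compatibility of the equations for χ = η_u yields τ_ttt = 0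
and ζ_tttt = 0. The resulting polynomials contain seven constants, matched by two translations,
`fieldD` and the four extra fields. -/
lemma maximalAlgebra_zero_le (hΩ : IsRegularDomain (0, 0) Ω) :
    maximalAlgebra (0, 0) Ω
      ≤ generalAlgebra (0, 0) Ω ⊔ spanOver Ω {fieldK0, fieldP3, fieldP2, fieldP1} := by
  rintro _ ⟨v, hv, rfl⟩
  have hO := isOpen_cylinder Ω
  have hc := isPreconnected_cylinder hΩ.1
  have hτ := symmetry_tau hΩ.2 hv
  have hζ := symmetry_zeta hΩ.2 hv
  have hη := (symmetry_smooth hv).2.2.2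
  have hcl := symmetry_classifying hΩ.2 hv
  have hdet := symmetry_determining hΩ.2 hv
  have τy : ∀ z ∈ cylinder Ω, dd vy (tauC v) z = 0 := fun z hz => by
    have := (hcl z hz).1; simp only at this; linarith
  have ζy : ∀ z ∈ cylinder Ω, dd vy (zetaC v) z = 3 / 2 * dd vt (tauC v) z := fun z hz => by
    have := (hcl z hz).2.1; simp only at this; linarith
  have τ1 := hτ.dd hO vt
  have τ2 := τ1.dd hO vt
  have τ3 := τ2.dd hO vt
  have ζ1 := hζ.dd hO vt
  have ζ2 := ζ1.dd hO vt
  have ζ3 := ζ2.dd hO vt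
  have τ1y : ∀ z ∈ cylinder Ω, dd vy (dd vt (tauC v)) z = 0 := fun z hz => by
    rw [dd_comm_on hτ.smooth hO _ _ z hz, dd_zero_on hO τy _ z hz]
  have τ2y : ∀ z ∈ cylinder Ω, dd vy (dd vt (dd vt (tauC v))) z = 0 := fun z hz => by
    rw [dd_comm_on τ1.smooth hO _ _ z hz, dd_zero_on hO τ1y _ z hz]
  have ζ1y : ∀ z ∈ cylinder Ω, dd vy (dd vt (zetaC v)) z = 3 / 2 * dd vt (dd vt (tauC v)) z :=
    fun z hz => by
      rw [dd_comm_on hζ.smooth hO _ _ z hz, dd_eqOn hO ζy _ z hz, dd_const_mul (τ1.diff hO hz)]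
  have ζ2y : ∀ z ∈ cylinder Ω, dd vy (dd vt (dd vt (zetaC v))) z
      = 3 / 2 * dd vt (dd vt (dd vt (tauC v))) z := fun z hz => by
    rw [dd_comm_on ζ1.smooth hO _ _ z hz, dd_eqOn hO ζ1y _ z hz, dd_const_mul (τ2.diff hO hz)]
  have hA : ∀ z : VarSpace, diffusivity (0, 0) z.1 = 1 := fun z => by simp [diffusivity]
  have hx : ∀ z : VarSpace, DifferentiableAt ℝ (fun w : VarSpace => w.1.2.1) z := fun z => by
    fun_prop
  have hξ : ∀ z ∈ cylinder Ω, xiC v z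
      = dd vt (zetaC v) z + z.1.2.1 * (1 / 2 * dd vt (tauC v) z) := fun z hz => by
    rw [(hdet z hz).xi_eq, ζy z hz, τy z hz]; ring
  have dξ : ∀ e : VarSpace, ∀ z ∈ cylinder Ω, dd e (xiC v) z = dd e (dd vt (zetaC v)) z
      + (e.1.2.1 * (1 / 2 * dd vt (tauC v) z) + z.1.2.1 * (1 / 2 * dd e (dd vt (tauC v)) z)) :=
    fun e z hz => by
      have h := (τ1.const_mul hO (1 / 2)).diff hO hz
      rw [dd_eqOn hO hξ e z hz, dd_add (ζ1.diff hO hz) ((hx z).fun_mul h), dd_mul (hx z) h,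
        dd_coord_x, dd_const_mul (τ1.diff hO hz)]
  have hξxx : ∀ z ∈ cylinder Ω, dd vx (dd vx (xiC v)) z = 0 := fun z hz => by
    have h : ∀ z ∈ cylinder Ω, dd vx (xiC v) z = 1 / 2 * dd vt (tauC v) z := fun z hz => by
      rw [dξ vx z hz, ζ1.dx z hz, τ1.dx z hz]; simp
    rw [dd_eqOn hO h vx z hz, dd_const_mul (τ1.diff hO hz), τ1.dx z hz, mul_zero]
  have χx : ∀ z ∈ cylinder Ω, dd vx (dd vu (etaC v)) z
      = (-(1 / 2)) * dd vt (dd vt (zetaC v)) z + z.1.2.1 * ((-1) * dd vt (dd vt (tauC v)) z) :=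
    fun z hz => by
      have h := (hdet z hz).eta_xu
      rw [dξ vt z hz, dξ vy z hz, hξxx z hz, hA, ζ1y z hz, τ1y z hz] at h
      simp only [vt, vy] at h ⊢
      linarith
  have χxe : ∀ e : VarSpace, ∀ z ∈ cylinder Ω, dd vx (dd e (dd vu (etaC v))) z
      = (-(1 / 2)) * dd e (dd vt (dd vt (zetaC v))) z
        + (e.1.2.1 * ((-1) * dd vt (dd vt (tauC v)) z)
          + z.1.2.1 * ((-1) * dd e (dd vt (dd vt (tauC v))) z)) := fun e z hz => by
    have h1 := (ζ2.const_mul hO (-(1 / 2))).diff hO hz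
    have h2 := (τ2.const_mul hO (-1)).diff hO hz
    rw [dd_comm_on (hη.dd hO vu) hO _ _ z hz, dd_eqOn hO χx e z hz,
      dd_add h1 ((hx z).fun_mul h2), dd_mul (hx z) h2, dd_const_mul (ζ2.diff hO hz),
      dd_const_mul (τ2.diff hO hz), dd_coord_x]
  have hsm : ∀ e : VarSpace, ∀ z ∈ cylinder Ω, DifferentiableAt ℝ (dd e (dd vu (etaC v))) z :=
    fun e z hz => (contDiffAt_of_mem_cylinder ((hη.dd hO vu).dd hO e) hz).diffAt
  have h1 : ∀ z ∈ cylinder Ω, dd vt (dd vu (etaC v)) z + z.1.2.1 * dd vy (dd vu (etaC v)) z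
      = (-1) * dd vt (dd vt (tauC v)) z := fun z hz => by
    rw [symmetry_eta_u hΩ.2 hv z hz, χxe vx z hz, ζ2.dx z hz, τ2.dx z hz, hA]
    simp
  have χy : ∀ z ∈ cylinder Ω, dd vy (dd vu (etaC v)) z
      = 1 / 2 * dd vt (dd vt (dd vt (zetaC v))) z
        + z.1.2.1 * (7 / 4 * dd vt (dd vt (dd vt (tauC v))) z) := fun z hz => by
    have h := dd_eqOn hO h1 vx z hz
    rw [dd_add (hsm vt z hz) ((hx z).fun_mul (hsm vy z hz)), dd_mul (hx z) (hsm vy z hz),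
      dd_coord_x, χxe vt z hz, χxe vy z hz, ζ2y z hz, τ2y z hz, dd_const_mul (τ2.diff hO hz),
      τ2.dx z hz] at h
    simp only [vx, vt, vy] at h ⊢
    linarith
  -- Computing χ_xy in two ways gives (7/4)τ_ttt = −(3/4)τ_ttt.
  have τ30 : ∀ z ∈ cylinder Ω, dd vt (dd vt (dd vt (tauC v))) z = 0 := fun z hz => by
    have h := χxe vy z hz
    have h2 := (ζ3.const_mul hO (1 / 2)).diff hO hz
    have h3 := (τ3.const_mul hO (7 / 4)).diff hO hz
    rw [dd_eqOn hO χy vx z hz, dd_add h2 ((hx z).fun_mul h3), dd_mul (hx z) h3,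
      dd_const_mul (ζ3.diff hO hz), dd_const_mul (τ3.diff hO hz), dd_coord_x, ζ3.dx z hz,
      τ3.dx z hz, ζ2y z hz, τ2y z hz] at h
    simp only [vx, vy] at h
    linarith
  have ζ3y : ∀ z ∈ cylinder Ω, dd vy (dd vt (dd vt (dd vt (zetaC v)))) z = 0 := fun z hz => by
    rw [dd_comm_on ζ2.smooth hO _ _ z hz, dd_eqOn hO ζ2y _ z hz, dd_const_mul (τ3.diff hO hz),
      dd_zero_on hO τ30 _ z hz, mul_zero]
  -- Now χ_y = ½ζ_ttt is independent of y, so the y-derivative of χ_t + xχ_y = −τ_tt reduces to χ_ty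
  -- = 0.
  have ζ40 : ∀ z ∈ cylinder Ω, dd vt (dd vt (dd vt (dd vt (zetaC v)))) z = 0 := fun z hz => by
    have e1 : ∀ z ∈ cylinder Ω, dd vy (dd vu (etaC v)) z
        = 1 / 2 * dd vt (dd vt (dd vt (zetaC v))) z := fun z hz => by
      rw [χy z hz, τ30 z hz]; ring
    have e2 := dd_eqOn hO e1 vt z hz
    have e4 := dd_eqOn hO h1 vy z hz
    have e5 : dd vy (dd vy (dd vu (etaC v))) z = 0 := by
      rw [dd_eqOn hO e1 vy z hz, dd_const_mul (ζ3.diff hO hz), ζ3y z hz, mul_zero]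
    rw [dd_add (hsm vt z hz) ((hx z).fun_mul (hsm vy z hz)), dd_mul (hx z) (hsm vy z hz),
      dd_coord_x, dd_const_mul (τ2.diff hO hz), τ2y z hz, e5,
      dd_comm_on (hη.dd hO vu) hO vy vt z hz, e2, dd_const_mul (ζ3.diff hO hz)] at e4
    simp only [vy] at e4
    linarith
  obtain ⟨k, hk⟩ := τ2.exists_const hO hc τ30 τ2y
  -- One polynomial family contains every antiderivative needed in the successive integrations.
  have Tlin : ∀ a b c d l : ℝ, TY (cylinder Ω)
      fun z => a * z.1.1 ^ 3 + b * z.1.1 ^ 2 + c * z.1.1 + d * z.1.1 * z.1.2.2 + l * z.1.2.2 :=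
    fun a b c d l => ⟨by fun_prop, fun z _ => by simp (disch := fun_prop),
      fun z _ => by simp (disch := fun_prop)⟩
  obtain ⟨l, hl⟩ := τ1.eq_add_const (Tlin 0 0 k 0 0) hO hc
    (fun z hz => by rw [hk z hz]; simp (disch := fun_prop))
    (fun z hz => by rw [τ1y z hz]; simp (disch := fun_prop))
  obtain ⟨a, ha⟩ := hτ.eq_add_const (Tlin 0 (k / 2) l 0 0) hO hc
    (fun z hz => by rw [hl z hz]; simp (disch := fun_prop); ring)
    (fun z hz => by rw [τy z hz]; simp (disch := fun_prop))
  obtain ⟨m3, h3⟩ := ζ3.exists_const hO hc ζ40 ζ3y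
  obtain ⟨m2, h2⟩ := ζ2.eq_add_const (Tlin 0 0 m3 0 0) hO hc
    (fun z hz => by rw [h3 z hz]; simp (disch := fun_prop))
    (fun z hz => by rw [ζ2y z hz, τ30 z hz]; simp (disch := fun_prop))
  obtain ⟨m1, h1⟩ := ζ1.eq_add_const (Tlin 0 (m3 / 2) m2 0 (3 / 2 * k)) hO hc
    (fun z hz => by rw [h2 z hz]; simp (disch := fun_prop); ring)
    (fun z hz => by rw [ζ1y z hz, hk z hz]; simp (disch := fun_prop))
  obtain ⟨b, hb⟩ := hζ.eq_add_const (Tlin (m3 / 6) (m2 / 2) m1 (3 / 2 * k) (3 / 2 * l)) hO hc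
    (fun z hz => by rw [h1 z hz]; simp (disch := fun_prop); ring)
    (fun z hz => by rw [ζy z hz, hl z hz]; simp (disch := fun_prop); ring)
  refine restrictTo_mem_of_eq
    (w := (a • fieldPt + (b • fieldPy + (l / 2) • fieldD (0, 0)))
      + ((k / 2) • fieldK0 + ((m3 / 6) • fieldP3 + ((m2 / 2) • fieldP2 + m1 • fieldP1)))) hΩ hv ?_
    le_sup_left ?_ (fun z hz => ?_) (fun z hz => ?_)
  · exact add_mem (add_mem (Submodule.smul_mem _ _ (fieldPt_mem _ Ω)) (add_mem
      (Submodule.smul_mem _ _ (fieldPy_mem _ Ω)) (Submodule.smul_mem _ _ (fieldD_mem _ Ω))))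
      (add_mem (Submodule.smul_mem _ _ (fieldK0_mem Ω)) (add_mem
        (Submodule.smul_mem _ _ (fieldP3_mem Ω)) (add_mem
          (Submodule.smul_mem _ _ (fieldP2_mem Ω)) (Submodule.smul_mem _ _ (fieldP1_mem Ω)))))
  · rw [map_add]
    refine Submodule.add_mem_sup ?_ ?_
    · simp only [map_add, map_smul]
      exact add_mem (Submodule.smul_mem _ _ (restrictTo_mem_spanOver (by simp))) (add_mem
        (Submodule.smul_mem _ _ (restrictTo_mem_spanOver (by simp)))
        (Submodule.smul_mem _ _ (restrictTo_mem_spanOver (by simp))))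
    · simp only [map_add, map_smul]
      exact add_mem (Submodule.smul_mem _ _ (restrictTo_mem_spanOver (by simp))) (add_mem
        (Submodule.smul_mem _ _ (restrictTo_mem_spanOver (by simp))) (add_mem
        (Submodule.smul_mem _ _ (restrictTo_mem_spanOver (by simp)))
        (Submodule.smul_mem _ _ (restrictTo_mem_spanOver (by simp)))))
  · rw [ha z hz]; simp [tauC, fieldPt, fieldPy, fieldD, fieldK0, fieldP1, fieldP2, fieldP3]; ring
  · rw [hb z hz]; simp [zetaC, fieldPt, fieldPy, fieldD, fieldK0, fieldP1, fieldP2, fieldP3]; ring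

end Extensions

/-! ### Strictness of the extensions and directness of the sums. -/

section Extensions

variable {θ : Param} {Ω : TopologicalSpace.Opens Base}

attribute [local simp] dd_add dd_sub dd_mul dd_pow dd_neg dd_const dd_coord_t dd_coord_x dd_coord_y
  dd_coord_u vt vx vy vu

/-- A cubic polynomial of one coordinate vanishes on a nonempty open set only if it is zero. -/
lemma cubic_eq_zero {O : Set VarSpace} (hO : IsOpen O) (hne : O.Nonempty) {e : VarSpace}
    {L : VarSpace → ℝ} (hd : Differentiable ℝ L) (hL : ∀ z, dd e L z = 1) {c₀ c₁ c₂ c₃ : ℝ}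
    (h : ∀ z ∈ O, c₀ + c₁ * L z + c₂ * L z ^ 2 + c₃ * L z ^ 3 = 0) :
    c₀ = 0 ∧ c₁ = 0 ∧ c₂ = 0 ∧ c₃ = 0 := by
  obtain ⟨z, hz⟩ := hne
  have h1 : ∀ z ∈ O, c₁ + 2 * c₂ * L z + 3 * c₃ * L z ^ 2 = 0 := fun z hz => by
    have := dd_zero_on hO h e z hz
    simp (disch := fun_prop) [hL] at this
    linarith
  have h2 : ∀ z ∈ O, 2 * c₂ + 6 * c₃ * L z = 0 := fun z hz => by
    have := dd_zero_on hO h1 e z hz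
    simp (disch := fun_prop) [hL] at this
    linarith
  have h3 : c₃ = 0 := by
    have := dd_zero_on hO h2 e z hz
    simp (disch := fun_prop) [hL] at this
    linarith
  have h4 := h2 z hz
  have h5 := h1 z hz
  have h6 := h z hz
  subst h3
  obtain rfl : c₂ = 0 := by linarith
  obtain rfl : c₁ = 0 := by linarith
  exact ⟨by linarith, rfl, rfl, rfl⟩

lemma cylinder_nonempty (hΩ : IsRegularDomain θ Ω) : (cylinder Ω).Nonempty := by
  obtain ⟨p, hp⟩ := hΩ.1.nonempty
  exact ⟨(p, 0), hp⟩

lemma cubic_t_eq_zero (hΩ : IsRegularDomain θ Ω) {c₀ c₁ c₂ c₃ : ℝ} (h : ∀ z ∈ cylinder Ω,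
    c₀ + c₁ * z.1.1 + c₂ * z.1.1 ^ 2 + c₃ * z.1.1 ^ 3 = 0) :
    c₀ = 0 ∧ c₁ = 0 ∧ c₂ = 0 ∧ c₃ = 0 :=
  cubic_eq_zero (isOpen_cylinder Ω) (cylinder_nonempty hΩ) (e := vt) (L := fun z => z.1.1)
    (by fun_prop) (fun z => dd_coord_t _ z) h

lemma cubic_x_eq_zero (hΩ : IsRegularDomain θ Ω) {c₀ c₁ c₂ c₃ : ℝ} (h : ∀ z ∈ cylinder Ω,
    c₀ + c₁ * z.1.2.1 + c₂ * z.1.2.1 ^ 2 + c₃ * z.1.2.1 ^ 3 = 0) :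
    c₀ = 0 ∧ c₁ = 0 ∧ c₂ = 0 ∧ c₃ = 0 :=
  cubic_eq_zero (isOpen_cylinder Ω) (cylinder_nonempty hΩ) (e := vx) (L := fun z => z.1.2.1)
    (by fun_prop) (fun z => dd_coord_x _ z) h

lemma cubic_y_eq_zero (hΩ : IsRegularDomain θ Ω) {c₀ c₁ c₂ c₃ : ℝ} (h : ∀ z ∈ cylinder Ω,
    c₀ + c₁ * z.1.2.2 + c₂ * z.1.2.2 ^ 2 + c₃ * z.1.2.2 ^ 3 = 0) :
    c₀ = 0 ∧ c₁ = 0 ∧ c₂ = 0 ∧ c₃ = 0 :=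
  cubic_eq_zero (isOpen_cylinder Ω) (cylinder_nonempty hΩ) (e := vy) (L := fun z => z.1.2.2)
    (by fun_prop) (fun z => dd_coord_y _ z) h

/-- The fields u∂_u and f∂_u have no component along the base, so base components of the general
algebra form a three-parameter family. Membership and disjointness can thus be tested by comparing
polynomials in one coordinate. -/
lemma generalAlgebra_components {V : cylinder Ω → VarSpace} (hV : V ∈ generalAlgebra θ Ω) :
    ∃ a b d : ℝ, ∀ z : cylinder Ω, (V z).1 = (a + d * ((2 - θ.2) * z.1.1.1), d * (z.1.1.2.1 - θ.1),
      b + d * ((3 - θ.2) * z.1.1.2.2 - θ.1 * z.1.1.1)) := by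
  obtain ⟨v, hv, rfl⟩ := hV
  suffices h : ∃ a b d : ℝ, ∀ z : VarSpace, (v z).1 = (a + d * ((2 - θ.2) * z.1.1),
      d * (z.1.2.1 - θ.1), b + d * ((3 - θ.2) * z.1.2.2 - θ.1 * z.1.1)) by
    obtain ⟨a, b, d, h⟩ := h
    exact ⟨a, b, d, fun z => h z.1⟩
  induction hv using Submodule.span_induction with
  | mem v hv =>
    rcases hv with h | ⟨f, -, rfl⟩
    · simp only [mem_insert_iff, mem_singleton_iff] at h
      rcases h with rfl | rfl | rfl | rfl
      · exact ⟨1, 0, 0, fun z => by simp [fieldPt]⟩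
      · exact ⟨0, 1, 0, fun z => by simp [fieldPy]⟩
      · exact ⟨0, 0, 0, fun z => by simp [fieldI]⟩
      · exact ⟨0, 0, 1, fun z => by simp [fieldD]⟩
    · exact ⟨0, 0, 0, fun z => by simp [fieldZ]⟩
  | zero => exact ⟨0, 0, 0, fun z => by simp; rfl⟩
  | add v w _ _ hv hw =>
    obtain ⟨a, b, d, h⟩ := hv
    obtain ⟨a', b', d', h'⟩ := hw
    refine ⟨a + a', b + b', d + d', fun z => ?_⟩
    rw [Pi.add_apply, Prod.fst_add, h, h']
    ext <;> simp <;> ring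
  | smul c v _ hv =>
    obtain ⟨a, b, d, h⟩ := hv
    refine ⟨c * a, c * b, c * d, fun z => ?_⟩
    rw [Pi.smul_apply, Prod.smul_fst, h]
    ext <;> simp <;> ring

lemma hasExtension_of_not_mem {v : VarSpace → VarSpace} (hv : v ∈ symmetryFields θ Ω)
    (h : restrictTo Ω v ∉ generalAlgebra θ Ω) : HasExtension θ Ω :=
  lt_of_le_not_ge (generalAlgebra_le θ Ω) fun hle => h (hle ⟨v, hv, rfl⟩)

lemma hasExtension_zero (hΩ : IsRegularDomain (0, 0) Ω) : HasExtension (0, 0) Ω := by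
  refine hasExtension_of_not_mem (fieldP1_mem Ω) fun h => ?_
  obtain ⟨a, b, d, h⟩ := generalAlgebra_components h
  have := cubic_x_eq_zero hΩ (c₀ := 1) (c₁ := -d) (c₂ := 0) (c₃ := 0) fun z hz => by
    have := congrArg (fun q : Base => q.2.1) (h ⟨z, hz⟩)
    simp [restrictTo, fieldP1] at this
    linarith
  exact one_ne_zero this.1

lemma hasExtension_two (hΩ : IsRegularDomain (0, 2) Ω) : HasExtension (0, 2) Ω := by
  refine hasExtension_of_not_mem (fieldK2_mem Ω) fun h => ?_
  obtain ⟨a, b, d, h⟩ := generalAlgebra_components h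
  have := cubic_y_eq_zero hΩ (c₀ := -b) (c₁ := -d) (c₂ := 1) (c₃ := 0) fun z hz => by
    have := congrArg (fun q : Base => q.2.2) (h ⟨z, hz⟩)
    simp [restrictTo, fieldK2] at this
    linarith
  exact one_ne_zero this.2.2.1

lemma hasExtension_three (hΩ : IsRegularDomain (0, 3) Ω) : HasExtension (0, 3) Ω := by
  refine hasExtension_of_not_mem (fieldK3_mem hΩ.2) fun h => ?_
  obtain ⟨a, b, d, h⟩ := generalAlgebra_components h
  have := cubic_t_eq_zero hΩ (c₀ := -a) (c₁ := d) (c₂ := 1) (c₃ := 0) fun z hz => by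
    have := congrArg (fun q : Base => q.1) (h ⟨z, hz⟩)
    simp [restrictTo, fieldK3] at this
    linarith
  exact one_ne_zero this.2.2.1

lemma hasExtension_five (hΩ : IsRegularDomain (0, 5) Ω) : HasExtension (0, 5) Ω := by
  refine hasExtension_of_not_mem (fieldK5_mem Ω) fun h => ?_
  obtain ⟨a, b, d, h⟩ := generalAlgebra_components h
  have := cubic_x_eq_zero hΩ (c₀ := 0) (c₁ := d) (c₂ := 1) (c₃ := 0) fun z hz => by
    have := congrArg (fun q : Base => q.2.1) (h ⟨z, hz⟩)
    simp [restrictTo, fieldK5] at this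
    linarith
  exact one_ne_zero this.2.2.1

lemma eq_of_hasExtension (hΩ : IsRegularDomain θ Ω) (h : HasExtension θ Ω) :
    θ.2 = 0 ∨ θ.2 = 2 ∨ θ.2 = 3 ∨ θ.2 = 5 := by
  by_contra! hne
  exact (lt_irrefl _) (h.trans_le (maximalAlgebra_le_general hΩ hne.1 hne.2.1 hne.2.2.1 hne.2.2.2))

lemma disjoint_two (hΩ : IsRegularDomain (0, 2) Ω) :
    Disjoint (generalAlgebra (0, 2) Ω) (spanOver Ω {fieldK2}) := by
  rw [Submodule.disjoint_def]
  intro V hV hV'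
  obtain ⟨v, hv, rfl⟩ := hV'
  obtain ⟨k, rfl⟩ := Submodule.mem_span_singleton.1 hv
  obtain ⟨a, b, d, h⟩ := generalAlgebra_components hV
  have := cubic_y_eq_zero hΩ (c₀ := -b) (c₁ := -d) (c₂ := k) (c₃ := 0) fun z hz => by
    have := congrArg (fun q : Base => q.2.2) (h ⟨z, hz⟩)
    simp [restrictTo, fieldK2] at this
    linarith
  rw [this.2.2.1, zero_smul, map_zero]

/-- The τ-component eliminates the scaling and `fieldK0`; afterwards the ξʸ-component is a cubic in
t whose coefficients are the remaining constants. -/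
lemma disjoint_zero (hΩ : IsRegularDomain (0, 0) Ω) :
    Disjoint (generalAlgebra (0, 0) Ω) (spanOver Ω {fieldK0, fieldP3, fieldP2, fieldP1}) := by
  rw [Submodule.disjoint_def]
  intro V hV hV'
  obtain ⟨v, hv, rfl⟩ := hV'
  obtain ⟨k, w₁, hw₁, rfl⟩ := Submodule.mem_span_insert.1 hv
  obtain ⟨p, w₂, hw₂, rfl⟩ := Submodule.mem_span_insert.1 hw₁
  obtain ⟨q, w₃, hw₃, rfl⟩ := Submodule.mem_span_insert.1 hw₂
  obtain ⟨r, rfl⟩ := Submodule.mem_span_singleton.1 hw₃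
  obtain ⟨a, b, d, h⟩ := generalAlgebra_components hV
  obtain ⟨-, h1, h2, -⟩ := cubic_t_eq_zero hΩ (c₀ := -a) (c₁ := -(2 * d)) (c₂ := k) (c₃ := 0)
    fun z hz => by
      have := congrArg (fun q : Base => q.1) (h ⟨z, hz⟩)
      simp [restrictTo, fieldK0, fieldP3, fieldP2, fieldP1] at this
      linarith
  obtain rfl : d = 0 := by linarith
  subst h2
  obtain ⟨-, rfl, rfl, rfl⟩ := cubic_t_eq_zero hΩ (c₀ := -b) (c₁ := r) (c₂ := q) (c₃ := p)
    fun z hz => by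
      have := congrArg (fun q : Base => q.2.2) (h ⟨z, hz⟩)
      simp [restrictTo, fieldP3, fieldP2, fieldP1] at this
      linarith
  simp

lemma maximalAlgebra_two (hΩ : IsRegularDomain (0, 2) Ω) :
    maximalAlgebra (0, 2) Ω = generalAlgebra (0, 2) Ω ⊔ spanOver Ω {fieldK2} := by
  refine le_antisymm (maximalAlgebra_two_le hΩ) (sup_le (generalAlgebra_le _ _) ?_)
  refine spanOver_le_iff.2 ?_
  rintro v rfl
  exact ⟨_, fieldK2_mem Ω, rfl⟩

lemma maximalAlgebra_zero (hΩ : IsRegularDomain (0, 0) Ω) :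
    maximalAlgebra (0, 0) Ω
      = generalAlgebra (0, 0) Ω ⊔ spanOver Ω {fieldK0, fieldP3, fieldP2, fieldP1} := by
  refine le_antisymm (maximalAlgebra_zero_le hΩ) (sup_le (generalAlgebra_le _ _) ?_)
  refine spanOver_le_iff.2 ?_
  rintro v (rfl | rfl | rfl | rfl)
  exacts [⟨_, fieldK0_mem Ω, rfl⟩, ⟨_, fieldP3_mem Ω, rfl⟩, ⟨_, fieldP2_mem Ω, rfl⟩,
    ⟨_, fieldP1_mem Ω, rfl⟩]

end Extensions

/-! ### The kernel Lie invariance algebras -/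

section Kernel

variable {θ : Param} {Ω : TopologicalSpace.Opens Base} {v w : VarSpace → VarSpace}

/-- An element of the kernel comes with a different extension off the cylinder for each equation;
this allows one representative to serve for all of them. -/
lemma symmetryFields_congr (hw : w ∈ symmetryFields θ Ω) (h : ∀ z ∈ cylinder Ω, v z = w z) :
    v ∈ symmetryFields θ Ω := by
  have hO := isOpen_cylinder Ω
  obtain ⟨h1, h2⟩ := mem_symmetryFields_iff.1 hw
  refine mem_symmetryFields_iff.2 ⟨h1.congr h, fun z hz hr => ?_⟩
  have a1 : ∀ z ∈ cylinder Ω, tauC v z = tauC w z := fun z hz => by simp only [tauC, h z hz]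
  have a2 : ∀ z ∈ cylinder Ω, xiC v z = xiC w z := fun z hz => by simp only [xiC, h z hz]
  have a3 : ∀ z ∈ cylinder Ω, zetaC v z = zetaC w z := fun z hz => by simp only [zetaC, h z hz]
  have a4 : ∀ z ∈ cylinder Ω, etaC v z = etaC w z := fun z hz => by simp only [etaC, h z hz]
  have b1 := fun e => dd_eqOn hO a1 e z hz
  have b2 := fun e => dd_eqOn hO a2 e
  have b3 := fun e => dd_eqOn hO a3 e z hz
  have b4 := fun e => dd_eqOn hO a4 e
  have c2 := fun e e' => dd_eqOn hO (b2 e) e' z hz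
  have c4 := fun e e' => dd_eqOn hO (b4 e) e' z hz
  obtain ⟨d1, d2, d3, d4, d5, d6, d7, d8, d9, d10⟩ := h2 z hz hr
  constructor <;> simp only [a2 z hz, b1, b2 _ z hz, b3, b4 _ z hz, c2, c4] <;> assumption

/-- A continuous function that vanishes unless `x` belongs to a finite set is zero. -/
lemma eq_zero_of_generic_x {O : Set VarSpace} (hO : IsOpen O) {f : VarSpace → ℝ}
    (hf : ContDiffOn ℝ ∞ f O) {B : Set ℝ} (hB : B.Finite)
    (h : ∀ z ∈ O, z.1.2.1 ∉ B → f z = 0) : ∀ z ∈ O, f z = 0 := by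
  intro z hz
  have hc : Tendsto (fun s : ℝ => z + s • vx) (𝓝[≠] 0) (𝓝 z) := by
    have : Continuous fun s : ℝ => z + s • vx := by fun_prop
    have h0 := this.tendsto 0
    simp only [zero_smul, add_zero] at h0
    exact h0.mono_left nhdsWithin_le_nhds
  have h1 : Tendsto (fun s : ℝ => f (z + s • vx)) (𝓝[≠] 0) (𝓝 (f z)) :=
    (hf.contDiffAt (hO.mem_nhds hz)).continuousAt.tendsto.comp hc
  have hB' : ∀ᶠ s : ℝ in 𝓝[≠] 0, z.1.2.1 + s ∉ B := by
    have hfin : ((fun s => z.1.2.1 + s) ⁻¹' B).Finite :=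
      hB.preimage (add_right_injective _).injOn
    have := (hfin.subset sdiff_subset : ((fun s => z.1.2.1 + s) ⁻¹' B \ {0}).Finite).isClosed
    have h2 := this.isOpen_compl.mem_nhds (x := (0 : ℝ)) (by simp)
    filter_upwards [nhdsWithin_le_nhds h2, self_mem_nhdsWithin] with s hs hs0 hsB
    exact hs ⟨hsB, hs0⟩
  have h2 : Tendsto (fun s : ℝ => f (z + s • vx)) (𝓝[≠] 0) (𝓝 0) := by
    refine tendsto_const_nhds.congr' ?_
    filter_upwards [hc.eventually (hO.mem_nhds hz), hB'] with s hs1 hs2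
    refine (h _ hs1 ?_).symm
    simpa [vx] using hs2
  exact tendsto_nhds_unique h1 h2

/-- Solutions that are common to all equations of the class. -/
lemma common_solution {O : Set VarSpace} (hO : IsOpen O) (hc : IsPreconnected O)
    {g : VarSpace → ℝ} (hg : ContDiffOn ℝ ∞ g O) (gu : ∀ z ∈ O, dd vu g z = 0)
    (gxx : ∀ z ∈ O, dd vx (dd vx g) z = 0)
    (g1 : ∀ z ∈ O, dd vt g z + z.1.2.1 * dd vy g z = 0) :
    ∃ k m n : ℝ, ∀ z ∈ O, g z = k * (z.1.1 * z.1.2.1 - z.1.2.2) + m * z.1.2.1 + n := by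
  have hd : ∀ {f : VarSpace → ℝ}, ContDiffOn ℝ ∞ f O → ∀ z ∈ O, DifferentiableAt ℝ f z :=
    fun hf z hz => (hf.contDiffAt (hO.mem_nhds hz)).diffAt
  have hx : ∀ z : VarSpace, DifferentiableAt ℝ (fun w : VarSpace => w.1.2.1) z := fun z => by
    fun_prop
  have sx := hg.dd hO vx
  have sy := hg.dd hO vy
  have st := hg.dd hO vt
  have e1 : ∀ e, ∀ z ∈ O, dd e (dd vt g) z
      + (e.1.2.1 * dd vy g z + z.1.2.1 * dd e (dd vy g) z) = 0 := fun e z hz => by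
    have := dd_zero_on hO g1 e z hz
    rwa [dd_add (hd st z hz) ((hx z).fun_mul (hd sy z hz)), dd_mul (hx z) (hd sy z hz),
      dd_coord_x] at this
  have gxxe : ∀ e, ∀ z ∈ O, dd vx (dd vx (dd e g)) z = 0 := fun e z hz => by
    rw [dd_eqOn hO (dd_comm_on hg hO vx e) vx z hz, dd_comm_on sx hO vx e z hz,
      dd_zero_on hO gxx e z hz]
  -- Two x-derivatives of g_t + xg_y = 0 give g_txx + 2g_xy + xg_xxy = 0, and the outer terms vanish
  -- with g_xx.
  have gxy : ∀ z ∈ O, dd vx (dd vy g) z = 0 := fun z hz => by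
    have e2 : ∀ z ∈ O, dd vx (dd vt g) z + (dd vy g z + z.1.2.1 * dd vx (dd vy g) z) = 0 :=
      fun z hz => by
        have := e1 vx z hz
        simpa [vx] using this
    have := dd_zero_on hO e2 vx z hz
    have d1 := hd (sy.dd hO vx) z hz
    rw [dd_add (hd (st.dd hO vx) z hz) ((hd sy z hz).fun_add ((hx z).fun_mul d1)),
      dd_add (hd sy z hz) ((hx z).fun_mul d1), dd_mul (hx z) d1, dd_coord_x, gxxe vt z hz,
      gxxe vy z hz] at this
    simp only [vx] at this ⊢
    linarith
  have gtx : ∀ z ∈ O, dd vx (dd vt g) z = (-1) * dd vy g z := fun z hz => by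
    have := e1 vx z hz
    rw [gxy z hz] at this
    simp only [vx] at this ⊢
    linarith
  -- The y-derivative of g_tx = −g_y has left side (g_xy)_t = 0.
  have gyy : ∀ z ∈ O, dd vy (dd vy g) z = 0 := fun z hz => by
    have h1 := dd_eqOn hO gtx vy z hz
    have h2 : dd vy (dd vx (dd vt g)) z = 0 := by
      rw [dd_eqOn hO (dd_comm_on hg hO vx vt) vy z hz, dd_comm_on sx hO vy vt z hz]
      refine dd_zero_on hO (fun z hz => ?_) vt z hz
      rw [dd_comm_on hg hO _ _ z hz, gxy z hz]
    rw [h2, dd_const_mul (hd sy z hz)] at h1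
    linarith
  have hgy : TY O (dd vy g) := ⟨sy, gxy, fun z hz => by
    rw [dd_comm_on hg hO _ _ z hz, dd_zero_on hO gu _ z hz]⟩
  obtain ⟨k, hk⟩ := hgy.exists_const hO hc (fun z hz => by
    have := e1 vy z hz
    rw [gyy z hz] at this
    rw [dd_comm_on hg hO _ _ z hz]
    simpa [vy] using this) gyy
  have gt : ∀ z ∈ O, dd vt g z = (-k) * z.1.2.1 := fun z hz => by
    have := g1 z hz
    rw [hk z hz] at this
    linarith
  obtain ⟨m, hm⟩ := eq_add_const hO hc sx (g := fun z => (-k) * z.1.1) (by fun_prop)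
    (fun z hz => by
      rw [dd_comm_on hg hO _ _ z hz, gtx z hz, hk z hz, dd_const_mul (by fun_prop), dd_coord_t]
      simp [vt])
    (fun z hz => by rw [gxx z hz, dd_const_mul (by fun_prop), dd_coord_t]; simp [vx])
    (fun z hz => by
      rw [dd_comm_on hg hO _ _ z hz, gxy z hz, dd_const_mul (by fun_prop), dd_coord_t]
      simp [vy])
    (fun z hz => by
      rw [dd_comm_on hg hO _ _ z hz, dd_zero_on hO gu _ z hz, dd_const_mul (by fun_prop),
        dd_coord_t]
      simp [vu])
  have dP : ∀ e z : VarSpace, dd e (fun z : VarSpace =>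
      (-k) * (z.1.1 * z.1.2.1 - z.1.2.2) + m * z.1.2.1) z
      = (-k) * (e.1.1 * z.1.2.1 + z.1.1 * e.1.2.1 - e.1.2.2) + m * e.1.2.1 := by
    intro e z
    rw [dd_add (by fun_prop) (by fun_prop), dd_const_mul (by fun_prop), dd_const_mul (by fun_prop),
      dd_sub (by fun_prop) (by fun_prop), dd_mul (by fun_prop) (by fun_prop), dd_coord_t,
      dd_coord_x, dd_coord_y]
  obtain ⟨n, hn⟩ := eq_add_const hO hc hg
    (g := fun z => (-k) * (z.1.1 * z.1.2.1 - z.1.2.2) + m * z.1.2.1) (by fun_prop)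
    (fun z hz => by rw [gt z hz, dP]; simp [vt])
    (fun z hz => by rw [hm z hz, dP]; simp [vx])
    (fun z hz => by rw [hk z hz, dP]; simp [vy])
    (fun z hz => by rw [gu z hz, dP]; simp [vu])
  exact ⟨-k, m, n, hn⟩

/-- The equations with β = 0 and β = 1 already determine the kernel: their diffusivities are
different enough to force ξˣ = 0 and η_xx = 0. The set Ω may meet x = 0, where β = 1 gives no
condition, so vanishing there is obtained by continuity. -/
lemma kernelAlgebraF'_le (hΩ : IsConnected (Ω : Set Base)) :
    kernelAlgebraF' Ω ≤ spanOver Ω {fieldPt, fieldPy, fieldI,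
      fieldZ (fun p => p.1 * p.2.1 - p.2.2), fieldZ (fun p => p.2.1), fieldZ (fun _ => 1)} := by
  intro V hV
  have hV' := fun β : ℝ => (Submodule.mem_iInf _).1 hV β
  obtain ⟨v, hv, rfl⟩ := hV' 0
  have hv1 : v ∈ symmetryFields (0, 1) Ω := by
    obtain ⟨w, hw, h⟩ := hV' 1
    exact symmetryFields_congr hw fun z hz => (congrFun h ⟨z, hz⟩).symm
  have hr : IsRegularDomain (0, 0) Ω := ⟨hΩ, fun p _ => by simp [Regular, diffusivity]⟩
  have hO := isOpen_cylinder Ω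
  have hc := isPreconnected_cylinder hΩ
  have hdet := symmetry_determining hr.2 hv
  have hdet1 := (mem_symmetryFields_iff.1 hv1).2
  have hτ := symmetry_tau hr.2 hv
  have hζ := symmetry_zeta hr.2 hv
  obtain ⟨-, sξ, -, sη⟩ := symmetry_smooth hv
  have hreg : ∀ z : VarSpace, z.1.2.1 ≠ 0 → Regular (0, 1) z.1 := fun z h =>
    regular_of_ne (θ := (0, 1)) h
  have hA : ∀ z : VarSpace, diffusivity (0, 0) z.1 = 1 := fun z => by simp [diffusivity]
  have hA1 : ∀ z : VarSpace, diffusivity (0, 1) z.1 = |z.1.2.1| := fun z => by simp [diffusivity]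
  have hxi : ∀ z ∈ cylinder Ω, 2 * dd vx (xiC v) z - dd vt (tauC v) z
      - z.1.2.1 * dd vy (tauC v) z = 0 := fun z hz => by
    have := (hdet z hz).xi_x
    rw [hA, px_diffusivity_of_eq_zero rfl] at this
    linarith
  -- The bracket in the equation for ξ_x vanishes by β = 0, and β = 1 then leaves ξˣA' = 0 with A' ≠
  -- 0 off x = 0.
  have ξ0 : ∀ z ∈ cylinder Ω, xiC v z = 0 := by
    refine eq_zero_of_generic_x hO sξ (finite_singleton 0) fun z hz hx => ?_
    have h1 := (hdet1 z hz (hreg z hx)).xi_x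
    have h2 := px_diffusivity (0, 1) (hreg z hx)
    rw [hxi z hz, mul_zero] at h1
    refine (mul_eq_zero.1 h1.symm).resolve_right fun h3 => ?_
    rw [h3, hA1] at h2
    simp at h2
    exact hx (abs_eq_zero.1 h2.symm)
  obtain ⟨τt, τy, -⟩ := polynomial_eq_zero hO (hτ.dd hO vt) (hτ.dd hO vy) (TY.const 0) 0 (by
    intro z hz
    have := hxi z hz
    rw [dd_zero_on hO ξ0 vx z hz] at this
    linarith)
  obtain ⟨ζt, ζy, -⟩ := polynomial_eq_zero hO (hζ.dd hO vt) (hζ.dd hO vy) (TY.const 0) 0 (by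
    intro z hz
    have := (hdet z hz).xi_eq
    rw [ξ0 z hz, τt z hz, τy z hz] at this
    linarith)
  obtain ⟨a, ha⟩ := hτ.exists_const hO hc τt τy
  obtain ⟨b, hb⟩ := hζ.exists_const hO hc ζt ζy
  -- Subtracting the translations makes τ and ξʸ zero and does not affect η.
  obtain ⟨c, hcu⟩ := exists_eta_u_eq hr (v := v - (a • fieldPt + b • fieldPy))
    (sub_mem hv (add_mem (Submodule.smul_mem _ _ (fieldPt_mem _ Ω))
      (Submodule.smul_mem _ _ (fieldPy_mem _ Ω))))
    (fun z hz => by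
      have := ha z hz
      simp only [tauC] at this
      simp [tauC, fieldPt, fieldPy, this])
    (fun z hz => by
      have := hb z hz
      simp only [zetaC] at this
      simp [zetaC, fieldPt, fieldPy, this])
  have eη : etaC (v - (a • fieldPt + b • fieldPy)) = etaC v := by
    funext z; simp [etaC, fieldPt, fieldPy]
  rw [eη] at hcu
  -- The last determining equations for β = 0 and β = 1 differ by (|x| − 1)η_xx = 0, so x = 1 and x
  -- = −1 are exceptional besides x = 0.
  have ηxx : ∀ z ∈ cylinder Ω, dd vx (dd vx (etaC v)) z = 0 := by
    refine eq_zero_of_generic_x hO ((sη.dd hO vx).dd hO vx)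
      (show ({0, 1, -1} : Set ℝ).Finite from by simp) fun z hz hx => ?_
    simp only [mem_insert_iff, mem_singleton_iff, not_or] at hx
    have h1 := (hdet z hz).eta_eq
    have h2 := (hdet1 z hz (hreg z hx.1)).eta_eq
    rw [h1, hA, hA1] at h2
    have h3 : (|z.1.2.1| - 1) * dd vx (dd vx (etaC v)) z = 0 := by linarith
    refine (mul_eq_zero.1 h3).resolve_left fun h4 => ?_
    rcases (abs_eq zero_le_one).1 (sub_eq_zero.1 h4) with h | h
    exacts [hx.2.1 h, hx.2.2 h]
  have dg : ∀ e, ∀ z ∈ cylinder Ω, dd e (fun z => etaC v z - c * z.2) z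
      = dd e (etaC v) z - c * e.2 := fun e z hz => by
    rw [dd_sub (contDiffAt_of_mem_cylinder sη hz).diffAt (by fun_prop),
      dd_const_mul (by fun_prop), dd_coord_u]
  obtain ⟨k, m, n, h⟩ := common_solution hO hc (g := fun z => etaC v z - c * z.2)
    (sη.sub (by fun_prop))
    (fun z hz => by rw [dg _ z hz, hcu z hz]; simp [vu])
    (fun z hz => by
      rw [dd_eqOn hO (g := dd vx (etaC v)) (fun z hz => by rw [dg _ z hz]; simp [vx]) vx z hz,
        ηxx z hz])
    (fun z hz => by
      rw [dg _ z hz, dg _ z hz]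
      have := (hdet z hz).eta_eq
      rw [ηxx z hz] at this
      simp only [vt, vy] at this ⊢
      linarith)
  have e : restrictTo Ω v = restrictTo Ω (a • fieldPt + (b • fieldPy + (c • fieldI
      + (k • fieldZ (fun p => p.1 * p.2.1 - p.2.2) + (m • fieldZ (fun p => p.2.1)
        + n • fieldZ (fun _ => 1)))))) := by
    refine restrictTo_congr fun z hz => field_ext ?_ ?_ ?_ ?_
    · rw [ha z hz]; simp [tauC, fieldPt, fieldPy, fieldI, fieldZ]
    · rw [ξ0 z hz]; simp [xiC, fieldPt, fieldPy, fieldI, fieldZ]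
    · rw [hb z hz]; simp [zetaC, fieldPt, fieldPy, fieldI, fieldZ]
    · have := h z hz
      rw [eq_add_of_sub_eq this]
      simp [etaC, fieldPt, fieldPy, fieldI, fieldZ]
      ring
  rw [e]
  simp only [map_add, map_smul]
  refine add_mem ?_ (add_mem ?_ (add_mem ?_ (add_mem ?_ (add_mem ?_ ?_))))
  all_goals exact Submodule.smul_mem _ _ (restrictTo_mem_spanOver (by simp))

lemma kernelAlgebraF_le (Ω : TopologicalSpace.Opens Base) : kernelAlgebraF Ω ≤ kernelAlgebraF' Ω :=
  le_iInf fun β => iInf_le _ (0, β)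

/-- The three functions are affine in x and satisfy f_t + xf_y = 0, so they solve the equation
whatever the diffusivity is. -/
lemma le_kernelAlgebraF (Ω : TopologicalSpace.Opens Base) :
    spanOver Ω {fieldPt, fieldPy, fieldI, fieldZ (fun p => p.1 * p.2.1 - p.2.2),
      fieldZ (fun p => p.2.1), fieldZ (fun _ => 1)} ≤ kernelAlgebraF Ω := by
  refine le_iInf fun θ => spanOver_le_iff.2 ?_
  have hf : ∀ k m n : ℝ, ∀ q e : Base, fderiv ℝ
      (fun q : Base => k * (q.1 * q.2.1 - q.2.2) + m * q.2.1 + n) q e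
      = k * (e.1 * q.2.1 + q.1 * e.2.1 - e.2.2) + m * e.2.1 := by
    intro k m n q e
    have h1 : HasFDerivAt (fun q : Base => q.1) (ContinuousLinearMap.fst ℝ ℝ (ℝ × ℝ)) q :=
      hasFDerivAt_fst
    have h2 : HasFDerivAt (fun q : Base => q.2.1)
        ((ContinuousLinearMap.fst ℝ ℝ ℝ).comp (ContinuousLinearMap.snd ℝ ℝ (ℝ × ℝ))) q :=
      hasFDerivAt_fst.comp q hasFDerivAt_snd
    have h3 : HasFDerivAt (fun q : Base => q.2.2)
        ((ContinuousLinearMap.snd ℝ ℝ ℝ).comp (ContinuousLinearMap.snd ℝ ℝ (ℝ × ℝ))) q :=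
      hasFDerivAt_snd.comp q hasFDerivAt_snd
    have h : HasFDerivAt (fun q : Base => k * (q.1 * q.2.1 - q.2.2) + m * q.2.1 + n) _ q :=
      ((((h1.mul h2).sub h3).const_mul k).add (h2.const_mul m)).add_const n
    rw [h.fderiv]
    simp [-mul_eq_mul_left_iff]
    ring
  have hsol : ∀ k m n : ℝ,
      fieldZ (fun q : Base => k * (q.1 * q.2.1 - q.2.2) + m * q.2.1 + n) ∈ symmetryFields θ Ω := by
    intro k m n
    refine fieldZ_mem (by fun_prop) fun p _ _ => ?_
    have h1 : px (fun q : Base => k * (q.1 * q.2.1 - q.2.2) + m * q.2.1 + n)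
        = fun q => (0 : ℝ) * (q.1 * q.2.1 - q.2.2) + 0 * q.2.1 + (k * q.1 + m) := by
      funext q; rw [px, hf]; simp
    have h2 : px (px (fun q : Base => k * (q.1 * q.2.1 - q.2.2) + m * q.2.1 + n)) p = 0 := by
      rw [h1]
      have h3 : HasFDerivAt (fun q : Base => (0 : ℝ) * (q.1 * q.2.1 - q.2.2) + 0 * q.2.1
          + (k * q.1 + m)) (k • ContinuousLinearMap.fst ℝ ℝ (ℝ × ℝ)) p := by
        simp only [zero_mul, zero_add]
        exact (hasFDerivAt_fst.const_mul k).add_const m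
      rw [px, h3.fderiv]
      simp
    rw [eqResidual, h2, pt, py, hf, hf]
    simp
    ring
  rintro v (rfl | rfl | rfl | rfl | rfl | rfl)
  · exact ⟨_, fieldPt_mem θ Ω, rfl⟩
  · exact ⟨_, fieldPy_mem θ Ω, rfl⟩
  · exact ⟨_, fieldI_mem θ Ω, rfl⟩
  · refine ⟨_, ?_, rfl⟩
    have h := hsol 1 0 0
    simp only [one_mul, zero_mul, add_zero] at h
    exact h
  · refine ⟨_, ?_, rfl⟩
    have h := hsol 0 1 0
    simp only [one_mul, zero_mul, add_zero, zero_add] at h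
    exact h
  · refine ⟨_, ?_, rfl⟩
    have h := hsol 0 0 1
    simp only [zero_mul, zero_add] at h
    exact h

end Kernel

/-! ### Some point transformations -/

lemma hasFDerivAt_base_t (q : Base) :
    HasFDerivAt (fun q : Base => q.1) (ContinuousLinearMap.fst ℝ ℝ (ℝ × ℝ)) q := hasFDerivAt_fst

lemma hasFDerivAt_base_x (q : Base) : HasFDerivAt (fun q : Base => q.2.1)
    ((ContinuousLinearMap.fst ℝ ℝ ℝ).comp (ContinuousLinearMap.snd ℝ ℝ (ℝ × ℝ))) q :=
  hasFDerivAt_fst.comp q hasFDerivAt_snd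

lemma hasFDerivAt_base_y (q : Base) : HasFDerivAt (fun q : Base => q.2.2)
    ((ContinuousLinearMap.snd ℝ ℝ ℝ).comp (ContinuousLinearMap.snd ℝ ℝ (ℝ × ℝ))) q :=
  hasFDerivAt_snd.comp q hasFDerivAt_snd

/-- The shift of `x` by `a`, as a transformation of all variables. -/
noncomputable def shiftHomeomorph (a : ℝ) : VarSpace ≃ₜ VarSpace where
  toFun z := ((z.1.1, z.1.2.1 - a, z.1.2.2 - a * z.1.1), z.2)
  invFun z := ((z.1.1, z.1.2.1 + a, z.1.2.2 + a * z.1.1), z.2)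
  left_inv z := by simp
  right_inv z := by simp
  continuous_toFun := by fun_prop
  continuous_invFun := by fun_prop

section Shift

variable {w : Base → ℝ}

lemma dd_comp_shift (hw : ContDiff ℝ ∞ w) (a : ℝ) (e p : Base) :
    dd e (fun q : Base => w (q.1, q.2.1 - a, q.2.2 - a * q.1)) p
      = e.1 * pt w (p.1, p.2.1 - a, p.2.2 - a * p.1) + e.2.1 * px w (p.1, p.2.1 - a, p.2.2 - a * p.1)
        + (e.2.2 - a * e.1) * py w (p.1, p.2.1 - a, p.2.2 - a * p.1) := by
  have h1 : HasFDerivAt (fun q : Base => (q.1, q.2.1 - a, q.2.2 - a * q.1)) _ p :=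
    (hasFDerivAt_base_t p).prodMk (((hasFDerivAt_base_x p).sub_const a).prodMk
      ((hasFDerivAt_base_y p).sub ((hasFDerivAt_base_t p).const_mul a)))
  have h2 := ((hw.contDiffAt (x := (p.1, p.2.1 - a, p.2.2 - a * p.1))).diffAt.hasFDerivAt).comp p h1
  have h3 : HasFDerivAt (fun q : Base => w (q.1, q.2.1 - a, q.2.2 - a * q.1)) _ p := h2
  rw [dd, h3.fderiv, ContinuousLinearMap.comp_apply, base_apply]
  simp [pt, px, py]

/-- The term −at in the new y produces −a·w_y in u_t, which turns the transport coefficient x into x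
− a. -/
lemma eqResidual_shift (hw : ContDiff ℝ ∞ w) {u : Base → ℝ} {p : Base} (a : ℝ) (θ : Param)
    (h : u =ᶠ[𝓝 p] fun q => w (q.1, q.2.1 - a, q.2.2 - a * q.1)) :
    eqResidual θ u p = eqResidual (θ.1 - a, θ.2) w (p.1, p.2.1 - a, p.2.2 - a * p.1) := by
  have e1 : px u =ᶠ[𝓝 p] fun q => px w (q.1, q.2.1 - a, q.2.2 - a * q.1) := by
    filter_upwards [dd_congr_eventually h (0, 1, 0)] with q hq
    have : px u q = _ := hq.trans (dd_comp_shift hw a _ q)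
    rw [this]
    simp
  have e2 : px (px u) p = px (px w) (p.1, p.2.1 - a, p.2.2 - a * p.1) := by
    have : px (px u) p = _ :=
      (dd_congr e1 (0, 1, 0)).trans (dd_comp_shift (w := px w) (hw.dd (0, 1, 0)) a _ p)
    rw [this]
    simp
  have e3 := (dd_congr h (1, 0, 0)).trans (dd_comp_shift hw a _ p)
  have e4 := (dd_congr h (0, 0, 1)).trans (dd_comp_shift hw a _ p)
  have e3' : pt u p = _ := e3
  have e4' : py u p = _ := e4
  have e5 : diffusivity θ p
      = diffusivity (θ.1 - a, θ.2) (p.1, p.2.1 - a, p.2.2 - a * p.1) := by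
    simp [diffusivity]
  rw [eqResidual, eqResidual, e2, e3', e4', e5]
  simp
  ring

end Shift

lemma mapsEquation_shift (a : ℝ) (θ : Param) :
    MapsEquation (shiftHomeomorph a).toOpenPartialHomeomorph θ (θ.1 - a, θ.2) := by
  intro u w hu hw p _ _ _ h
  have h' : u =ᶠ[𝓝 p] fun q => w (q.1, q.2.1 - a, q.2.2 - a * q.1) := by
    filter_upwards [h] with q hq using hq.symm
  rw [eqResidual_shift hw a θ h']
  rfl

lemma isPointTransformation_shift (a : ℝ) :
    IsPointTransformation (shiftHomeomorph a).toOpenPartialHomeomorph := by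
  refine ⟨⟨0, trivial⟩, ?_, ?_⟩
  · have : ContDiff ℝ ∞ fun z : VarSpace =>
        (((z.1.1, z.1.2.1 - a, z.1.2.2 - a * z.1.1), z.2) : VarSpace) := by fun_prop
    exact this.contDiffOn
  · have : ContDiff ℝ ∞ fun z : VarSpace =>
        (((z.1.1, z.1.2.1 + a, z.1.2.2 + a * z.1.1), z.2) : VarSpace) := by fun_prop
    exact this.contDiffOn

lemma groupoidEquivalent_shift (θ : Param) : GroupoidEquivalent θ (0, θ.2) := by
  refine ⟨_, isPointTransformation_shift θ.1, ?_⟩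
  have := mapsEquation_shift θ.1 θ
  rwa [sub_self] at this

/-- The shift by a fixed amount acts on every equation by (α, β) ↦ (α − a, β), so it belongs to the
equivalence group. -/
lemma groupEquivalent_shift (θ : Param) : GroupEquivalent θ (0, θ.2) := by
  let Ψ : Param ≃ Param :=
    { toFun := fun η => (η.1 - θ.1, η.2)
      invFun := fun η => (η.1 + θ.1, η.2)
      left_inv := fun η => by simp
      right_inv := fun η => by simp }
  refine ⟨_, Ψ, ⟨isPointTransformation_shift θ.1, ?_, ?_, mapsEquation_shift θ.1⟩, ?_⟩
  · have : ContDiff ℝ ∞ fun η : Param => ((η.1 - θ.1, η.2) : Param) := by fun_prop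
    exact this
  · have : ContDiff ℝ ∞ fun η : Param => ((η.1 + θ.1, η.2) : Param) := by fun_prop
    exact this
  · simp [Ψ]

/-- The transformation that maps the equations with parameters `(α, β)` and `(0, 5 - β)` to each
other, on the half-space `x > α`. -/
noncomputable def inversion (α : ℝ) : OpenPartialHomeomorph VarSpace VarSpace where
  toFun z := ((z.1.2.2 - α * z.1.1, (z.1.2.1 - α)⁻¹, z.1.1), z.2 * (z.1.2.1 - α)⁻¹)
  invFun z := ((z.1.2.2, z.1.2.1⁻¹ + α, z.1.1 + α * z.1.2.2), z.2 * z.1.2.1⁻¹)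
  source := {z | α < z.1.2.1}
  target := {z | 0 < z.1.2.1}
  map_source' z hz := by
    have : α < z.1.2.1 := hz
    change 0 < (z.1.2.1 - α)⁻¹
    exact inv_pos.2 (sub_pos.2 this)
  map_target' z hz := by
    have : 0 < z.1.2.1⁻¹ := inv_pos.2 hz
    change α < z.1.2.1⁻¹ + α
    linarith
  left_inv' z hz := by
    have : z.1.2.1 - α ≠ 0 := (sub_pos.2 hz).ne'
    ext <;> simp [this]
  right_inv' z hz := by
    have : z.1.2.1 ≠ 0 := ne_of_gt hz
    ext <;> simp [this]
  open_source := isOpen_lt continuous_const (by fun_prop)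
  open_target := isOpen_lt continuous_const (by fun_prop)
  continuousOn_toFun := by
    have h : ContinuousOn (fun z : VarSpace => (z.1.2.1 - α)⁻¹) {z | α < z.1.2.1} :=
      ContinuousOn.inv₀ (by fun_prop) fun z hz => (sub_pos.2 hz).ne'
    fun_prop
  continuousOn_invFun := by
    have h : ContinuousOn (fun z : VarSpace => z.1.2.1⁻¹) {z | 0 < z.1.2.1} :=
      ContinuousOn.inv₀ (by fun_prop) fun z hz => ne_of_gt hz
    fun_prop

lemma isPointTransformation_inversion (α : ℝ) : IsPointTransformation (inversion α) := by
  refine ⟨⟨((0, α + 1, 0), 0), ?_⟩, ?_, ?_⟩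
  · change α < α + 1
    linarith
  · have h : ContDiffOn ℝ ∞ (fun z : VarSpace => (z.1.2.1 - α)⁻¹) {z | α < z.1.2.1} :=
      ContDiffOn.inv (by fun_prop) fun z hz => (sub_pos.2 hz).ne'
    change ContDiffOn ℝ ∞ (fun z : VarSpace =>
      (((z.1.2.2 - α * z.1.1, (z.1.2.1 - α)⁻¹, z.1.1), z.2 * (z.1.2.1 - α)⁻¹) : VarSpace)) _
    change ContDiffOn ℝ ∞ _ {z : VarSpace | α < z.1.2.1}
    fun_prop
  · have h : ContDiffOn ℝ ∞ (fun z : VarSpace => z.1.2.1⁻¹) {z | 0 < z.1.2.1} :=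
      ContDiffOn.inv (by fun_prop) fun z hz => ne_of_gt hz
    change ContDiffOn ℝ ∞ (fun z : VarSpace =>
      (((z.1.2.2, z.1.2.1⁻¹ + α, z.1.1 + α * z.1.2.2), z.2 * z.1.2.1⁻¹) : VarSpace)) _
    change ContDiffOn ℝ ∞ _ {z : VarSpace | 0 < z.1.2.1}
    fun_prop

section Inversion

variable {w : Base → ℝ}

/-- The action of the inversion on the independent variables. -/
noncomputable def inversionBase (α : ℝ) (q : Base) : Base :=
  (q.2.2 - α * q.1, (q.2.1 - α)⁻¹, q.1)

lemma hasFDerivAt_inv_sub {α : ℝ} {p : Base} (hp : α < p.2.1) :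
    HasFDerivAt (fun q : Base => (q.2.1 - α)⁻¹) (-((p.2.1 - α) ^ 2)⁻¹ •
      (ContinuousLinearMap.fst ℝ ℝ ℝ).comp (ContinuousLinearMap.snd ℝ ℝ (ℝ × ℝ))) p := by
  have h := (hasDerivAt_inv (sub_pos.2 hp).ne').comp_hasFDerivAt p
    ((hasFDerivAt_base_x p).sub_const α)
  exact h

lemma dd_comp_inversion (hw : ContDiff ℝ ∞ w) {α : ℝ} {p : Base} (hp : α < p.2.1) (e : Base) :
    dd e (fun q : Base => w (inversionBase α q)) p
      = (e.2.2 - α * e.1) * pt w (inversionBase α p)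
        - e.2.1 * ((p.2.1 - α) ^ 2)⁻¹ * px w (inversionBase α p)
        + e.1 * py w (inversionBase α p) := by
  have h1 : HasFDerivAt (inversionBase α) _ p :=
    ((hasFDerivAt_base_y p).sub ((hasFDerivAt_base_t p).const_mul α)).prodMk
      ((hasFDerivAt_inv_sub hp).prodMk (hasFDerivAt_base_t p))
  have h2 := ((hw.contDiffAt (x := inversionBase α p)).diffAt.hasFDerivAt).comp p h1
  have h3 : HasFDerivAt (fun q : Base => w (inversionBase α q)) _ p := h2
  rw [dd, h3.fderiv, ContinuousLinearMap.comp_apply, base_apply]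
  simp [pt, px, py]
  ring

lemma differentiableAt_comp_inversion (hw : ContDiff ℝ ∞ w) {α : ℝ} {p : Base} (hp : α < p.2.1) :
    DifferentiableAt ℝ (fun q : Base => w (inversionBase α q)) p := by
  have h1 : HasFDerivAt (inversionBase α) _ p :=
    ((hasFDerivAt_base_y p).sub ((hasFDerivAt_base_t p).const_mul α)).prodMk
      ((hasFDerivAt_inv_sub hp).prodMk (hasFDerivAt_base_t p))
  exact (hw.contDiffAt.diffAt).comp p h1.differentiableAt

lemma dd_base_x (e p : Base) (α : ℝ) : dd e (fun q : Base => q.2.1 - α) p = e.2.1 := by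
  rw [dd, ((hasFDerivAt_base_x p).sub_const α).fderiv]
  simp

/-- With s = x − α, interchanging t and y gives u_t + xu_y = s²(w_t + s⁻¹w_y), and the multiplier s
removes first-order terms: u_xx = s⁻³w_xx. So s^β becomes s²·(1/s)^(5 − β). The restriction s > 0
fixes the sign of s⁵. -/
lemma eqResidual_inversion (hw : ContDiff ℝ ∞ w) {u : Base → ℝ} {θ : Param} {p : Base}
    (hp : θ.1 < p.2.1) (h : u =ᶠ[𝓝 p] fun q => (q.2.1 - θ.1) * w (inversionBase θ.1 q)) :
    eqResidual θ u p = (p.2.1 - θ.1) ^ 2 * eqResidual (0, 5 - θ.2) w (inversionBase θ.1 p) := by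
  have hne : p.2.1 - θ.1 ≠ 0 := (sub_pos.2 hp).ne'
  have hmul : ∀ e q : Base, θ.1 < q.2.1 →
      dd e (fun q : Base => (q.2.1 - θ.1) * w (inversionBase θ.1 q)) q
        = e.2.1 * w (inversionBase θ.1 q) + (q.2.1 - θ.1) *
          ((e.2.2 - θ.1 * e.1) * pt w (inversionBase θ.1 q)
            - e.2.1 * ((q.2.1 - θ.1) ^ 2)⁻¹ * px w (inversionBase θ.1 q)
            + e.1 * py w (inversionBase θ.1 q)) := by
    intro e q hq
    rw [dd_mul (by fun_prop) (differentiableAt_comp_inversion hw hq), dd_comp_inversion hw hq,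
      dd_base_x]
  have hev : ∀ᶠ q in 𝓝 p, θ.1 < q.2.1 :=
    (isOpen_lt continuous_const (by fun_prop : Continuous fun q : Base => q.2.1)).mem_nhds hp
  have e1 : px u =ᶠ[𝓝 p] fun q =>
      w (inversionBase θ.1 q) - (q.2.1 - θ.1)⁻¹ * px w (inversionBase θ.1 q) := by
    filter_upwards [dd_congr_eventually h (0, 1, 0), hev] with q hq hq'
    have h' : q.2.1 - θ.1 ≠ 0 := (sub_pos.2 hq').ne'
    have := hq.trans (hmul _ q hq')
    refine Eq.trans this ?_
    simp
    field_simp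
    ring
  have hwx : ContDiff ℝ ∞ (px w) := hw.dd (0, 1, 0)
  have e2 : px (px u) p = ((p.2.1 - θ.1) ^ 3)⁻¹ * px (px w) (inversionBase θ.1 p) := by
    have hi : DifferentiableAt ℝ (fun q : Base => (q.2.1 - θ.1)⁻¹) p :=
      (hasFDerivAt_inv_sub hp).differentiableAt
    have hi' : dd (0, 1, 0) (fun q : Base => (q.2.1 - θ.1)⁻¹) p = -((p.2.1 - θ.1) ^ 2)⁻¹ := by
      rw [dd, (hasFDerivAt_inv_sub hp).fderiv]
      simp
    have d1 := differentiableAt_comp_inversion hw hp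
    have d2 := differentiableAt_comp_inversion hwx hp
    refine (dd_congr e1 (0, 1, 0)).trans ?_
    rw [dd_sub d1 (hi.fun_mul d2), dd_mul hi d2, dd_comp_inversion hw hp,
      dd_comp_inversion hwx hp, hi']
    simp
    field_simp
  have e3 : pt u p = _ := (dd_congr h (1, 0, 0)).trans (hmul _ p hp)
  have e4 : py u p = _ := (dd_congr h (0, 0, 1)).trans (hmul _ p hp)
  have e5 : diffusivity θ p
      = (p.2.1 - θ.1) ^ 5 * diffusivity (0, 5 - θ.2) (inversionBase θ.1 p) := by
    have hpos := sub_pos.2 hp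
    have h5 : (p.2.1 - θ.1) ^ 5 = (p.2.1 - θ.1) ^ (5 : ℝ) := by norm_cast
    simp only [diffusivity, inversionBase, sub_zero]
    rw [abs_of_pos hpos, abs_of_pos (inv_pos.2 hpos), Real.inv_rpow hpos.le,
      ← Real.rpow_neg hpos.le, h5, ← Real.rpow_add hpos]
    congr 1
    ring
  rw [eqResidual, eqResidual, e2, e3, e4, e5]
  simp only [inversionBase]
  field_simp
  ring

end Inversion

lemma groupoidEquivalent_inversion (θ : Param) : GroupoidEquivalent θ (0, 5 - θ.2) := by
  refine ⟨_, isPointTransformation_inversion θ.1, ?_⟩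
  intro u w hu hw p hp _ _ h
  have hp' : θ.1 < p.2.1 := hp
  have hne : p.2.1 - θ.1 ≠ 0 := (sub_pos.2 hp').ne'
  have hev : ∀ᶠ q : Base in 𝓝 p, θ.1 < q.2.1 :=
    (isOpen_lt continuous_const (by fun_prop : Continuous fun q : Base => q.2.1)).mem_nhds hp'
  have h' : u =ᶠ[𝓝 p] fun q => (q.2.1 - θ.1) * w (inversionBase θ.1 q) := by
    filter_upwards [h, hev] with q hq hq'
    have hq'' : w (inversionBase θ.1 q) = u q * (q.2.1 - θ.1)⁻¹ := hq
    have : q.2.1 - θ.1 ≠ 0 := (sub_pos.2 hq').ne'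
    rw [hq'']
    field_simp
  rw [eqResidual_inversion hw hp' h', mul_eq_zero, or_iff_right (pow_ne_zero 2 hne)]
  rfl

/-! ### Images of functions under point transformations -/

/-- A function that is smooth on an open set coincides near any point of the set with a globally
smooth function. -/
lemma exists_contDiff_eventuallyEq {N : Set Base} (hN : IsOpen N) {w : Base → ℝ}
    (hw : ContDiffOn ℝ ∞ w N) {a : Base} (ha : a ∈ N) :
    ∃ W : Base → ℝ, ContDiff ℝ ∞ W ∧ W =ᶠ[𝓝 a] w := by
  obtain ⟨r, hr, hrN⟩ := Metric.isOpen_iff.1 hN a ha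
  let φ : ContDiffBump a := ⟨r / 4, r / 2, by positivity, by linarith⟩
  refine ⟨fun q => φ q * w q, ?_, ?_⟩
  · refine contDiff_iff_contDiffAt.2 fun q => ?_
    by_cases hq : q ∈ N
    · exact φ.contDiff.contDiffAt.mul (hw.contDiffAt (hN.mem_nhds hq))
    · have h1 : q ∉ tsupport φ := by
        rw [φ.tsupport_eq]
        exact fun h => hq (hrN (Metric.closedBall_subset_ball (by change r / 2 < r; linarith) h))
      refine (contDiffAt_const (c := (0 : ℝ))).congr_of_eventuallyEq ?_
      filter_upwards [notMem_tsupport_iff_eventuallyEq.1 h1] with y hy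
      rw [hy]; simp
  · filter_upwards [φ.eventuallyEq_one] with q hq
    rw [hq]; simp

section Image

variable {Φ : OpenPartialHomeomorph VarSpace VarSpace} {u : Base → ℝ} {p : Base}

/-- If the projected graph map is a local diffeomorphism at p, its inverse carries the image of the
graph to a graph. A cut-off makes that function globally smooth, as `MapsEquation` requires. -/
lemma exists_image_function (hΦ : IsPointTransformation Φ) (hu : ContDiff ℝ ∞ u)
    (hp : (p, u p) ∈ Φ.source)
    (hM : Function.Injective (fderiv ℝ (fun q => (Φ (q, u q)).1) p)) :
    ∃ w : Base → ℝ, ContDiff ℝ ∞ w ∧ ∀ᶠ q in 𝓝 p, w (Φ (q, u q)).1 = (Φ (q, u q)).2 := by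
  set ψ : Base → Base := fun q => (Φ (q, u q)).1 with hψ
  have hg : ContDiff ℝ ∞ fun q : Base => ((q, u q) : VarSpace) := contDiff_id.prodMk hu
  set V : Set Base := (fun q : Base => ((q, u q) : VarSpace)) ⁻¹' Φ.source with hV
  have hVo : IsOpen V := Φ.open_source.preimage hg.continuous
  have hΦV : ContDiffOn ℝ ∞ (fun q : Base => Φ (q, u q)) V :=
    hΦ.2.1.comp hg.contDiffOn fun q hq => hq
  have hψV : ContDiffOn ℝ ∞ ψ V := hΦV.fst
  have hψat : ∀ q ∈ V, ContDiffAt ℝ ∞ ψ q := fun q hq => hψV.contDiffAt (hVo.mem_nhds hq)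
  let M : Base ≃L[ℝ] Base :=
    (LinearEquiv.ofInjectiveEndo (fderiv ℝ ψ p : Base →ₗ[ℝ] Base) hM).toContinuousLinearEquiv
  have hMp : HasFDerivAt ψ (M : Base →L[ℝ] Base) p := by
    have h := (hψat p hp).diffAt.hasFDerivAt
    have e : (M : Base →L[ℝ] Base) = fderiv ℝ ψ p := by ext1 <;> rfl
    rwa [e]
  let e := (hψat p hp).toOpenPartialHomeomorph ψ hMp (by simp)
  have hpe : p ∈ e.source := (hψat p hp).mem_toOpenPartialHomeomorph_source hMp (by simp)
  -- Smoothness of the inverse is needed on a neighbourhood, so the derivative must be invertible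
  -- near p and not just at p.
  have hinv : ∀ᶠ q in 𝓝 p, ∃ M' : Base ≃L[ℝ] Base, (M' : Base →L[ℝ] Base) = fderiv ℝ ψ q := by
    have hc : ContinuousAt (fderiv ℝ ψ) p :=
      ((hψat p hp).fderiv_right (m := ∞) le_rfl).continuousAt
    have := hc.tendsto.eventually
      (show range ((↑) : (Base ≃L[ℝ] Base) → Base →L[ℝ] Base) ∈ 𝓝 (fderiv ℝ ψ p) from by
        rw [← hMp.fderiv.symm]; exact ContinuousLinearEquiv.nhds M)
    exact this
  obtain ⟨I, hI, hIo, hpI⟩ := eventually_nhds_iff.1 hinv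
  let N : Set Base := e.target ∩ e.symm ⁻¹' (V ∩ I)
  have hN : IsOpen N := e.isOpen_inter_preimage_symm (hVo.inter hIo)
  have hs : ContDiffOn ℝ ∞ e.symm N := by
    intro y hy
    obtain ⟨M', hM'⟩ := hI _ hy.2.2
    have hd : HasFDerivAt e (M' : Base →L[ℝ] Base) (e.symm y) := by
      rw [hM']
      exact (hψat _ hy.2.1).diffAt.hasFDerivAt
    exact (e.contDiffAt_symm hy.1 hd (hψat _ hy.2.1)).contDiffWithinAt
  have hw : ContDiffOn ℝ ∞ (fun y => (Φ (e.symm y, u (e.symm y))).2) N :=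
    (hΦV.snd.comp hs fun y hy => hy.2.1)
  have ha : ψ p ∈ N := by
    refine ⟨e.map_source hpe, ?_⟩
    have : e.symm (ψ p) = p := e.left_inv hpe
    change e.symm (ψ p) ∈ V ∩ I
    rw [this]
    exact ⟨hp, hpI⟩
  obtain ⟨W, hW, hWe⟩ := exists_contDiff_eventuallyEq hN hw ha
  refine ⟨W, hW, ?_⟩
  have hcont : ContinuousAt ψ p := (hψat p hp).continuousAt
  filter_upwards [hcont.tendsto.eventually hWe, e.open_source.mem_nhds hpe] with q hq hqe
  have : e.symm (ψ q) = q := e.left_inv hqe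
  rw [show W (Φ (q, u q)).1 = _ from hq, this]

end Image

section Chain

variable {w : Base → ℝ} {ψ : Base → Base} {p : Base}

lemma dd_comp_base (hw : ContDiff ℝ ∞ w) (hψ : DifferentiableAt ℝ ψ p) (e : Base) :
    dd e (fun q => w (ψ q)) p = dd e (fun q => (ψ q).1) p * pt w (ψ p)
      + dd e (fun q => (ψ q).2.1) p * px w (ψ p) + dd e (fun q => (ψ q).2.2) p * py w (ψ p) := by
  have h1 : HasFDerivAt (fun q => w (ψ q)) _ p :=
    hw.contDiffAt.diffAt.hasFDerivAt.comp p hψ.hasFDerivAt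
  have h2 : HasFDerivAt (fun q => (ψ q).1) _ p := hψ.hasFDerivAt.fst
  have h3 : HasFDerivAt (fun q => (ψ q).2.1) _ p := hψ.hasFDerivAt.snd.fst
  have h4 : HasFDerivAt (fun q => (ψ q).2.2) _ p := hψ.hasFDerivAt.snd.snd
  simp only [dd]
  rw [h1.fderiv, ContinuousLinearMap.comp_apply, base_apply, h2.fderiv, h3.fderiv, h4.fderiv]
  rfl

/-- The second derivative of a composition in a direction that is mapped to the direction of `x`. -/
lemma dd_dd_comp_base (hw : ContDiff ℝ ∞ w) (hψ : ContDiffAt ℝ ∞ ψ p) {e : Base}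
    (h1 : dd e (fun q => (ψ q).1) p = 0) (h2 : dd e (fun q => (ψ q).2.1) p = 1)
    (h3 : dd e (fun q => (ψ q).2.2) p = 0) :
    dd e (dd e (fun q => w (ψ q))) p = px (px w) (ψ p)
      + dd e (dd e (fun q => (ψ q).1)) p * pt w (ψ p)
      + dd e (dd e (fun q => (ψ q).2.1)) p * px w (ψ p)
      + dd e (dd e (fun q => (ψ q).2.2)) p * py w (ψ p) := by
  have hev : dd e (fun q => w (ψ q)) =ᶠ[𝓝 p] fun q => dd e (fun q => (ψ q).1) q * pt w (ψ q)
      + dd e (fun q => (ψ q).2.1) q * px w (ψ q) + dd e (fun q => (ψ q).2.2) q * py w (ψ q) := by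
    filter_upwards [hψ.two.eventually_smooth] with q hq
    exact dd_comp_base hw (hq.differentiableAt (by simp)) e
  have wt : ContDiff ℝ ∞ (pt w) := hw.dd _
  have wx : ContDiff ℝ ∞ (px w) := hw.dd _
  have wy : ContDiff ℝ ∞ (py w) := hw.dd _
  have s1 : ContDiffAt ℝ ∞ (dd e fun q => (ψ q).1) p := ContDiffAt.dd hψ.fst e
  have s2 : ContDiffAt ℝ ∞ (dd e fun q => (ψ q).2.1) p := ContDiffAt.dd hψ.snd.fst e
  have s3 : ContDiffAt ℝ ∞ (dd e fun q => (ψ q).2.2) p := ContDiffAt.dd hψ.snd.snd e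
  have c : ∀ {f : Base → ℝ}, ContDiff ℝ ∞ f → DifferentiableAt ℝ (fun q => f (ψ q)) p :=
    fun hf => hf.contDiffAt.diffAt.comp p hψ.diffAt
  rw [dd_congr hev, dd_add ((s1.diffAt.fun_mul (c wt)).fun_add (s2.diffAt.fun_mul (c wx)))
    (s3.diffAt.fun_mul (c wy)), dd_add (s1.diffAt.fun_mul (c wt)) (s2.diffAt.fun_mul (c wx)),
    dd_mul s1.diffAt (c wt), dd_mul s2.diffAt (c wx), dd_mul s3.diffAt (c wy),
    dd_comp_base wx hψ.diffAt, h1, h2, h3]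
  ring

end Chain

/-- A quadratic polynomial with prescribed derivatives at `p`. -/
noncomputable def quadraticFunction (p : Base) (u₀ a b c h₁ h₂ h₃ : ℝ) (q : Base) : ℝ :=
  u₀ + a * (q.1 - p.1) + b * (q.2.1 - p.2.1) + c * (q.2.2 - p.2.2)
    + h₁ / 2 * (q.1 - p.1) ^ 2 + h₂ / 2 * (q.2.1 - p.2.1) ^ 2 + h₃ / 2 * (q.2.2 - p.2.2) ^ 2

section Quadratic

variable (p : Base) (u₀ a b c h₁ h₂ h₃ : ℝ)

lemma contDiff_quadraticFunction : ContDiff ℝ ∞ (quadraticFunction p u₀ a b c h₁ h₂ h₃) := by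
  unfold quadraticFunction; fun_prop

lemma quadraticFunction_self : quadraticFunction p u₀ a b c h₁ h₂ h₃ p = u₀ := by
  simp [quadraticFunction]

lemma dd_quadraticFunction (e : Base) : dd e (quadraticFunction p u₀ a b c h₁ h₂ h₃)
    = quadraticFunction p (a * e.1 + b * e.2.1 + c * e.2.2) (h₁ * e.1) (h₂ * e.2.1) (h₃ * e.2.2)
      0 0 0 := by
  funext q
  have k1 := (hasFDerivAt_base_t q).sub_const p.1
  have k2 := (hasFDerivAt_base_x q).sub_const p.2.1
  have k3 := (hasFDerivAt_base_y q).sub_const p.2.2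
  have h : HasFDerivAt (quadraticFunction p u₀ a b c h₁ h₂ h₃) _ q :=
    ((((((k1.const_mul a).const_add u₀).add (k2.const_mul b)).add (k3.const_mul c)).add
      ((k1.pow 2).const_mul (h₁ / 2))).add ((k2.pow 2).const_mul (h₂ / 2))).add
      ((k3.pow 2).const_mul (h₃ / 2))
  rw [dd, h.fderiv]
  simp [quadraticFunction]
  ring

end Quadratic

/-! ### The structure of admissible transformations -/

section Components

variable {v : VarSpace → VarSpace} {z : VarSpace}

lemma dd_tauC (h : DifferentiableAt ℝ v z) (e : VarSpace) :
    dd e (tauC v) z = (fderiv ℝ v z e).1.1 := by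
  have h1 : HasFDerivAt (tauC v) _ z := h.hasFDerivAt.fst.fst
  rw [dd, h1.fderiv]; rfl

lemma dd_xiC (h : DifferentiableAt ℝ v z) (e : VarSpace) :
    dd e (xiC v) z = (fderiv ℝ v z e).1.2.1 := by
  have h1 : HasFDerivAt (xiC v) _ z := h.hasFDerivAt.fst.snd.fst
  rw [dd, h1.fderiv]; rfl

lemma dd_zetaC (h : DifferentiableAt ℝ v z) (e : VarSpace) :
    dd e (zetaC v) z = (fderiv ℝ v z e).1.2.2 := by
  have h1 : HasFDerivAt (zetaC v) _ z := h.hasFDerivAt.fst.snd.snd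
  rw [dd, h1.fderiv]; rfl

lemma dd_etaC (h : DifferentiableAt ℝ v z) (e : VarSpace) :
    dd e (etaC v) z = (fderiv ℝ v z e).2 := by
  have h1 : HasFDerivAt (etaC v) _ z := h.hasFDerivAt.snd
  rw [dd, h1.fderiv]; rfl

/-- The second derivative in a direction with `u`-component. -/
lemma dd_dd_add_smul {F : VarSpace → ℝ} (hF : ContDiffAt ℝ ∞ F z) (e : VarSpace) (s : ℝ) :
    dd (e + s • vu) (dd (e + s • vu) F) z
      = dd e (dd e F) z + 2 * s * dd e (dd vu F) z + s ^ 2 * dd vu (dd vu F) z := by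
  have h : ∀ (G : VarSpace → ℝ) w, dd (e + s • vu) G w = dd e G w + s * dd vu G w := by
    intro G w
    simp only [dd, map_add, map_smul, smul_eq_mul]
  rw [h, show dd (e + s • vu) F = _ from funext (h F),
    dd_add (hF.dd e).diffAt ((hF.dd vu).diffAt.const_mul s),
    dd_add (hF.dd e).diffAt ((hF.dd vu).diffAt.const_mul s), dd_const_mul (hF.dd vu).diffAt,
    dd_const_mul (hF.dd vu).diffAt, dd_comm hF.two vu e]
  ring

end Components

/-- The tangent vector over `e` of the graph of a function with the first derivatives
`a`, `b` and `c`. -/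
def graphVector (a b c : ℝ) (e : Base) : VarSpace := (e, a * e.1 + b * e.2.1 + c * e.2.2)

section Structure

variable {Φ : OpenPartialHomeomorph VarSpace VarSpace} {θ θ' : Param} {z : VarSpace}

lemma IsPointTransformation.contDiffAt (hΦ : IsPointTransformation Φ) (hz : z ∈ Φ.source) :
    ContDiffAt ℝ ∞ Φ z := hΦ.2.1.contDiffAt (Φ.open_source.mem_nhds hz)

lemma IsPointTransformation.fderiv_injective (hΦ : IsPointTransformation Φ) (hz : z ∈ Φ.source) :
    Function.Injective (fderiv ℝ Φ z) := by
  have h1 := (hΦ.contDiffAt hz).diffAt.hasFDerivAt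
  have h2 := (hΦ.2.2.contDiffAt (Φ.open_target.mem_nhds (Φ.map_source hz))).diffAt.hasFDerivAt
  have h3 : HasFDerivAt (fun w => Φ.symm (Φ w)) _ z := h2.comp z h1
  have h4 : (fun w => Φ.symm (Φ w)) =ᶠ[𝓝 z] id := by
    filter_upwards [Φ.open_source.mem_nhds hz] with w hw using Φ.left_inv hw
  have h5 := (h4.hasFDerivAt_iff.1 h3).unique (hasFDerivAt_id z)
  intro a b hab
  have ha := DFunLike.congr_fun h5 a
  have hb := DFunLike.congr_fun h5 b
  simp only [ContinuousLinearMap.comp_apply, ContinuousLinearMap.id_apply] at ha hb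
  rw [← ha, ← hb, hab]

lemma IsPointTransformation.fderiv_surjective (hΦ : IsPointTransformation Φ) (hz : z ∈ Φ.source) :
    Function.Surjective (fderiv ℝ Φ z) :=
  LinearMap.injective_iff_surjective.1
    (show Function.Injective (fderiv ℝ Φ z : VarSpace →ₗ[ℝ] VarSpace) from hΦ.fderiv_injective hz)

/-- The condition on an admissible transformation that comes from the 2-jet at `z` of a quadratic
polynomial. -/
lemma jet_condition (hΦ : IsPointTransformation Φ) (hmap : MapsEquation Φ θ θ')
    (hz : z ∈ Φ.source) (hr : Regular θ z.1) (hr' : Regular θ' (Φ z).1) {a b c : ℝ}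
    (hM : ∀ e, (fderiv ℝ Φ z (graphVector a b c e)).1 = 0 → e = 0) {n m : Base}
    (hn : (fderiv ℝ Φ z (graphVector a b c n)).1 = (0, 1, 0))
    (hm : ∀ e, (fderiv ℝ Φ z (graphVector a b c e)).2
      = m.1 * (fderiv ℝ Φ z (graphVector a b c e)).1.1
        + m.2.1 * (fderiv ℝ Φ z (graphVector a b c e)).1.2.1
        + m.2.2 * (fderiv ℝ Φ z (graphVector a b c e)).1.2.2)
    {h₁ h₂ h₃ : ℝ} (h : a + z.1.2.1 * c = diffusivity θ z.1 * h₂) {ν : VarSpace}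
    (hν : ν = graphVector a b c n) :
    m.1 + (Φ z).1.2.1 * m.2.2 = diffusivity θ' (Φ z).1 *
      (dd ν (dd ν (etaC Φ)) z - m.1 * dd ν (dd ν (tauC Φ)) z - m.2.1 * dd ν (dd ν (xiC Φ)) z
        - m.2.2 * dd ν (dd ν (zetaC Φ)) z + (h₁ * n.1 ^ 2 + h₂ * n.2.1 ^ 2 + h₃ * n.2.2 ^ 2)
        * (dd vu (etaC Φ) z - m.1 * dd vu (tauC Φ) z - m.2.1 * dd vu (xiC Φ) z
          - m.2.2 * dd vu (zetaC Φ) z)) := by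
  obtain ⟨p, u₀⟩ := z
  set u := quadraticFunction p u₀ a b c h₁ h₂ h₃ with hu_def
  have hu : ContDiff ℝ ∞ u := contDiff_quadraticFunction ..
  have hup : u p = u₀ := quadraticFunction_self ..
  have hz' : (p, u p) ∈ Φ.source := by rwa [hup]
  have hC : ContDiffAt ℝ ∞ Φ (p, u p) := hΦ.contDiffAt hz'
  have hdu : ∀ e, dd e u p = a * e.1 + b * e.2.1 + c * e.2.2 := fun e => by
    rw [hu_def, dd_quadraticFunction, quadraticFunction_self]
  have hddu : ∀ e, dd e (dd e u) p = h₁ * e.1 ^ 2 + h₂ * e.2.1 ^ 2 + h₃ * e.2.2 ^ 2 := fun e => by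
    rw [hu_def, dd_quadraticFunction, dd_quadraticFunction, quadraticFunction_self]
    ring
  set ψ : Base → Base := fun q => (Φ (q, u q)).1 with hψ
  have hψC : ContDiffAt ℝ ∞ ψ p :=
    (hC.comp p (contDiffAt_id.prodMk hu.contDiffAt)).fst
  have hg : HasFDerivAt (fun q : Base => (q, u q))
      ((ContinuousLinearMap.id ℝ Base).prod (fderiv ℝ u p)) p :=
    (hasFDerivAt_id p).prodMk hu.contDiffAt.diffAt.hasFDerivAt
  have hψd : ∀ e, fderiv ℝ ψ p e = (fderiv ℝ Φ (p, u₀) (graphVector a b c e)).1 := by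
    intro e
    have h1 := (hC.diffAt.hasFDerivAt.comp p hg).fst
    have h2 : HasFDerivAt ψ _ p := h1
    have h3 : ((ContinuousLinearMap.id ℝ Base).prod (fderiv ℝ u p)) e = graphVector a b c e := by
      rw [graphVector, ← hdu]; rfl
    rw [h2.fderiv, ← hup]
    change (fderiv ℝ Φ (p, u p) (((ContinuousLinearMap.id ℝ Base).prod (fderiv ℝ u p)) e)).1 = _
    rw [h3]
  have hinj : Function.Injective (fderiv ℝ ψ p) :=
    (injective_iff_map_eq_zero _).2 fun e he => hM e (by rw [← hψd, he])
  obtain ⟨w, hw, hwe⟩ := exists_image_function hΦ hu hz' hinj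
  have hres : eqResidual θ u p = 0 := by
    have e1 : pt u p = a := (hdu _).trans (by simp)
    have e2 : py u p = c := (hdu _).trans (by simp)
    have e3 : px (px u) p = h₂ := (hddu _).trans (by simp)
    rw [eqResidual, e1, e2, e3]
    linarith
  have hres' := (hmap u w hu hw p hz' (by exact hr) (by rw [hup]; exact hr') hwe).1 hres
  have hds : ∀ {F : VarSpace → ℝ}, ContDiffAt ℝ ∞ F (p, u p) → ∀ e,
      dd e (fun q => F (q, u q)) p = dd (graphVector a b c e) F (p, u₀) := by
    intro F hF e
    rw [dd_comp_graph hF.diffAt hu.contDiffAt.diffAt, hdu, hup,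
      show graphVector a b c e = (e, 0) + (a * e.1 + b * e.2.1 + c * e.2.2) • vu by
        simp [graphVector, vu]]
    simp only [dd, map_add, map_smul, smul_eq_mul]
  have hdds : ∀ {F : VarSpace → ℝ}, ContDiffAt ℝ ∞ F (p, u p) →
      dd n (dd n (fun q => F (q, u q))) p = dd ν (dd ν F) (p, u₀)
        + (h₁ * n.1 ^ 2 + h₂ * n.2.1 ^ 2 + h₃ * n.2.2 ^ 2) * dd vu F (p, u₀) := by
    intro F hF
    rw [dd_dd_comp_graph hF hu, hdu, hddu, hν,
      show graphVector a b c n = (n, 0) + (a * n.1 + b * n.2.1 + c * n.2.2) • vu by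
        simp [graphVector, vu], dd_dd_add_smul (hup ▸ hF), hup]
  have hC' : ContDiffAt ℝ ∞ Φ (p, u₀) := hup ▸ hC
  have hsurj : Function.Surjective (fderiv ℝ ψ p) :=
    LinearMap.injective_iff_surjective.1
      (show Function.Injective (fderiv ℝ ψ p : Base →ₗ[ℝ] Base) from hinj)
  -- The derivative of the projected graph map is onto, so the first-order chain rule identifies the
  -- gradient of the image function with m.
  have hgrad : ∀ r : Base, r.1 * pt w (ψ p) + r.2.1 * px w (ψ p) + r.2.2 * py w (ψ p)
      = m.1 * r.1 + m.2.1 * r.2.1 + m.2.2 * r.2.2 := by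
    intro r
    obtain ⟨e, rfl⟩ := hsurj r
    have h1 := dd_comp_base hw hψC.diffAt e
    rw [dd_congr hwe] at h1
    have h2 := hds hC.etaC e
    have h3 := hds hC.tauC e
    have h4 := hds hC.xiC e
    have h5 := hds hC.zetaC e
    rw [dd_etaC hC'.diffAt] at h2
    rw [dd_tauC hC'.diffAt] at h3
    rw [dd_xiC hC'.diffAt] at h4
    rw [dd_zetaC hC'.diffAt] at h5
    have h6 := h1.symm.trans (h2.trans (hm e))
    rw [show dd e (fun q => (ψ q).1) p = _ from h3, show dd e (fun q => (ψ q).2.1) p = _ from h4,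
      show dd e (fun q => (ψ q).2.2) p = _ from h5] at h6
    rw [hψd]
    exact h6
  have g1 : pt w (ψ p) = m.1 := by simpa using hgrad (1, 0, 0)
  have g2 : px w (ψ p) = m.2.1 := by simpa using hgrad (0, 1, 0)
  have g3 : py w (ψ p) = m.2.2 := by simpa using hgrad (0, 0, 1)
  have n1 : dd n (fun q => (ψ q).1) p = 0 := by
    have := hds hC.tauC n
    rw [dd_tauC hC'.diffAt, hn] at this
    exact this
  have n2 : dd n (fun q => (ψ q).2.1) p = 1 := by
    have := hds hC.xiC n
    rw [dd_xiC hC'.diffAt, hn] at this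
    exact this
  have n3 : dd n (fun q => (ψ q).2.2) p = 0 := by
    have := hds hC.zetaC n
    rw [dd_zetaC hC'.diffAt, hn] at this
    exact this
  -- Since n is sent to the x-direction, the second derivative along n contains w_xx with
  -- coefficient 1 and no other second derivative of w.
  have key := dd_dd_comp_base hw hψC n1 n2 n3
  rw [dd_congr (dd_congr_eventually hwe n) n, g1, g2, g3,
    show dd n (dd n fun q => (Φ (q, u q)).2) p = _ from hdds hC.etaC,
    show dd n (dd n fun q => (ψ q).1) p = _ from hdds hC.tauC,
    show dd n (dd n fun q => (ψ q).2.1) p = _ from hdds hC.xiC,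
    show dd n (dd n fun q => (ψ q).2.2) p = _ from hdds hC.zetaC] at key
  rw [eqResidual, show pt w (Φ (p, u p)).1 = _ from g1, show py w (Φ (p, u p)).1 = _ from g3,
    show px (px w) (Φ (p, u p)).1 = px (px w) (ψ p) from rfl, hup] at hres'
  linear_combination hres' - diffusivity θ' (Φ (p, u₀)).1 * key

end Structure

section Structure

variable {Φ : OpenPartialHomeomorph VarSpace VarSpace} {θ θ' : Param} {z : VarSpace}

/-- `graphVector` as a linear map. -/
def graphMap (a b c : ℝ) : Base →ₗ[ℝ] VarSpace where
  toFun := graphVector a b c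
  map_add' e e' := by ext <;> simp [graphVector]; ring
  map_smul' s e := by ext <;> simp [graphVector]; ring

/-- Transversality makes the projected tangent map invertible: n is the preimage of the x-direction,
and m is the gradient of the image graph. -/
lemma exists_normal {a b c : ℝ} {L : VarSpace →L[ℝ] VarSpace}
    (hM : ∀ e, (L (graphVector a b c e)).1 = 0 → e = 0) :
    ∃ n m : Base, (L (graphVector a b c n)).1 = (0, 1, 0) ∧
      ∀ e, (L (graphVector a b c e)).2 = m.1 * (L (graphVector a b c e)).1.1
        + m.2.1 * (L (graphVector a b c e)).1.2.1 + m.2.2 * (L (graphVector a b c e)).1.2.2 := by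
  let M : Base →ₗ[ℝ] Base := LinearMap.fst ℝ Base ℝ ∘ₗ (L : VarSpace →ₗ[ℝ] VarSpace) ∘ₗ graphMap a b c
  have hinj : Function.Injective M := (injective_iff_map_eq_zero M).2 hM
  let E : Base ≃ₗ[ℝ] Base := LinearEquiv.ofInjectiveEndo M hinj
  have hE : ∀ e, E e = (L (graphVector a b c e)).1 := fun _ => rfl
  let f : Base →L[ℝ] ℝ := (LinearMap.snd ℝ Base ℝ ∘ₗ (L : VarSpace →ₗ[ℝ] VarSpace) ∘ₗ
    graphMap a b c ∘ₗ (E.symm : Base →ₗ[ℝ] Base)).toContinuousLinearMap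
  refine ⟨E.symm (0, 1, 0), (f (1, 0, 0), f (0, 1, 0), f (0, 0, 1)), ?_, fun e => ?_⟩
  · rw [← hE, E.apply_symm_apply]
  · have h1 : (L (graphVector a b c e)).2 = f (E e) := by
      change _ = (L (graphVector a b c (E.symm (E e)))).2
      rw [E.symm_apply_apply]
    rw [h1, base_apply, hE]
    ring

/-- If the expression vanished, the image of ∂_u would be tangent to the image graph. By injectivity
∂_u would then be tangent to the graph of a function. -/
lemma conormal_vu_ne_zero (hΦ : IsPointTransformation Φ) (hz : z ∈ Φ.source) {a b c : ℝ}
    {m : Base} (hM : ∀ e, (fderiv ℝ Φ z (graphVector a b c e)).1 = 0 → e = 0)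
    (hm : ∀ e, (fderiv ℝ Φ z (graphVector a b c e)).2
      = m.1 * (fderiv ℝ Φ z (graphVector a b c e)).1.1
        + m.2.1 * (fderiv ℝ Φ z (graphVector a b c e)).1.2.1
        + m.2.2 * (fderiv ℝ Φ z (graphVector a b c e)).1.2.2) :
    dd vu (etaC Φ) z - m.1 * dd vu (tauC Φ) z - m.2.1 * dd vu (xiC Φ) z
      - m.2.2 * dd vu (zetaC Φ) z ≠ 0 := by
  have hd := (hΦ.contDiffAt hz).diffAt
  rw [dd_etaC hd, dd_tauC hd, dd_xiC hd, dd_zetaC hd]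
  intro h
  have hsurj : Function.Surjective
      (LinearMap.fst ℝ Base ℝ ∘ₗ (fderiv ℝ Φ z : VarSpace →ₗ[ℝ] VarSpace) ∘ₗ graphMap a b c) :=
    LinearMap.injective_iff_surjective.1 ((injective_iff_map_eq_zero _).2 hM)
  obtain ⟨e, he⟩ := hsurj (fderiv ℝ Φ z vu).1
  replace he : (fderiv ℝ Φ z (graphVector a b c e)).1 = (fderiv ℝ Φ z vu).1 := he
  have h2 : fderiv ℝ Φ z (graphVector a b c e) = fderiv ℝ Φ z vu := by
    refine Prod.ext he ?_
    rw [hm, he]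
    linarith
  have h3 := hΦ.fderiv_injective hz h2
  have h4 : e = 0 := congrArg Prod.fst h3
  have h5 : a * e.1 + b * e.2.1 + c * e.2.2 = 1 := congrArg Prod.snd h3
  simp [h4] at h5

/-- For a transversal graph, the new variables `t` and `y` have zero derivative in the direction of
`x` along the graph. -/
lemma transversal_condition (hΦ : IsPointTransformation Φ) (hmap : MapsEquation Φ θ θ')
    (hz : z ∈ Φ.source) (hr : Regular θ z.1) (hr' : Regular θ' (Φ z).1) {a b c : ℝ}
    (hM : ∀ e, (fderiv ℝ Φ z (graphVector a b c e)).1 = 0 → e = 0) :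
    dd vx (tauC Φ) z + b * dd vu (tauC Φ) z = 0 ∧ dd vx (xiC Φ) z + b * dd vu (xiC Φ) z ≠ 0 ∧
      dd vx (zetaC Φ) z + b * dd vu (zetaC Φ) z = 0 := by
  have hd := (hΦ.contDiffAt hz).diffAt
  obtain ⟨n, m, hn, hm⟩ := exists_normal hM
  have hκ := conormal_vu_ne_zero hΦ hz hM hm
  have hA : diffusivity θ z.1 ≠ 0 := hr
  have hA' : diffusivity θ' (Φ z).1 ≠ 0 := hr'
  -- The derivatives u_tt and u_yy are not restricted by the equation, so varying them must not
  -- change the transformed condition; this kills the t- and y-components of n.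
  have J : ∀ h₁ h₃ : ℝ, _ := fun h₁ h₃ => jet_condition hΦ hmap hz hr hr' hM hn hm
    (h₁ := h₁) (h₃ := h₃) (mul_div_cancel₀ _ hA).symm rfl
  have n1 : n.1 = 0 := by
    have : diffusivity θ' (Φ z).1 * (n.1 ^ 2 * (dd vu (etaC Φ) z - m.1 * dd vu (tauC Φ) z
        - m.2.1 * dd vu (xiC Φ) z - m.2.2 * dd vu (zetaC Φ) z)) = 0 := by
      linear_combination J 0 0 - J 1 0
    simpa [hA', hκ] using this
  have n3 : n.2.2 = 0 := by
    have : diffusivity θ' (Φ z).1 * (n.2.2 ^ 2 * (dd vu (etaC Φ) z - m.1 * dd vu (tauC Φ) z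
        - m.2.1 * dd vu (xiC Φ) z - m.2.2 * dd vu (zetaC Φ) z)) = 0 := by
      linear_combination J 0 0 - J 0 1
    simpa [hA', hκ] using this
  have hv : graphVector a b c n = n.2.1 • (vx + b • vu) := by
    ext <;> simp [graphVector, vx, vu, n1, n3]
    ring
  have hL : ∀ F : VarSpace → ℝ, dd (n.2.1 • (vx + b • vu)) F z
      = n.2.1 * (dd vx F z + b * dd vu F z) := fun F => by
    simp only [dd, map_add, map_smul, smul_eq_mul]
  rw [hv] at hn
  have h1 := dd_tauC hd (n.2.1 • (vx + b • vu))
  have h2 := dd_xiC hd (n.2.1 • (vx + b • vu))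
  have h3 := dd_zetaC hd (n.2.1 • (vx + b • vu))
  rw [hn, hL] at h1 h2 h3
  have hn2 : n.2.1 ≠ 0 := by rintro h; rw [h] at h2; simp at h2
  refine ⟨(mul_eq_zero.1 h1).resolve_left hn2, fun h => ?_, (mul_eq_zero.1 h3).resolve_left hn2⟩
  rw [h] at h2; simp at h2

/-- The graphs with two different values of the derivative with respect to `x` are transversal. -/
lemma exists_transversal (hΦ : IsPointTransformation Φ) (hz : z ∈ Φ.source) :
    ∃ a c b b' : ℝ, b ≠ b' ∧ (∀ e, (fderiv ℝ Φ z (graphVector a b c e)).1 = 0 → e = 0) ∧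
      ∀ e, (fderiv ℝ Φ z (graphVector a b' c e)).1 = 0 → e = 0 := by
  -- The vector k is the preimage of ∂_u. The image of the graph fails to be a graph exactly when k
  -- is tangent, that is, when a·k_t + b·k_x + c·k_y = k_u.
  obtain ⟨k, hk⟩ := hΦ.fderiv_surjective hz (0, 1)
  have hk0 : k ≠ 0 := by
    rintro rfl
    simpa using congrArg Prod.snd hk
  have main : ∀ a b c : ℝ, a * k.1.1 + b * k.1.2.1 + c * k.1.2.2 ≠ k.2 →
      ∀ e, (fderiv ℝ Φ z (graphVector a b c e)).1 = 0 → e = 0 := by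
    intro a b c hne e he
    have h1 : graphVector a b c e = (fderiv ℝ Φ z (graphVector a b c e)).2 • k := by
      refine hΦ.fderiv_injective hz ?_
      rw [map_smul, hk]
      ext <;> simp [he]
    set s := (fderiv ℝ Φ z (graphVector a b c e)).2
    have h2 : e = s • k.1 := congrArg Prod.fst h1
    have h3 : a * e.1 + b * e.2.1 + c * e.2.2 = s * k.2 := congrArg Prod.snd h1
    have h4 : s * (a * k.1.1 + b * k.1.2.1 + c * k.1.2.2 - k.2) = 0 := by
      rw [h2] at h3
      simp only [Prod.smul_fst, Prod.smul_snd, smul_eq_mul] at h3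
      linear_combination h3
    rw [(mul_eq_zero.1 h4).resolve_right (sub_ne_zero.2 hne)] at h2
    simpa using h2
  obtain ⟨⟨kt, kx, ky⟩, ku⟩ := k
  simp only at main
  by_cases hx : kx = 0
  · subst hx
    suffices h : ∃ a c : ℝ, a * kt + c * ky ≠ ku by
      obtain ⟨a, c, h⟩ := h
      exact ⟨a, c, 0, 1, zero_ne_one, main _ _ _ (by simpa using h), main _ _ _ (by simpa using h)⟩
    by_contra! h
    have h1 := h 0 0
    have h2 := h 1 0
    have h3 := h 0 1
    simp only [zero_mul, one_mul, add_zero, zero_add] at h1 h2 h3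
    subst h1
    subst h2
    subst h3
    exact hk0 rfl
  -- These slopes give b·k_x = k_u + 1 and b·k_x = k_u + 2, both different from k_u.
  · refine ⟨0, 0, (ku + 1) / kx, (ku + 2) / kx, ?_, main _ _ _ ?_, main _ _ _ ?_⟩
    · intro h
      field_simp at h
      linarith
    all_goals
      intro h
      field_simp at h
      linarith

/-- The new variables `t` and `y` depend only on `t` and `y`. -/
lemma projectable (hΦ : IsPointTransformation Φ) (hmap : MapsEquation Φ θ θ')
    (hz : z ∈ Φ.source) (hr : Regular θ z.1) (hr' : Regular θ' (Φ z).1) :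
    dd vx (tauC Φ) z = 0 ∧ dd vu (tauC Φ) z = 0 ∧ dd vx (zetaC Φ) z = 0 ∧ dd vu (zetaC Φ) z = 0 ∧
      ∃ b, dd vx (xiC Φ) z + b * dd vu (xiC Φ) z ≠ 0 := by
  obtain ⟨a, c, b, b', hb, h1, h2⟩ := exists_transversal hΦ hz
  obtain ⟨T1, X1, Y1⟩ := transversal_condition hΦ hmap hz hr hr' h1
  obtain ⟨T2, -, Y2⟩ := transversal_condition hΦ hmap hz hr hr' h2
  have hT : dd vu (tauC Φ) z = 0 := by
    have : (b - b') * dd vu (tauC Φ) z = 0 := by linear_combination T1 - T2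
    exact (mul_eq_zero.1 this).resolve_left (sub_ne_zero.2 hb)
  have hY : dd vu (zetaC Φ) z = 0 := by
    have : (b - b') * dd vu (zetaC Φ) z = 0 := by linear_combination Y1 - Y2
    exact (mul_eq_zero.1 this).resolve_left (sub_ne_zero.2 hb)
  rw [hT] at T1
  rw [hY] at Y1
  exact ⟨by linarith, hT, by linarith, hY, b, X1⟩

/-- Since dT and dY involve only dt and dy, vanishing of this 2 × 2 determinant would contradict
surjectivity of the derivative of Φ. -/
lemma jacobian_ne_zero (hΦ : IsPointTransformation Φ) (hz : z ∈ Φ.source)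
    (hTx : dd vx (tauC Φ) z = 0) (hTu : dd vu (tauC Φ) z = 0) (hYx : dd vx (zetaC Φ) z = 0)
    (hYu : dd vu (zetaC Φ) z = 0) :
    dd vy (zetaC Φ) z * dd vt (tauC Φ) z - dd vt (zetaC Φ) z * dd vy (tauC Φ) z ≠ 0 := by
  have hd := (hΦ.contDiffAt hz).diffAt
  obtain ⟨e, he⟩ := hΦ.fderiv_surjective hz ((1, 0, 0), 0)
  obtain ⟨f, hf⟩ := hΦ.fderiv_surjective hz ((0, 0, 1), 0)
  have e1 := dd_tauC hd e
  have e2 := dd_zetaC hd e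
  have f1 := dd_tauC hd f
  have f2 := dd_zetaC hd f
  rw [he, dd, var_apply] at e1 e2
  rw [hf, dd, var_apply] at f1 f2
  simp only [← dd_eq_fderiv, hTx, hTu, hYx, hYu] at e1 e2 f1 f2
  intro h
  have : (1 : ℝ) = 0 := by
    calc (1 : ℝ) = 1 * 1 - 0 * 0 := by ring
      _ = (dd vy (zetaC Φ) z * dd vt (tauC Φ) z - dd vt (zetaC Φ) z * dd vy (tauC Φ) z)
          * (e.1.1 * f.1.2.2 - e.1.2.2 * f.1.1) := by
        linear_combination -(f.1.1 * dd vt (zetaC Φ) z + f.1.2.2 * dd vy (zetaC Φ) z) * e1 - f2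
          + (f.1.1 * dd vt (tauC Φ) z + f.1.2.2 * dd vy (tauC Φ) z) * e2
      _ = 0 := by rw [h, zero_mul]
  exact one_ne_zero this

end Structure

section Structure

variable {Φ : OpenPartialHomeomorph VarSpace VarSpace} {θ θ' : Param} {W : Set VarSpace}

/-- For fixed u_x the t- and y-components of the gradient of the image function can be prescribed
freely, and the second-order condition is affine in them. Comparing the two linear coefficients
gives the diffusion and the transport relation. -/
lemma coefficient_conditions (hΦ : IsPointTransformation Φ) (hmap : MapsEquation Φ θ θ')
    (hW : IsOpen W) (hWs : W ⊆ Φ.source)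
    (hTx : ∀ z ∈ W, dd vx (tauC Φ) z = 0) (hTu : ∀ z ∈ W, dd vu (tauC Φ) z = 0)
    (hYx : ∀ z ∈ W, dd vx (zetaC Φ) z = 0) (hYu : ∀ z ∈ W, dd vu (zetaC Φ) z = 0)
    {z : VarSpace} (hz : z ∈ W) (hr : Regular θ z.1) (hr' : Regular θ' (Φ z).1) {b : ℝ}
    (hb : dd vx (xiC Φ) z + b * dd vu (xiC Φ) z ≠ 0) :
    diffusivity θ' (Φ z).1 * (dd vt (tauC Φ) z + z.1.2.1 * dd vy (tauC Φ) z)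
        = diffusivity θ z.1 * (dd vx (xiC Φ) z + b * dd vu (xiC Φ) z) ^ 2 ∧
      (Φ z).1.2.1 * (dd vt (tauC Φ) z + z.1.2.1 * dd vy (tauC Φ) z)
        = dd vt (zetaC Φ) z + z.1.2.1 * dd vy (zetaC Φ) z := by
  have hzs := hWs hz
  have hd := (hΦ.contDiffAt hzs).diffAt
  have hA : diffusivity θ z.1 ≠ 0 := hr
  have hA' : diffusivity θ' (Φ z).1 ≠ 0 := hr'
  have hΔ := jacobian_ne_zero hΦ hzs (hTx z hz) (hTu z hz) (hYx z hz) (hYu z hz)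
  have L1 : ∀ v : VarSpace, (fderiv ℝ Φ z v).1.1
      = v.1.1 * dd vt (tauC Φ) z + v.1.2.2 * dd vy (tauC Φ) z := fun v => by
    rw [← dd_tauC hd, dd, var_apply]
    simp only [← dd_eq_fderiv, hTx z hz, hTu z hz]
    ring
  have L2 : ∀ v : VarSpace, (fderiv ℝ Φ z v).1.2.1 = v.1.1 * dd vt (xiC Φ) z
      + v.1.2.1 * dd vx (xiC Φ) z + v.1.2.2 * dd vy (xiC Φ) z + v.2 * dd vu (xiC Φ) z := fun v => by
    rw [← dd_xiC hd, dd, var_apply]; rfl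
  have L3 : ∀ v : VarSpace, (fderiv ℝ Φ z v).1.2.2
      = v.1.1 * dd vt (zetaC Φ) z + v.1.2.2 * dd vy (zetaC Φ) z := fun v => by
    rw [← dd_zetaC hd, dd, var_apply]
    simp only [← dd_eq_fderiv, hYx z hz, hYu z hz]
    ring
  have L4 : ∀ v : VarSpace, (fderiv ℝ Φ z v).2 = v.1.1 * dd vt (etaC Φ) z
      + v.1.2.1 * dd vx (etaC Φ) z + v.1.2.2 * dd vy (etaC Φ) z + v.2 * dd vu (etaC Φ) z :=
    fun v => by rw [← dd_etaC hd, dd, var_apply]; rfl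
  set Tt := dd vt (tauC Φ) z
  set Ty := dd vy (tauC Φ) z
  set Yt := dd vt (zetaC Φ) z
  set Yy := dd vy (zetaC Φ) z
  set D := dd vx (xiC Φ) z + b * dd vu (xiC Φ) z with hD
  -- Since T and Y are constant along the graph in the x-direction, the slope b alone fixes the
  -- x-component of the image gradient.
  set m₂ := (dd vx (etaC Φ) z + b * dd vu (etaC Φ) z) / D with hm₂
  have hm₂' : m₂ * D = dd vx (etaC Φ) z + b * dd vu (etaC Φ) z := div_mul_cancel₀ _ hb
  set κ := dd vu (etaC Φ) z - m₂ * dd vu (xiC Φ) z with hκ_def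
  -- Otherwise −X_u ∂_x + X_x ∂_u would be a nonzero kernel vector of the derivative of Φ.
  have hκ : κ ≠ 0 := by
    intro h0
    have h1 : fderiv ℝ Φ z (((0, -dd vu (xiC Φ) z, 0), dd vx (xiC Φ) z) : VarSpace) = 0 := by
      have h2 : dd vx (xiC Φ) z * dd vu (etaC Φ) z = dd vu (xiC Φ) z * dd vx (etaC Φ) z := by
        linear_combination D * h0 + D * hκ_def + dd vu (xiC Φ) z * hm₂' - dd vu (etaC Φ) z * hD
      refine Prod.ext (Prod.ext ?_ (Prod.ext ?_ ?_)) ?_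
      · rw [L1]; simp
      · rw [L2]; simp; ring
      · rw [L3]; simp
      · rw [L4]; simp; linarith
    have h3 := hΦ.fderiv_injective hzs (h1.trans (map_zero _).symm)
    have h4 : -dd vu (xiC Φ) z = 0 := congrArg (fun v : VarSpace => v.1.2.1) h3
    have h5 : dd vx (xiC Φ) z = 0 := congrArg Prod.snd h3
    apply hb
    rw [hD, h5, neg_eq_zero.1 h4]; ring
  have hM : ∀ a c e, (fderiv ℝ Φ z (graphVector a b c e)).1 = 0 → e = 0 := by
    intro a c e he
    have e1 := L1 (graphVector a b c e)
    have e2 := L2 (graphVector a b c e)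
    have e3 := L3 (graphVector a b c e)
    rw [he] at e1 e2 e3
    simp only [graphVector, Prod.fst_zero, Prod.snd_zero] at e1 e2 e3
    have k1 : (Yy * Tt - Yt * Ty) * e.1 = 0 := by linear_combination Ty * e3 - Yy * e1
    have k3 : (Yy * Tt - Yt * Ty) * e.2.2 = 0 := by linear_combination Yt * e1 - Tt * e3
    replace k1 := (mul_eq_zero.1 k1).resolve_left hΔ
    replace k3 := (mul_eq_zero.1 k3).resolve_left hΔ
    have k2 : D * e.2.1 = 0 := by
      rw [k1, k3] at e2
      linear_combination -e2
    replace k2 := (mul_eq_zero.1 k2).resolve_left hb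
    exact Prod.ext k1 (Prod.ext k2 k3)
  set ν : VarSpace := ((0, D⁻¹, 0), b * D⁻¹) with hν
  have hνT : dd ν (dd ν (tauC Φ)) z = 0 := by
    refine dd_zero_on hW (fun w hw => ?_) ν z hz
    rw [dd, var_apply]
    simp [← dd_eq_fderiv, hTx w hw, hTu w hw, hν]
  have hνY : dd ν (dd ν (zetaC Φ)) z = 0 := by
    refine dd_zero_on hW (fun w hw => ?_) ν z hz
    rw [dd, var_apply]
    simp [← dd_eq_fderiv, hYx w hw, hYu w hw, hν]
  have J : ∀ m₁ m₃ : ℝ, m₁ + (Φ z).1.2.1 * m₃ = diffusivity θ' (Φ z).1 *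
      (dd ν (dd ν (etaC Φ)) z - m₂ * dd ν (dd ν (xiC Φ)) z
        + (m₁ * (Tt + z.1.2.1 * Ty) + m₃ * (Yt + z.1.2.1 * Yy)
          - (dd vt (etaC Φ) z - m₂ * dd vt (xiC Φ) z)
          - z.1.2.1 * (dd vy (etaC Φ) z - m₂ * dd vy (xiC Φ) z)) / (diffusivity θ z.1 * D ^ 2)) := by
    intro m₁ m₃
    -- These are the values of u_t and u_y for which the image gradient is (m₁, m₂, m₃).
    set a := (m₁ * Tt + m₃ * Yt - (dd vt (etaC Φ) z - m₂ * dd vt (xiC Φ) z)) / κ with ha_def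
    set c := (m₁ * Ty + m₃ * Yy - (dd vy (etaC Φ) z - m₂ * dd vy (xiC Φ) z)) / κ with hc_def
    have ha : a * κ = _ := div_mul_cancel₀ _ hκ
    have hc : c * κ = _ := div_mul_cancel₀ _ hκ
    have key := jet_condition (m := (m₁, m₂, m₃)) (n := (0, D⁻¹, 0)) (h₁ := 0) (h₃ := 0)
      (h₂ := (a + z.1.2.1 * c) / diffusivity θ z.1) (ν := ν) hΦ hmap hzs hr hr' (hM a c) ?_ ?_
      (mul_div_cancel₀ _ hA).symm (by simp [graphVector, hν])
    · rw [hνT, hνY, hTu z hz, hYu z hz] at key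
      simp only at key
      rw [key]
      have : a + z.1.2.1 * c = (m₁ * (Tt + z.1.2.1 * Ty) + m₃ * (Yt + z.1.2.1 * Yy)
          - (dd vt (etaC Φ) z - m₂ * dd vt (xiC Φ) z)
          - z.1.2.1 * (dd vy (etaC Φ) z - m₂ * dd vy (xiC Φ) z)) / κ := by
        rw [ha_def, hc_def]; ring
      rw [this]
      rw [show dd vu (etaC Φ) z - m₁ * 0 - m₂ * dd vu (xiC Φ) z - m₃ * 0 = κ by rw [hκ_def]; ring]
      field_simp
      ring
    · refine Prod.ext ?_ (Prod.ext ?_ ?_)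
      · rw [L1]; simp [graphVector]
      · rw [L2]; simp only [graphVector]
        have : D * D⁻¹ = 1 := mul_inv_cancel₀ hb
        linear_combination this - D⁻¹ * hD
      · rw [L3]; simp [graphVector]
    · intro e
      rw [L1, L2, L3, L4]
      simp only [graphVector]
      linear_combination e.1 * ha + e.2.2 * hc - e.2.1 * hm₂' + e.2.1 * m₂ * hD
        - (a * e.1 + c * e.2.2) * hκ_def
  have J0 := J 0 0
  have J1 := J 1 0
  have J3 := J 0 1
  have K1 : 1 = diffusivity θ' (Φ z).1 * (Tt + z.1.2.1 * Ty) / (diffusivity θ z.1 * D ^ 2) := by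
    linear_combination J1 - J0
  have K3 : (Φ z).1.2.1
      = diffusivity θ' (Φ z).1 * (Yt + z.1.2.1 * Yy) / (diffusivity θ z.1 * D ^ 2) := by
    linear_combination J3 - J0
  have hAD : diffusivity θ z.1 * D ^ 2 ≠ 0 := mul_ne_zero hA (pow_ne_zero 2 hb)
  have K1' : diffusivity θ z.1 * D ^ 2 = diffusivity θ' (Φ z).1 * (Tt + z.1.2.1 * Ty) := by
    field_simp at K1
    linear_combination K1
  refine ⟨K1'.symm, ?_⟩
  rw [eq_div_iff hAD, K1'] at K3
  refine mul_left_cancel₀ hA' ?_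
  linear_combination K3

end Structure

section TYLemmas

variable {O : Set VarSpace} {f g : VarSpace → ℝ}

lemma TY.mul (hf : TY O f) (hg : TY O g) (hO : IsOpen O) : TY O (fun z => f z * g z) where
  smooth := hf.smooth.mul hg.smooth
  dx z hz := by rw [dd_mul (hf.diff hO hz) (hg.diff hO hz), hf.dx z hz, hg.dx z hz]; ring
  du z hz := by rw [dd_mul (hf.diff hO hz) (hg.diff hO hz), hf.du z hz, hg.du z hz]; ring

lemma TY.sub (hf : TY O f) (hg : TY O g) (hO : IsOpen O) : TY O (fun z => f z - g z) where
  smooth := hf.smooth.sub hg.smooth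
  dx z hz := by rw [dd_sub (hf.diff hO hz) (hg.diff hO hz), hf.dx z hz, hg.dx z hz, sub_zero]
  du z hz := by rw [dd_sub (hf.diff hO hz) (hg.diff hO hz), hf.du z hz, hg.du z hz, sub_zero]

lemma dd_affine (hf : TY O f) (hg : TY O g) (hO : IsOpen O) {z : VarSpace} (hz : z ∈ O) :
    dd vx (fun w => f w + w.1.2.1 * g w) z = g z ∧
      dd vu (fun w => f w + w.1.2.1 * g w) z = 0 := by
  have hx : DifferentiableAt ℝ (fun w : VarSpace => w.1.2.1) z := by fun_prop
  constructor
  · rw [dd_add (hf.diff hO hz) (hx.fun_mul (hg.diff hO hz)), dd_mul hx (hg.diff hO hz), dd_coord_x,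
      hf.dx z hz, hg.dx z hz]
    simp [vx]
  · rw [dd_add (hf.diff hO hz) (hx.fun_mul (hg.diff hO hz)), dd_mul hx (hg.diff hO hz), dd_coord_x,
      hf.du z hz, hg.du z hz]
    simp [vu]

end TYLemmas

lemma dd_abs_sub_rpow {f : VarSpace → ℝ} {z : VarSpace} (hf : DifferentiableAt ℝ f z) {α : ℝ}
    (β : ℝ) (h : f z ≠ α) (e : VarSpace) :
    DifferentiableAt ℝ (fun w => |f w - α| ^ β) z ∧
      dd e (fun w => |f w - α| ^ β) z = β * |f z - α| ^ β / (f z - α) * dd e f z := by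
  have h1 : HasFDerivAt (fun w => |f w - α| ^ β)
      ((β * |f z - α| ^ β / (f z - α)) • fderiv ℝ f z) z :=
    (hasDerivAt_abs_rpow_div β (sub_ne_zero.2 h)).comp_hasFDerivAt (f := fun w => f w - α) z
      (hf.hasFDerivAt.sub_const α)
  refine ⟨h1.differentiableAt, ?_⟩
  rw [dd, h1.fderiv]
  rfl

lemma exists_mem_x_ne {O : Set VarSpace} (hO : IsOpen O) (hne : O.Nonempty) (a : ℝ) :
    ∃ z ∈ O, z.1.2.1 ≠ a := by
  by_contra! h
  obtain ⟨z, hz⟩ := hne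
  have h1 := dd_eqOn (g := fun _ => a) hO h vx z hz
  rw [dd_coord_x, dd_const] at h1
  exact one_ne_zero h1

section Structure

variable {Φ : OpenPartialHomeomorph VarSpace VarSpace} {θ θ' : Param} {W : Set VarSpace}

/-- Open sets are not contained in hyperplanes x = const, and Φ is open, so the singular values of x
can be avoided for source and target simultaneously. -/
lemma exists_isOpen_x_ne (hW : IsOpen W) (hne : W.Nonempty) (hWs : W ⊆ Φ.source) (a a' : ℝ) :
    ∃ W' ⊆ W, IsOpen W' ∧ W'.Nonempty ∧ ∀ z ∈ W', z.1.2.1 ≠ a ∧ (Φ z).1.2.1 ≠ a' := by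
  have hc : Continuous fun z : VarSpace => z.1.2.1 := by fun_prop
  have hW₁ : IsOpen (W ∩ {z | z.1.2.1 ≠ a}) := hW.inter (isOpen_ne_fun hc continuous_const)
  have hs : W ∩ {z | z.1.2.1 ≠ a} ⊆ Φ.source := inter_subset_left.trans hWs
  obtain ⟨z₁, hz₁, hz₁'⟩ := exists_mem_x_ne hW hne a
  obtain ⟨_, ⟨z, hz, rfl⟩, hz'⟩ := exists_mem_x_ne (Φ.isOpen_image_of_subset_source hW₁ hs)
    (Set.Nonempty.image Φ ⟨z₁, hz₁, hz₁'⟩) a'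
  exact ⟨(W ∩ {z | z.1.2.1 ≠ a}) ∩ Φ ⁻¹' {z | z.1.2.1 ≠ a'}, inter_subset_left.trans inter_subset_left,
    (Φ.continuousOn.mono hs).isOpen_inter_preimage hW₁ (isOpen_ne_fun hc continuous_const),
    ⟨z, hz, hz'⟩, fun w hw => ⟨hw.1.2, hw.2⟩⟩

/-- Conditions on the parameters and the components of an admissible transformation. -/
lemma admissible_conditions (hΦ : IsPointTransformation Φ) (hmap : MapsEquation Φ θ θ')
    (hW : IsOpen W) (hne : W.Nonempty) (hWs : W ⊆ Φ.source) :
    ∃ W' ⊆ W, IsOpen W' ∧ W'.Nonempty ∧ ∀ z ∈ W', ∃ c d a b : ℝ,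
      c = dd vt (tauC Φ) z + θ.1 * dd vy (tauC Φ) z ∧ d = dd vy (tauC Φ) z ∧ b * c - a * d ≠ 0 ∧
      θ.2 * (c * a) = 0 ∧ θ'.2 * (b * c - a * d) = θ.2 * (c * b) + (θ.2 - 5) * (d * a) ∧
      (5 - θ.2) * (d * b) = 0 := by
  obtain ⟨W', hW'W, hO, hW'ne, hx⟩ := exists_isOpen_x_ne hW hne hWs θ.1 θ'.1
  refine ⟨W', hW'W, hO, hW'ne, ?_⟩
  obtain ⟨α, β⟩ := θ
  obtain ⟨α', β'⟩ := θ'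
  simp only at hx ⊢
  have hs : W' ⊆ Φ.source := hW'W.trans hWs
  have hr : ∀ z ∈ W', Regular (α, β) z.1 := fun z hz => regular_of_ne (hx z hz).1
  have hr' : ∀ z ∈ W', Regular (α', β') (Φ z).1 := fun z hz => regular_of_ne (hx z hz).2
  have hΦC := fun z hz => hΦ.contDiffAt (hs (a := z) hz)
  have hproj := fun z hz => projectable hΦ hmap (hs (a := z) hz) (hr z hz) (hr' z hz)
  have TT : TY W' (tauC Φ) := ⟨fun z hz => (hΦC z hz).tauC.contDiffWithinAt,
    fun z hz => (hproj z hz).1, fun z hz => (hproj z hz).2.1⟩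
  have TYY : TY W' (zetaC Φ) := ⟨fun z hz => (hΦC z hz).zetaC.contDiffWithinAt,
    fun z hz => (hproj z hz).2.2.1, fun z hz => (hproj z hz).2.2.2.1⟩
  have hcoef := fun z hz b hb => coefficient_conditions (b := b) hΦ hmap hO hs TT.dx TT.du TYY.dx
    TYY.du (z := z) hz (hr z hz) (hr' z hz) hb
  have hX : ∀ z ∈ W', DifferentiableAt ℝ (xiC Φ) z := fun z hz => (hΦC z hz).xiC.diffAt
  have hJ := fun z hz => jacobian_ne_zero hΦ (hs (a := z) hz) (TT.dx z hz) (TT.du z hz) (TYY.dx z hz)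
    (TYY.du z hz)
  set Tt := dd vt (tauC Φ)
  set Ty := dd vy (tauC Φ)
  set Yt := dd vt (zetaC Φ)
  set Yy := dd vy (zetaC Φ)
  have hTt : TY W' Tt := TT.dd hO vt
  have hTy : TY W' Ty := TT.dd hO vy
  have hYt : TY W' Yt := TYY.dd hO vt
  have hYy : TY W' Yy := TYY.dd hO vy
  set S : VarSpace → ℝ := fun w => Tt w + w.1.2.1 * Ty w with hS
  have hSd : ∀ z ∈ W', DifferentiableAt ℝ S z := fun z hz =>
    (hTt.diff hO hz).fun_add (DifferentiableAt.fun_mul (by fun_prop) (hTy.diff hO hz))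
  have hS0 : ∀ z ∈ W', S z ≠ 0 := by
    intro z hz h
    obtain ⟨b, hb⟩ := (hproj z hz).2.2.2.2
    have h1 := (hcoef z hz b hb).1
    rw [show Tt z + z.1.2.1 * Ty z = 0 from h, mul_zero] at h1
    exact mul_ne_zero (hr z hz) (pow_ne_zero 2 hb) h1.symm
  -- Thus X is fractional linear in x, with denominator S.
  have hXS : ∀ z ∈ W', xiC Φ z * S z = Yt z + z.1.2.1 * Yy z := by
    intro z hz
    obtain ⟨b, hb⟩ := (hproj z hz).2.2.2.2
    exact (hcoef z hz b hb).2
  have hXu : ∀ z ∈ W', dd vu (xiC Φ) z = 0 := by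
    intro z hz
    have h1 := dd_eqOn hO hXS vu z hz
    rw [dd_mul (hX z hz) (hSd z hz), (dd_affine hTt hTy hO hz).2, (dd_affine hYt hYy hO hz).2,
      mul_zero, add_zero] at h1
    exact (mul_eq_zero.1 h1).resolve_right (hS0 z hz)
  have hXx : ∀ z ∈ W', dd vx (xiC Φ) z * S z ^ 2 = Yy z * Tt z - Yt z * Ty z := by
    intro z hz
    have h1 := dd_eqOn hO hXS vx z hz
    rw [dd_mul (hX z hz) (hSd z hz), (dd_affine hTt hTy hO hz).1, (dd_affine hYt hYy hO hz).1] at h1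
    have h2 : S z = Tt z + z.1.2.1 * Ty z := rfl
    linear_combination S z * h1 - Ty z * hXS z hz + Yy z * h2
  have hDelta : TY W' fun z => Yy z * Tt z - Yt z * Ty z :=
    (hYy.mul hTt hO).sub (hYt.mul hTy hO) hO
  -- The diffusion relation after substituting X_x = Δ/S², where Δ is the Jacobian of (T, Y) in (t,
  -- y).
  have hAS : ∀ z ∈ W', |xiC Φ z - α'| ^ β' * S z ^ 5
      = |z.1.2.1 - α| ^ β * (Yy z * Tt z - Yt z * Ty z) ^ 2 := by
    intro z hz
    obtain ⟨b, hb⟩ := (hproj z hz).2.2.2.2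
    have h1 : |xiC Φ z - α'| ^ β' * S z
        = |z.1.2.1 - α| ^ β * (dd vx (xiC Φ) z + b * dd vu (xiC Φ) z) ^ 2 := (hcoef z hz b hb).1
    rw [hXu z hz, mul_zero, add_zero] at h1
    rw [← hXx z hz]
    linear_combination S z ^ 4 * h1
  -- With s = x − α, c = T_t + αT_y and d = T_y, one has S = c + ds and S(X − α') = a + bs, where Δ
  -- = bc − ad.
  have hC : TY W' fun z => Tt z + α * Ty z := hTt.add (hTy.const_mul hO α) hO
  have hB : TY W' fun z => Yy z - α' * Ty z := hYy.sub (hTy.const_mul hO α') hO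
  have hA : TY W' fun z => (Yt z - α' * Tt z) + α * (Yy z - α' * Ty z) :=
    (hYt.sub (hTt.const_mul hO α') hO).add (hB.const_mul hO α) hO
  obtain ⟨k0, k1, k2⟩ := polynomial_eq_zero hO ((hC.mul hA hO).const_mul hO (-β))
    ((((hDelta.const_mul hO β').add ((hTy.mul hA hO).const_mul hO (5 - β)) hO)).sub
      ((hC.mul hB hO).const_mul hO β) hO) ((hTy.mul hB hO).const_mul hO (5 - β)) α (by
    intro z hz
    have hxz : DifferentiableAt ℝ (fun w : VarSpace => w.1.2.1) z := by fun_prop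
    have s0 := sub_ne_zero.2 (hx z hz).1
    have r0 : xiC Φ z - α' ≠ 0 := sub_ne_zero.2 (hx z hz).2
    obtain ⟨d1, e1⟩ := dd_abs_sub_rpow (hX z hz) β' (hx z hz).2 vx
    obtain ⟨d2, e2⟩ := dd_abs_sub_rpow hxz β (hx z hz).1 vx
    have dS5 : DifferentiableAt ℝ (fun w => S w ^ 5) z := (hSd z hz).fun_pow 5
    have dD2 : DifferentiableAt ℝ (fun w => (Yy w * Tt w - Yt w * Ty w) ^ 2) z :=
      (hDelta.diff hO hz).fun_pow 2
    have h1 := dd_eqOn hO hAS vx z hz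
    rw [dd_mul d1 dS5, dd_mul d2 dD2, dd_pow (hSd z hz), dd_pow (hDelta.diff hO hz), hDelta.dx z hz,
      e1, e2, (dd_affine hTt hTy hO hz).1, dd_coord_x] at h1
    have h2 : |xiC Φ z - α'| ^ β' ≠ 0 := hr' z hz
    have h3 := hAS z hz
    have h4 := hXx z hz
    have h5 := hXS z hz
    have h6 : S z = Tt z + z.1.2.1 * Ty z := rfl
    simp only [vx] at h1
    -- The logarithmic x-derivative β'X_x/(X − α') + 5T_y/S = β/(x − α), with denominators cleared.
    have h7 : β' * dd (((0, 1, 0), 0) : VarSpace) (xiC Φ) z * S z * (z.1.2.1 - α)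
        + 5 * Ty z * (xiC Φ z - α') * (z.1.2.1 - α) = β * S z * (xiC Φ z - α') := by
      refine mul_left_cancel₀ (mul_ne_zero h2 (pow_ne_zero 4 (hS0 z hz))) ?_
      push_cast at h1
      field_simp at h1
      linear_combination h1 - β * (xiC Φ z - α') * h3
    have h8 : dd (((0, 1, 0), 0) : VarSpace) (xiC Φ) z = dd vx (xiC Φ) z := rfl
    rw [h8] at h7
    have h9 : S z * (xiC Φ z - α')
        = (Yt z - α' * Tt z) + α * (Yy z - α' * Ty z) + (Yy z - α' * Ty z) * (z.1.2.1 - α) := by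
      linear_combination h5 - α' * h6
    linear_combination S z * h7 - β' * (z.1.2.1 - α) * h4
      - (5 * Ty z * (z.1.2.1 - α) - β * S z) * h9
      + β * ((Yt z - α' * Tt z) + α * (Yy z - α' * Ty z)
        + (Yy z - α' * Ty z) * (z.1.2.1 - α)) * h6)
  intro z hz
  have q0 := k0 z hz
  have q1 := k1 z hz
  have q2 := k2 z hz
  refine ⟨_, _, (Yt z - α' * Tt z) + α * (Yy z - α' * Ty z), Yy z - α' * Ty z, rfl, rfl,
    fun h => hJ z hz (by linear_combination h), by linear_combination -q0, by linear_combination q1,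
    q2⟩

end Structure

/-! ### Inequivalence -/

/-- From db = 0, either factor being zero reduces the relation for β' to a nonzero multiple of Δ
being 0. -/
lemma not_groupoidEquivalent_zero_two : ¬ GroupoidEquivalent (0, 0) (0, 2) := by
  rintro ⟨Φ, hΦ, hmap⟩
  obtain ⟨W, -, -, ⟨z, hz⟩, h⟩ := admissible_conditions hΦ hmap Φ.open_source hΦ.1 subset_rfl
  obtain ⟨c, d, a, b, -, -, h0, -, h2, h3⟩ := h z hz
  simp only at h2 h3
  apply h0
  rcases mul_eq_zero.1 ((mul_eq_zero.1 h3).resolve_left (by norm_num)) with h | h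
  · rw [h] at h2 ⊢
    linarith
  · rw [h] at h2 ⊢
    linarith

lemma not_groupoidEquivalent_two_zero : ¬ GroupoidEquivalent (0, 2) (0, 0) := by
  rintro ⟨Φ, hΦ, hmap⟩
  obtain ⟨W, -, -, ⟨z, hz⟩, h⟩ := admissible_conditions hΦ hmap Φ.open_source hΦ.1 subset_rfl
  obtain ⟨c, d, a, b, -, -, h0, -, h2, h3⟩ := h z hz
  simp only at h2 h3
  apply h0
  rcases mul_eq_zero.1 ((mul_eq_zero.1 h3).resolve_left (by norm_num)) with h | h
  · rw [h] at h2 ⊢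
    linarith
  · rw [h] at h2 ⊢
    linarith

/-- Changing β requires T_y ≠ 0. The same Φ must also act on (0, 1) and (1, 1), where T_y ≠ 0 forces
T_t + αT_y = 0 for both α = 0 and α = 1. -/
lemma not_groupEquivalent {β β' : ℝ} (hβ : β ≠ β') : ¬ GroupEquivalent (0, β) (0, β') := by
  rintro ⟨Φ, Ψ, ⟨hΦ, -, -, hmap⟩, hΨ⟩
  have h₀ := hmap (0, β)
  rw [hΨ] at h₀
  -- The open sets are nested so that the conditions for all three equations hold at one common
  -- point.
  obtain ⟨W₀, s₀, o₀, n₀, k₀⟩ := admissible_conditions hΦ h₀ Φ.open_source hΦ.1 subset_rfl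
  obtain ⟨W₁, s₁, o₁, n₁, k₁⟩ := admissible_conditions hΦ (hmap (0, 1)) o₀ n₀ s₀
  obtain ⟨W₂, s₂, -, ⟨z, hz⟩, k₂⟩ :=
    admissible_conditions hΦ (hmap (1, 1)) o₁ n₁ (s₁.trans s₀)
  obtain ⟨c₀, d₀, a₀, b₀, -, hd₀, hJ₀, -, h₀', -⟩ := k₀ z (s₁ (s₂ hz))
  obtain ⟨c₁, d₁, a₁, b₁, hc₁, hd₁, hJ₁, h₁, -, h₁'⟩ := k₁ z (s₂ hz)
  obtain ⟨c₂, d₂, a₂, b₂, hc₂, hd₂, hJ₂, h₂, -, h₂'⟩ := k₂ z hz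
  simp only at h₀' h₁ h₁' h₂ h₂' hc₁ hc₂
  rw [← hd₀] at hc₁ hc₂ hd₁ hd₂
  subst d₁ d₂
  have hd : d₀ ≠ 0 := by
    rintro rfl
    have h4 : (β' - β) * (b₀ * c₀ - a₀ * 0) = 0 := by linear_combination h₀'
    exact (mul_eq_zero.1 h4).elim (fun h => hβ (by linarith)) hJ₀
  -- For β = 1 and d ≠ 0: db = 0 gives b = 0, so Δ = −ad is nonzero, hence a ≠ 0 and ca = 0 gives c
  -- = 0.
  have aux : ∀ {a b c : ℝ}, b * c - a * d₀ ≠ 0 → 1 * (c * a) = 0 → (5 - 1) * (d₀ * b) = 0 →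
      c = 0 := by
    intro a b c hJ h h'
    have hb : b = 0 := ((mul_eq_zero.1 h').resolve_left (by norm_num) |> mul_eq_zero.1).resolve_left hd
    rw [one_mul] at h
    refine (mul_eq_zero.1 h).resolve_right fun ha => hJ ?_
    rw [ha, hb]; ring
  have e₁ := aux hJ₁ h₁ h₁'
  have e₂ := aux hJ₂ h₂ h₂'
  exact hd (by linarith)
-- Assembly of the classification.
theorem mainTheorem6 :
    -- the kernel algebras of the two classes coincide
    (∀ Ω : TopologicalSpace.Opens Base, IsConnected (Ω : Set Base) →
      kernelAlgebraF Ω = kernelAlgebraF' Ω ∧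
      kernelAlgebraF' Ω = spanOver Ω {fieldPt, fieldPy, fieldI,
        fieldZ (fun (t, x, y) => t * x - y), fieldZ (fun (_, x, _) => x), fieldZ (fun _ => 1)}) ∧
    -- every equation of the class admits the general algebra
    (∀ (θ : Param) (Ω : TopologicalSpace.Opens Base), IsRegularDomain θ Ω →
      generalAlgebra θ Ω ≤ maximalAlgebra θ Ω) ∧
    -- gauging of the parameter `β`
    (∀ θ : Param, ∃ θ' : Param, θ'.2 ≤ 5 / 2 ∧ GroupoidEquivalent θ θ') ∧
    -- the classification up to the equivalence groupoid
    IsCompleteExtensionList GroupoidEquivalent {(0, 0), (0, 2)} ∧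
    (∀ Ω : TopologicalSpace.Opens Base, IsRegularDomain (0, 0) Ω →
      maximalAlgebra (0, 0) Ω
        = generalAlgebra (0, 0) Ω ⊔ spanOver Ω {fieldK0, fieldP3, fieldP2, fieldP1} ∧
      Disjoint (generalAlgebra (0, 0) Ω) (spanOver Ω {fieldK0, fieldP3, fieldP2, fieldP1})) ∧
    (∀ Ω : TopologicalSpace.Opens Base, IsRegularDomain (0, 2) Ω →
      maximalAlgebra (0, 2) Ω = generalAlgebra (0, 2) Ω ⊔ spanOver Ω {fieldK2} ∧
      Disjoint (generalAlgebra (0, 2) Ω) (spanOver Ω {fieldK2})) ∧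
    -- the classification up to the equivalence group
    IsCompleteExtensionList GroupEquivalent {(0, 0), (0, 2), (0, 3), (0, 5)} := by
  refine ⟨fun Ω hΩ => ?_, fun θ Ω _ => generalAlgebra_le θ Ω, fun θ => ?_, ⟨?_, ?_, ?_⟩,
    fun Ω hΩ => ⟨maximalAlgebra_zero hΩ, disjoint_zero hΩ⟩,
    fun Ω hΩ => ⟨maximalAlgebra_two hΩ, disjoint_two hΩ⟩, ?_, ?_, ?_⟩
  · have h := (kernelAlgebraF'_le hΩ).trans (le_kernelAlgebraF Ω)
    exact ⟨le_antisymm (kernelAlgebraF_le Ω) h, le_antisymm (kernelAlgebraF'_le hΩ)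
      ((le_kernelAlgebraF Ω).trans (kernelAlgebraF_le Ω))⟩
  · rcases le_total θ.2 (5 / 2) with h | h
    · exact ⟨(0, θ.2), h, groupoidEquivalent_shift θ⟩
    · exact ⟨(0, 5 - θ.2), by simp only; linarith, groupoidEquivalent_inversion θ⟩
  · rintro θ (rfl | rfl) Ω hΩ
    exacts [hasExtension_zero hΩ, hasExtension_two hΩ]
  · intro θ Ω hΩ hE
    have h₁ := groupoidEquivalent_shift θ
    have h₂ := groupoidEquivalent_inversion θ
    -- The shift handles β = 0 and β = 2; the inversion takes β = 3 to 2 and β = 5 to 0.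
    rcases eq_of_hasExtension hΩ hE with h | h | h | h <;> rw [h] at h₁ h₂
    · exact ⟨_, Or.inl rfl, h₁⟩
    · exact ⟨_, Or.inr rfl, h₁⟩
    · exact ⟨_, Or.inr rfl, by norm_num at h₂; exact h₂⟩
    · exact ⟨_, Or.inl rfl, by norm_num at h₂; exact h₂⟩
  · rintro _ (rfl | rfl) _ (rfl | rfl) h
    exacts [absurd rfl h, not_groupoidEquivalent_zero_two, not_groupoidEquivalent_two_zero,
      absurd rfl h]
  · rintro θ (rfl | rfl | rfl | rfl) Ω hΩ
    exacts [hasExtension_zero hΩ, hasExtension_two hΩ, hasExtension_three hΩ, hasExtension_five hΩ]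
  · intro θ Ω hΩ hE
    refine ⟨(0, θ.2), ?_, groupEquivalent_shift θ⟩
    rcases eq_of_hasExtension hΩ hE with h | h | h | h <;> simp [h]
  · have key : ∀ θ ∈ ({(0, 0), (0, 2), (0, 3), (0, 5)} : Set Param), θ = (0, θ.2) := by
      rintro θ (rfl | rfl | rfl | rfl) <;> rfl
    intro θ hθ θ' hθ' hne
    rw [key θ hθ, key θ' hθ'] at hne ⊢
    exact not_groupEquivalent fun h => hne (by rw [h])
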